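/- **Setting.** Let $G=(V,E)$ be a finite connected simple graph that is series-parallel, i.e. every biconnected component of $G$ having at least one edge is obtained from single edges by iterated series and parallel compositions of two-terminal graphs. Let $w:E\to\mathbb Z_{\ge 1}$ be edge weights such that every edge is a shortest path between its endpoints and shortest paths are unique: between any two vertices there is exactly one path of minimum total weight. (For $w\equiv 1$ the first condition is automatic.) Let $r\in V$ and let $T$ be a BFS tree with root $r$: a spanning tree of $G$ whose paths from $r$ are shortest paths of $(G,w)$. Edges in $E\setminus E(T)$ are called cross edges. Ancestors, parents and least common ancestors (lca) are taken in the rooted tree $T$; two distinct vertices are unrelated if neither is an ancestor of the other. A shortest cross-edge path is a shortest path of $(G,w)$ whose first and last edges are cross edges. **Hammocks.** A hammock is an induced subgraph $H$ of $G$ whose vertex set is a disjoint union $A\sqcup A'$ such that $T[A]$ and $T[A']$ are connected, $H$ consists of these two trees and the cross edges between them, there is at least one such cross edge, and the highest vertices of $A$ and $A'$ in $T$ (the hammock roots) are unrelated. We write $r_i, r_i'$ for the two roots of a hammock $H_i$, in a chosen order. **Forests of hammocks.** For a family $\mathcal H=\{H_i\}$ of hammocks let $G[\mathcal H]$ be the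 union of the $H_i$. Pairwise edge-disjoint hammocks form a tree of hammocks if $G[\mathcal H]$ is connected and each simple cycle of $G[\mathcal H]$ has edges in exactly one $H_i$. They form a rooted forest of hammocks if, for every connected component of $G[\mathcal H]$, the hammocks meeting it form a tree of hammocks, exactly one of which is designated as root hammock. In a tree of hammocks with root hammock $H_k$, the parent of $H_j\ne H_k$ is $H_k$ if $H_j$ and $H_k$ share a vertex, and otherwise the hammock containing the first edge of any path in $G[\mathcal H]$ that starts in $H_j$, ends in $H_k$ and has no other vertex in $H_j$ or $H_k$. For a subtree $T_0$ of $T$, a rooted forest of hammocks is lca-respecting with base tree $T_0$ if - whenever $H_i$ is the parent of $H_j$: $V(H_i)\cap V(H_j)=\{r_j\}$, the parent of $r_j'$ in $T$ is $\mathrm{lca}(r_j,r_j')$, and $\mathrm{lca}(r_j,r_j')\in V(H_i)\cup\{\mathrm{lca}(r_i,r_i')\}$; - for every root hammock $H_k$: $r_k\in V(T_0)$, the parent in $T$ of both $r_k$ and $r_k'$ is $\mathrm{lca}(r_k,r_k')$, and $\mathrm{lca}(r_k,r_k')\in V(T_0)$. **Theorem.** For every such $(G,w,r,T)$ there is a hammock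 decomposition, that is, a partition $$E = E(T_0)\sqcup E(\mathcal H)\sqcup E_p,$$ where $T_0$ is a subtree of $T$ containing $r$; $\mathcal H$ is a rooted forest of hammocks that is lca-respecting with base tree $T_0$ and such that $G[\mathcal H]$ contains every shortest cross-edge path; $E(\mathcal H)=\bigcup_i E(H_i)$; and $E_p$ consists of the parent edges in $T$ of the roots $r_i'$, one for each $H_i\in\mathcal H$. Moreover, there is a deterministic algorithm (a program of a random access machine with unit-cost addition, subtraction, comparison and indirect addressing) which, given $(G,w,r,T)$ with $V=\{0,\dots,n-1\}$, outputs such a decomposition within a number of steps bounded by a polynomial in $n$. -/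

import Mathlib

/-! ### Series-parallel graphs -/

section SeriesParallel

variable {V : Type*} {G : SimpleGraph V}

/-- `IsTwoTerminalSP H s t`: the subgraph `H` is two-terminal series-parallel with source `s` and
sink `t`, i.e. it arises from single edges by series and parallel compositions. Identifying
terminals is expressed by letting the two parts overlap in exactly these vertices. -/
inductive IsTwoTerminalSP : G.Subgraph → V → V → Prop
  | edge {s t : V} (h : G.Adj s t) : IsTwoTerminalSP (G.subgraphOfAdj h) s t
  | series {H₁ H₂ : G.Subgraph} {s m t : V} :
      IsTwoTerminalSP H₁ s m → IsTwoTerminalSP H₂ m t → H₁.verts ∩ H₂.verts = {m} →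
      IsTwoTerminalSP (H₁ ⊔ H₂) s t
  | parallel {H₁ H₂ : G.Subgraph} {s t : V} :
      IsTwoTerminalSP H₁ s t → IsTwoTerminalSP H₂ s t → H₁.verts ∩ H₂.verts = {s, t} →
      Disjoint H₁.edgeSet H₂.edgeSet → IsTwoTerminalSP (H₁ ⊔ H₂) s t

/-- Connected, and still connected after the deletion of any one vertex (a single vertex
counts as biconnected). -/
def IsBiconnected (H : G.Subgraph) : Prop :=
  H.Connected ∧ ∀ v ∈ H.verts, (H.deleteVerts {v}).Preconnected

/-- Every biconnected component is two-terminal series-parallel for some pair of terminals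
(components without an edge, i.e. isolated vertices, are ignored). -/
def IsSeriesParallel (G : SimpleGraph V) : Prop :=
  ∀ B : G.Subgraph, Maximal IsBiconnected B → B.edgeSet.Nonempty →
    ∃ s t : V, IsTwoTerminalSP B s t

end SeriesParallel

/-! ### Weighted shortest paths and BFS trees -/

section Trees

variable {V : Type*}

/-- Total weight of a walk. -/
def walkWeight {G : SimpleGraph V} (w : Sym2 V → ℕ) {u v : V} (p : G.Walk u v) : ℕ :=
  (p.edges.map w).sum

/-- `p` is a shortest path of the weighted graph `(G, w)`. -/
def IsShortestPath {G : SimpleGraph V} (w : Sym2 V → ℕ) {u v : V} (p : G.Walk u v) : Prop :=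
  p.IsPath ∧ ∀ q : G.Walk u v, walkWeight w p ≤ walkWeight w q

/-- `T` is a BFS tree of `(G, w)` with root `r`: a spanning tree all of whose paths from `r` are
shortest paths of `(G, w)`. -/
structure IsBFSTree (G : SimpleGraph V) (w : Sym2 V → ℕ) (r : V) (T : SimpleGraph V) : Prop where
  le : T ≤ G
  isTree : T.IsTree
  shortest : ∀ (v : V) (p : T.Walk r v), p.IsPath → IsShortestPath w (p.mapLe le)

/-- The standing assumptions: `G` is a connected series-parallel graph, the edge weights are
positive integers, every edge is a shortest path between its endpoints, shortest paths are unique,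
and `T` is a BFS tree with root `r`. -/
structure IsInstance (G : SimpleGraph V) (w : Sym2 V → ℕ) (r : V) (T : SimpleGraph V) : Prop where
  connected : G.Connected
  seriesParallel : IsSeriesParallel G
  weight_pos : ∀ e ∈ G.edgeSet, 1 ≤ w e
  edge_shortest : ∀ (u v : V) (h : G.Adj u v), IsShortestPath w h.toWalk
  unique_shortest : ∀ (u v : V) (p q : G.Walk u v),
    IsShortestPath w p → IsShortestPath w q → p = q
  bfs : IsBFSTree G w r T

/-- `u` equals `v` or is an ancestor of `v` in the tree `T` rooted at `r`. -/
def AncestorOrEq (T : SimpleGraph V) (r u v : V) : Prop :=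
  ∃ p : T.Walk r v, p.IsPath ∧ u ∈ p.support

/-- `c` is the least common ancestor of `u` and `v`. -/
def IsLca (T : SimpleGraph V) (r c u v : V) : Prop :=
  AncestorOrEq T r c u ∧ AncestorOrEq T r c v ∧
    ∀ b, AncestorOrEq T r b u → AncestorOrEq T r b v → AncestorOrEq T r b c

/-- `c` is the parent of `v`. -/
def IsTreeParent (T : SimpleGraph V) (r c v : V) : Prop :=
  T.Adj c v ∧ AncestorOrEq T r c v

/-- `a = high(S)`: the vertex of `S` that is an ancestor of all other vertices of `S`. -/
def IsHighest (T : SimpleGraph V) (r : V) (S : Set V) (a : V) : Prop :=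
  a ∈ S ∧ ∀ x ∈ S, AncestorOrEq T r a x

end Trees

/-! ### Hammocks and forests of hammocks -/

section Hammocks

variable {V : Type*} {G : SimpleGraph V}

/-- `H` is a hammock with hammock trees `T[A]`, `T[B]` and hammock roots `a`, `b`: it is the induced
subgraph on `A ⊔ B`, it consists of the two trees and of the cross edges between them, there is at
least one such cross edge, and the roots are unrelated. -/
structure IsHammock (T : SimpleGraph V) (r : V) (H : G.Subgraph) (A B : Set V) (a b : V) :
    Prop where
  induced : H = (⊤ : G.Subgraph).induce (A ∪ B)
  disjoint : Disjoint A B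
  connected_left : (T.induce A).Connected
  connected_right : (T.induce B).Connected
  left_tree : ∀ x ∈ A, ∀ y ∈ A, G.Adj x y → T.Adj x y
  right_tree : ∀ x ∈ B, ∀ y ∈ B, G.Adj x y → T.Adj x y
  cross : ∃ x ∈ A, ∃ y ∈ B, G.Adj x y ∧ ¬ T.Adj x y
  left_root : IsHighest T r A a
  right_root : IsHighest T r B b
  unrelated : ¬ AncestorOrEq T r a b ∧ ¬ AncestorOrEq T r b a

variable {ι : Type*}

/-- The union of the subgraphs `H i`, `i ∈ s`. -/
def famUnion (H : ι → G.Subgraph) (s : Set ι) : G.Subgraph := ⨆ i ∈ s, H i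

/-- The (edge-disjoint) hammocks `H i`, `i ∈ s`, form a tree of hammocks: every simple cycle of
their union has edges in exactly one of them, and the union is connected. -/
structure IsTreeOfHammocks (H : ι → G.Subgraph) (s : Set ι) : Prop where
  edge_disjoint : s.PairwiseDisjoint fun i => (H i).edgeSet
  cycle : ∀ (u : V) (c : (famUnion H s).spanningCoe.Walk u u), c.IsCycle →
    ∃! i, i ∈ s ∧ ∃ e ∈ c.edges, e ∈ (H i).edgeSet
  connected : (famUnion H s).Connected

/-- The indices of the hammocks that meet the connected component `W` of the union. -/
def membersOf (H : ι → G.Subgraph) (W : (famUnion H Set.univ).coe.ConnectedComponent) : Set ι :=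
  {i | ∃ x : (famUnion H Set.univ).verts, (x : V) ∈ (H i).verts ∧
    (famUnion H Set.univ).coe.connectedComponentMk x = W}

/-- The edge-disjoint hammocks `H i` form a rooted forest of hammocks with root hammocks `H k`,
`k ∈ roots`: the hammocks meeting a connected component of the union form a tree of hammocks,
and exactly one of them is a root hammock. -/
structure IsRootedForestOfHammocks (H : ι → G.Subgraph) (roots : Set ι) : Prop where
  edge_disjoint : Pairwise fun i j => Disjoint (H i).edgeSet (H j).edgeSet
  tree : ∀ W, IsTreeOfHammocks H (membersOf H W)
  root : ∀ W, ∃! k, k ∈ membersOf H W ∧ k ∈ roots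

/-- `H i` is the parent of `H j`. With `H k` the root hammock of the tree of hammocks containing
`H j`, `j ≠ k`: the parent is `H k` if `H j` and `H k` share a vertex; otherwise it is the
hammock containing the first edge of any path from `H j` to `H k` in the union. -/
def IsParentHammock (H : ι → G.Subgraph) (roots : Set ι) (i j : ι) : Prop :=
  ∃ W, ∃ k, k ∈ roots ∧ i ∈ membersOf H W ∧ j ∈ membersOf H W ∧ k ∈ membersOf H W ∧ j ≠ k ∧
    (((H j).verts ∩ (H k).verts).Nonempty ∧ i = k ∨
      (H j).verts ∩ (H k).verts = ∅ ∧
        ∀ (x y : V) (p : (famUnion H Set.univ).spanningCoe.Walk x y), p.IsPath →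
          x ∈ (H j).verts → y ∈ (H k).verts →
          (∀ z ∈ p.support, z ∈ (H j).verts → z = x) →
          (∀ z ∈ p.support, z ∈ (H k).verts → z = y) →
          s(x, p.snd) ∈ (H i).edgeSet)

end Hammocks

/-! ### Hammock decompositions -/

/-- The data of a hammock decomposition: the number of hammocks, for the `i`-th hammock the vertex
sets of its hammock trees `T_i`, `T_i'` and the hammock roots `r_i`, `r_i'`, the set of root
hammocks, and the vertex set of the base tree `T_0`. -/
structure HammockData (V : Type*) where
  num : ℕ
  left : Fin num → Finset V
  right : Fin num → Finset V
  leftRoot : Fin num → V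
  rightRoot : Fin num → V
  roots : Finset (Fin num)
  base : Finset V

namespace HammockData

variable {V : Type*} (D : HammockData V)

/-- The `i`-th hammock, an induced subgraph of `G`. -/
def hammock (G : SimpleGraph V) (i : Fin D.num) : G.Subgraph :=
  (⊤ : G.Subgraph).induce ((D.left i : Set V) ∪ (D.right i : Set V))

/-- The rooted forest of hammocks is lca-respecting with base tree `T[D.base]`. -/
structure IsLcaRespecting (G : SimpleGraph V) (r : V) (T : SimpleGraph V) : Prop where
  inter : ∀ i j, IsParentHammock (D.hammock G) (D.roots : Set (Fin D.num)) i j →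
    (D.hammock G i).verts ∩ (D.hammock G j).verts = {D.leftRoot j}
  lca : ∀ i j, IsParentHammock (D.hammock G) (D.roots : Set (Fin D.num)) i j →
    ∃ c, IsLca T r c (D.leftRoot j) (D.rightRoot j) ∧ IsTreeParent T r c (D.rightRoot j) ∧
      (c ∈ (D.hammock G i).verts ∨ IsLca T r c (D.leftRoot i) (D.rightRoot i))
  root_mem : ∀ k ∈ D.roots, D.leftRoot k ∈ D.base
  root_lca : ∀ k ∈ D.roots,
    ∃ c, IsLca T r c (D.leftRoot k) (D.rightRoot k) ∧ IsTreeParent T r c (D.leftRoot k) ∧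
      IsTreeParent T r c (D.rightRoot k) ∧ c ∈ D.base

/-- `E(T_0)`. -/
def baseEdges (T : SimpleGraph V) : Set (Sym2 V) :=
  {e | e ∈ T.edgeSet ∧ ∀ v ∈ e, v ∈ D.base}

/-- `E(ℋ)`. -/
def hammockEdges (G : SimpleGraph V) : Set (Sym2 V) :=
  (famUnion (D.hammock G) Set.univ).edgeSet

/-- `E_p`: the parent edges of the roots `r_i'`. -/
def parentEdges (r : V) (T : SimpleGraph V) : Set (Sym2 V) :=
  {e | ∃ i c, IsTreeParent T r c (D.rightRoot i) ∧ e = s(c, D.rightRoot i)}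

/-- `D` is a hammock decomposition of `(G, w)` with root `r` and BFS tree `T`. -/
structure IsHammockDecomposition (G : SimpleGraph V) (w : Sym2 V → ℕ) (r : V)
    (T : SimpleGraph V) : Prop where
  root_mem_base : r ∈ D.base
  base_connected : (T.induce (D.base : Set V)).Connected
  isHammock : ∀ i, IsHammock T r (D.hammock G i) (D.left i) (D.right i)
    (D.leftRoot i) (D.rightRoot i)
  forest : IsRootedForestOfHammocks (D.hammock G) (D.roots : Set (Fin D.num))
  lcaRespecting : D.IsLcaRespecting G r T
  cover : G.edgeSet = D.baseEdges T ∪ D.hammockEdges G ∪ D.parentEdges r T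
  base_hammock_disjoint : Disjoint (D.baseEdges T) (D.hammockEdges G)
  base_parent_disjoint : Disjoint (D.baseEdges T) (D.parentEdges r T)
  hammock_parent_disjoint : Disjoint (D.hammockEdges G) (D.parentEdges r T)
  /-- Every shortest path whose first and last edges are cross edges lies in the forest. -/
  cross_paths : ∀ (u v : V) (p : G.Walk u v), IsShortestPath w p → ¬ p.Nil →
    s(u, p.snd) ∉ T.edgeSet → s(p.penultimate, v) ∉ T.edgeSet →
    ∀ e ∈ p.edges, e ∈ D.hammockEdges G

end HammockData

/-! ### Random access machines with a step count -/

/-- A state of the machine: registers and a memory, both holding natural numbers. -/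
structure RAMState where
  reg : ℕ → ℕ
  mem : ℕ → ℕ

/-- Write a value into a register. -/
def RAMState.setReg (s : RAMState) (x v : ℕ) : RAMState := ⟨Function.update s.reg x v, s.mem⟩

/-- Write a value into a memory cell. -/
def RAMState.setMem (s : RAMState) (a v : ℕ) : RAMState := ⟨s.reg, Function.update s.mem a v⟩

/-- Programs of a deterministic random access machine with addition, truncated subtraction,
comparison and indirect addressing. -/
inductive RAMProgram
  | const (x c : ℕ)
  | add (x y z : ℕ)
  | sub (x y z : ℕ)
  | load (x y : ℕ)
  | store (x y : ℕ)
  | seq (P Q : RAMProgram)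
  | ite (x y : ℕ) (P Q : RAMProgram)
  | loop (x y : ℕ) (P : RAMProgram)

/-- `P.Exec s s' t`: started in the state `s`, the program `P` halts in the state `s'` after exactly
`t` steps, where every instruction and every test is one step. -/
inductive RAMProgram.Exec : RAMProgram → RAMState → RAMState → ℕ → Prop
  | const (x c : ℕ) (s : RAMState) : Exec (.const x c) s (s.setReg x c) 1
  | add (x y z : ℕ) (s : RAMState) : Exec (.add x y z) s (s.setReg x (s.reg y + s.reg z)) 1
  | sub (x y z : ℕ) (s : RAMState) : Exec (.sub x y z) s (s.setReg x (s.reg y - s.reg z)) 1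
  | load (x y : ℕ) (s : RAMState) : Exec (.load x y) s (s.setReg x (s.mem (s.reg y))) 1
  | store (x y : ℕ) (s : RAMState) : Exec (.store x y) s (s.setMem (s.reg x) (s.reg y)) 1
  | seq {P Q : RAMProgram} {s s₁ s₂ : RAMState} {t₁ t₂ : ℕ} :
      Exec P s s₁ t₁ → Exec Q s₁ s₂ t₂ → Exec (.seq P Q) s s₂ (t₁ + t₂)
  | ite_true {x y : ℕ} {P Q : RAMProgram} {s s' : RAMState} {t : ℕ} :
      s.reg x < s.reg y → Exec P s s' t → Exec (.ite x y P Q) s s' (t + 1)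
  | ite_false {x y : ℕ} {P Q : RAMProgram} {s s' : RAMState} {t : ℕ} :
      ¬ s.reg x < s.reg y → Exec Q s s' t → Exec (.ite x y P Q) s s' (t + 1)
  | loop_true {x y : ℕ} {P : RAMProgram} {s s₁ s₂ : RAMState} {t₁ t₂ : ℕ} :
      s.reg x < s.reg y → Exec P s s₁ t₁ → Exec (.loop x y P) s₁ s₂ t₂ →
      Exec (.loop x y P) s s₂ (t₁ + t₂ + 1)
  | loop_false {x y : ℕ} {P : RAMProgram} {s : RAMState} :
      ¬ s.reg x < s.reg y → Exec (.loop x y P) s s 1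

/-- The machine is deterministic. -/
theorem RAMProgram.Exec.deterministic {P : RAMProgram} {s s₁ s₂ : RAMState} {t₁ t₂ : ℕ}
    (h₁ : P.Exec s s₁ t₁) (h₂ : P.Exec s s₂ t₂) : s₁ = s₂ ∧ t₁ = t₂ := by
  induction h₁ generalizing s₂ t₂ with
  | const | add | sub | load | store => cases h₂; exact ⟨rfl, rfl⟩
  | seq _ _ ih₁ ih₂ =>
    cases h₂ with
    | seq a b =>
      obtain ⟨rfl, rfl⟩ := ih₁ a
      obtain ⟨rfl, rfl⟩ := ih₂ b
      exact ⟨rfl, rfl⟩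
  | ite_true h _ ih =>
    cases h₂ with
    | ite_true _ a => obtain ⟨rfl, rfl⟩ := ih a; exact ⟨rfl, rfl⟩
    | ite_false h' _ => exact absurd h h'
  | ite_false h _ ih =>
    cases h₂ with
    | ite_true h' _ => exact absurd h' h
    | ite_false _ a => obtain ⟨rfl, rfl⟩ := ih a; exact ⟨rfl, rfl⟩
  | loop_true h _ _ ih₁ ih₂ =>
    cases h₂ with
    | loop_true _ a b =>
      obtain ⟨rfl, rfl⟩ := ih₁ a
      obtain ⟨rfl, rfl⟩ := ih₂ b
      exact ⟨rfl, rfl⟩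
    | loop_false h' => exact absurd h h'
  | loop_false h =>
    cases h₂ with
    | loop_true h' _ _ => exact absurd h' h
    | loop_false _ => exact ⟨rfl, rfl⟩

/-- The initial state: the input word in the memory cells `0, 1, 2, …`, zero elsewhere. -/
def RAMState.init (l : List ℕ) : RAMState := ⟨fun _ => 0, fun a => l.getD a 0⟩

/-- The word `l` stands in consecutive memory cells, starting at the address in register `0`. -/
def RAMState.Outputs (s : RAMState) (l : List ℕ) : Prop :=
  ∀ a < l.length, s.mem (s.reg 0 + a) = l.getD a 0

open Classical in
/-- The input word: the number of vertices, the root, the weight matrix (entry `0` for a non-edge)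
and the adjacency matrix of the tree, both row by row. -/
noncomputable def encodeInput {n : ℕ} (G : SimpleGraph (Fin n)) (w : Sym2 (Fin n) → ℕ)
    (r : Fin n) (T : SimpleGraph (Fin n)) : List ℕ :=
  [n, (r : ℕ)]
    ++ (List.finRange n).flatMap (fun u => (List.finRange n).map fun v =>
        if G.Adj u v then w s(u, v) else 0)
    ++ (List.finRange n).flatMap (fun u => (List.finRange n).map fun v =>
        if T.Adj u v then 1 else 0)

/-- The characteristic vector of a set of vertices. -/
def encodeSet {n : ℕ} (S : Finset (Fin n)) : List ℕ :=
  (List.finRange n).map fun v => if v ∈ S then 1 else 0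

/-- The output word: the number of hammocks, the vertex set of the base tree and, for each hammock,
whether it is a root hammock, its two hammock roots and the vertex sets of its hammock trees. -/
def HammockData.encode {n : ℕ} (D : HammockData (Fin n)) : List ℕ :=
  D.num :: encodeSet D.base ++ (List.finRange D.num).flatMap fun i =>
    [if i ∈ D.roots then 1 else 0, (D.leftRoot i : ℕ), (D.rightRoot i : ℕ)]
      ++ encodeSet (D.left i) ++ encodeSet (D.right i)

/-! Call two siblings of `T` adjacent if an edge of `G` joins the subtrees below them. A cross edge
`xy` joins unrelated vertices: an edge to an ancestor would be the unique shortest path, hence a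
tree edge. So it lies over one adjacent sibling pair, the children of lca(x, y) towards `x` and `y`.
All the structure comes from one obstruction, `IsSeriesParallel.false_of_four_sets`: a
series-parallel graph has no four disjoint, connected, pairwise adjacent vertex sets. Subtrees,
unions of adjacent subtrees and complements of subtrees serve as these sets.

First consequences: the sibling graph is a forest (`sibParent_unique_aux`), and each of its
components has at most one vertex `v` with `Out v`, i.e. with an edge leaving even the subtree of
the parent of `v` (`out_unique`). Each component is rooted at that vertex, or at its smallest vertex
if there is none; this root is the starter. Every non-starter `b` then has a unique sibling parent
`a`, and gets one hammock with right root `b`, containing all cross edges between the subtrees below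
`a` and `b`.

It remains to distribute the tree edges, identified with their lower ends `v`. A non-starter owns
itself, and its parent edge goes to E_p. If `Out v`, then labels cross `v`, and `v` goes to the
first one: the highest branching vertex wins, then a label above `v`, then the smaller label. Any
other starter inherits the owner of its parent. Vertices without an owner form the base tree. A
label that loses some vertex below `a` has its left root moved down to the deepest vertex it loses;
otherwise the left root is `a`. The K₄ obstruction shows that all edges of the label end below each
lost vertex (`leftCand_anc`), so no edge of the hammock is cut off.

A hammock thus consists of its owned vertices and its left root, which is owned by a hammock of
smaller rank or by none. Such a successive attachment at single vertices always yields a rooted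
forest of hammocks (`IsAttached.main`); the lca conditions follow from the priority rule
(`lca_mem`). Shortest cross-edge paths are covered because all cross edges are, and because a tree
edge on such a path has a lower end `v` with `Out v` (`out_of_cross_path`).

The decomposition depends only on `G`, `T`, `r` and the order of the vertices. Every relation
involved is definable by first-order formulas and reachability from earlier ones. A program
therefore fills one n × n table after the other: formulas by nested loops, reachability by `n`
rounds. It then prints the result behind the tables. -/

/-! ### Series-parallel graphs have no `K₄` minor -/

section KFour

open Relation

variable {V : Type*}

/-- The set `P` is connected for the relation `J`. -/
def ConnOn (J : V → V → Prop) (P : Set V) : Prop :=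
  ∀ x ∈ P, ∀ y ∈ P, ReflTransGen (fun a b => J a b ∧ a ∈ P ∧ b ∈ P) x y

/-- Four disjoint connected pairwise adjacent sets. -/
structure IsKFourModel (J : V → V → Prop) (P : Fin 4 → Set V) : Prop where
  conn : ∀ i, ConnOn J (P i)
  disj : ∀ i j, i ≠ j → Disjoint (P i) (P j)
  adj : ∀ i j, i ≠ j → ∃ x ∈ P i, ∃ y ∈ P j, J x y

/-- Adjoin the edge `xy` to a relation. -/
def adjoinEdge (J : V → V → Prop) (x y : V) (u v : V) : Prop :=
  J u v ∨ (u = x ∧ v = y) ∨ (u = y ∧ v = x)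

theorem adjoinEdge_symm {J : V → V → Prop} (hJ : ∀ u v, J u v → J v u) (x y : V) (u v : V)
    (h : adjoinEdge J x y u v) : adjoinEdge J x y v u := by
  unfold adjoinEdge at *
  have := hJ u v
  tauto

theorem reflTransGen_restrict_symm {J : V → V → Prop} (hJ : ∀ u v, J u v → J v u) {P : Set V}
    {x y : V} (h : ReflTransGen (fun a b => J a b ∧ a ∈ P ∧ b ∈ P) x y) :
    ReflTransGen (fun a b => J a b ∧ a ∈ P ∧ b ∈ P) y x := by
  induction h with
  | refl => exact .refl
  | tail _ h ih => exact .head ⟨hJ _ _ h.1, h.2.2, h.2.1⟩ ih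

/-- A set all of whose elements are joined to a fixed vertex is connected. -/
theorem ConnOn.of_center {J : V → V → Prop} (hJ : ∀ u v, J u v → J v u) {P : Set V} (z : V)
    (h : ∀ x ∈ P, ReflTransGen (fun a b => J a b ∧ a ∈ P ∧ b ∈ P) x z) : ConnOn J P :=
  fun x hx y hy => (h x hx).trans (reflTransGen_restrict_symm hJ (h y hy))

theorem ConnOn.mono {J J' : V → V → Prop} (hJ : ∀ u v, J u v → J' u v) {P : Set V}
    (h : ConnOn J P) : ConnOn J' P := fun x hx y hy =>
  ReflTransGen.mono (fun _ _ h => ⟨hJ _ _ h.1, h.2⟩) _ _ (h x hx y hy)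

theorem IsKFourModel.mono {J J' : V → V → Prop} (hJ : ∀ u v, J u v → J' u v)
    {P : Fin 4 → Set V} (h : IsKFourModel J P) : IsKFourModel J' P where
  conn i := (h.conn i).mono hJ
  disj := h.disj
  adj i j hij := by
    obtain ⟨x, hx, y, hy, hxy⟩ := h.adj i j hij
    exact ⟨x, hx, y, hy, hJ _ _ hxy⟩

/-- A chain inside one part can leave side 1 only through `x` or `y`, so cutting it there, and using
the new edge `xy` if the part contains both vertices, keeps the part connected. If two parts are
adjacent through an edge of side 2, then `hav` forces each of them to contain one of `x`, `y`, so
the new edge joins them. -/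
theorem IsKFourModel.restrict {J J₁ J₂ : V → V → Prop} {V₁ V₂ : Set V} {x y : V}
    (hJ : ∀ u v, J u v → J₁ u v ∨ J₂ u v) (s₁ : ∀ u v, J₁ u v → J₁ v u)
    (h₁ : ∀ u v, J₁ u v → u ∈ V₁ ∧ v ∈ V₁) (h₂ : ∀ u v, J₂ u v → u ∈ V₂ ∧ v ∈ V₂)
    (hV : V₁ ∩ V₂ ⊆ {x, y}) {P : Fin 4 → Set V} (hm : IsKFourModel J P)
    (hav : ∀ i, x ∉ P i → y ∉ P i → P i ⊆ V₁ \ V₂) :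
    IsKFourModel (adjoinEdge J₁ x y) fun i => P i ∩ (V₁ ∪ {x, y}) := by
  have hsym := adjoinEdge_symm s₁ x y
  refine ⟨fun i => ?_, fun i j hij => ?_, fun i j hij => ?_⟩
  · by_cases hi : x ∉ P i ∧ y ∉ P i
    · have hs := hav i hi.1 hi.2
      intro u hu v hv
      have := hm.conn i u hu.1 v hv.1
      refine ReflTransGen.mono (fun a b hab => ?_) _ _ this
      obtain ⟨hab, ha, hb⟩ := hab
      refine ⟨?_, ⟨ha, Or.inl (hs ha).1⟩, ⟨hb, Or.inl (hs hb).1⟩⟩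
      rcases hJ _ _ hab with h | h
      · exact Or.inl h
      · exact absurd (h₂ _ _ h).1 (hs ha).2
    · have key : ∀ u ∈ P i ∩ (V₁ ∪ {x, y}), ∃ z ∈ P i, (z = x ∨ z = y) ∧
          ReflTransGen (fun a b => adjoinEdge J₁ x y a b ∧ a ∈ P i ∩ (V₁ ∪ {x, y}) ∧
            b ∈ P i ∩ (V₁ ∪ {x, y})) u z := by
        have hz : ∃ z ∈ P i, z = x ∨ z = y := by
          by_cases hx : x ∈ P i
          · exact ⟨x, hx, Or.inl rfl⟩
          · by_cases hy : y ∈ P i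
            · exact ⟨y, hy, Or.inr rfl⟩
            · exact absurd ⟨hx, hy⟩ hi
        obtain ⟨z, hz, hzxy⟩ := hz
        intro u hu
        have hp := hm.conn i u hu.1 z hz
        induction hp using ReflTransGen.head_induction_on with
        | refl => exact ⟨z, hz, hzxy, .refl⟩
        | head hab hp ih =>
          rename_i a b
          by_cases ha : a = x ∨ a = y
          · exact ⟨a, hu.1, ha, .refl⟩
          · have ha1 : a ∈ V₁ := by
              rcases hu.2 with h | h
              · exact h
              · exact absurd h ha
            have hJ1 : J₁ a b := by
              rcases hJ _ _ hab.1 with h | h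
              · exact h
              · exact absurd (hV ⟨ha1, (h₂ _ _ h).1⟩) ha
            have hb : b ∈ P i ∩ (V₁ ∪ {x, y}) := ⟨hab.2.2, Or.inl (h₁ _ _ hJ1).2⟩
            obtain ⟨z', hz', hz'', hp'⟩ := ih hb
            exact ⟨z', hz', hz'', .head ⟨Or.inl hJ1, hu, hb⟩ hp'⟩
      intro u hu v hv
      obtain ⟨z, hz, hz', hp⟩ := key u hu
      obtain ⟨t, ht, ht', hq⟩ := key v hv
      refine hp.trans (ReflTransGen.trans ?_ (reflTransGen_restrict_symm hsym hq))
      have hzm : z ∈ P i ∩ (V₁ ∪ {x, y}) := ⟨hz, Or.inr hz'⟩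
      have htm : t ∈ P i ∩ (V₁ ∪ {x, y}) := ⟨ht, Or.inr ht'⟩
      rcases hz' with rfl | rfl <;> rcases ht' with rfl | rfl
      · exact .refl
      · exact .single ⟨Or.inr (Or.inl ⟨rfl, rfl⟩), hzm, htm⟩
      · exact .single ⟨Or.inr (Or.inr ⟨rfl, rfl⟩), hzm, htm⟩
      · exact .refl
  · exact (hm.disj i j hij).mono Set.inter_subset_left Set.inter_subset_left
  · obtain ⟨u, hu, v, hv, huv⟩ := hm.adj i j hij
    rcases hJ _ _ huv with h | h
    · exact ⟨u, ⟨hu, Or.inl (h₁ _ _ h).1⟩, v, ⟨hv, Or.inl (h₁ _ _ h).2⟩, Or.inl h⟩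
    · have hi : x ∈ P i ∨ y ∈ P i := by
        by_contra hc
        push Not at hc
        exact (hav i hc.1 hc.2 hu).2 (h₂ _ _ h).1
      have hj : x ∈ P j ∨ y ∈ P j := by
        by_contra hc
        push Not at hc
        exact (hav j hc.1 hc.2 hv).2 (h₂ _ _ h).2
      have hd := Set.disjoint_left.1 (hm.disj i j hij)
      rcases hi with hi | hi <;> rcases hj with hj | hj
      · exact absurd hj (hd hi)
      · exact ⟨x, ⟨hi, Or.inr (Or.inl rfl)⟩, y, ⟨hj, Or.inr (Or.inr rfl)⟩,
          Or.inr (Or.inl ⟨rfl, rfl⟩)⟩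
      · exact ⟨y, ⟨hi, Or.inr (Or.inr rfl)⟩, x, ⟨hj, Or.inr (Or.inl rfl)⟩,
          Or.inr (Or.inr ⟨rfl, rfl⟩)⟩
      · exact absurd hj (hd hi)

/-- A `K₄` model of a graph with a separation of order at most two gives one on one of the sides,
with the edge between the separating vertices added. -/
theorem IsKFourModel.of_separation {J J₁ J₂ : V → V → Prop} {V₁ V₂ : Set V} {x y : V}
    (hJ : ∀ u v, J u v → J₁ u v ∨ J₂ u v) (s₁ : ∀ u v, J₁ u v → J₁ v u)
    (s₂ : ∀ u v, J₂ u v → J₂ v u)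
    (h₁ : ∀ u v, J₁ u v → u ∈ V₁ ∧ v ∈ V₁) (h₂ : ∀ u v, J₂ u v → u ∈ V₂ ∧ v ∈ V₂)
    (hV : V₁ ∩ V₂ ⊆ {x, y}) {P : Fin 4 → Set V} (hm : IsKFourModel J P) :
    (∃ P', IsKFourModel (adjoinEdge J₁ x y) P') ∨ ∃ P', IsKFourModel (adjoinEdge J₂ x y) P' := by
  have one : ∀ z : V, ∃ i : Fin 4, ∀ j, j ≠ i → z ∉ P j := by
    intro z
    by_cases h : ∃ i, z ∈ P i
    · obtain ⟨i, hi⟩ := h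
      exact ⟨i, fun j hj hz => Set.disjoint_left.1 (hm.disj j i hj) hz hi⟩
    · push Not at h
      exact ⟨0, fun j _ => h j⟩
  obtain ⟨ix, hix⟩ := one x
  obtain ⟨iy, hiy⟩ := one y
  -- Each separating vertex lies in at most one part, so at least two of the four parts avoid both.
  obtain ⟨i, j, hij, hi1, hi2, hj1, hj2⟩ : ∃ i j : Fin 4, i ≠ j ∧ i ≠ ix ∧ i ≠ iy ∧ j ≠ ix ∧ j ≠ iy := by
    clear hix hiy
    revert ix iy
    decide
  have side₁ : ∀ k, x ∉ P k → y ∉ P k → (∃ u ∈ P k, u ∈ V₁) → P k ⊆ V₁ \ V₂ := by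
    rintro k hx hy ⟨u, hu, hu1⟩ v hv
    have hp := hm.conn k u hu v hv
    induction hp with
    | refl => exact ⟨hu1, fun h => by
        rcases hV ⟨hu1, h⟩ with rfl | rfl
        exacts [hx hu, hy hu]⟩
    | tail _ hab ih =>
      have ha := ih hab.2.1
      rcases hJ _ _ hab.1 with h | h
      · exact ⟨(h₁ _ _ h).2, fun h' => by
          rcases hV ⟨(h₁ _ _ h).2, h'⟩ with rfl | rfl
          exacts [hx hv, hy hv]⟩
      · exact absurd (h₂ _ _ h).1 ha.2
  have side₂ : ∀ k, x ∉ P k → y ∉ P k → (∃ u ∈ P k, u ∈ V₂) → P k ⊆ V₂ \ V₁ := by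
    rintro k hx hy ⟨u, hu, hu1⟩ v hv
    have hp := hm.conn k u hu v hv
    induction hp with
    | refl => exact ⟨hu1, fun h => by
        rcases hV ⟨h, hu1⟩ with rfl | rfl
        exacts [hx hu, hy hu]⟩
    | tail _ hab ih =>
      have ha := ih hab.2.1
      rcases hJ _ _ hab.1 with h | h
      · exact absurd (h₁ _ _ h).1 ha.2
      · exact ⟨(h₂ _ _ h).2, fun h' => by
          rcases hV ⟨h', (h₂ _ _ h).2⟩ with rfl | rfl
          exacts [hx hv, hy hv]⟩
  obtain ⟨u, hu, v, hv, huv⟩ := hm.adj i j hij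
  -- The side of the edge between these two parts decides. Every further part avoiding `x` and `y`
  -- is connected and adjacent to `P i`, so it lies on the same side.
  rcases hJ _ _ huv with h | h
  · left
    refine ⟨_, hm.restrict hJ s₁ h₁ h₂ hV fun k hx hy => ?_⟩
    have hi := side₁ i (hix i hi1) (hiy i hi2) ⟨u, hu, (h₁ _ _ h).1⟩
    by_cases hk : k = i
    · exact hk ▸ hi
    · obtain ⟨a, ha, b, hb, hab⟩ := hm.adj k i hk
      rcases hJ _ _ hab with h' | h'
      · exact side₁ k hx hy ⟨a, ha, (h₁ _ _ h').1⟩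
      · exact absurd (h₂ _ _ h').2 (hi hb).2
  · right
    refine ⟨_, hm.restrict (fun u v h => (hJ u v h).symm) s₂ h₂ h₁ (by rwa [Set.inter_comm])
      fun k hx hy => ?_⟩
    have hi := side₂ i (hix i hi1) (hiy i hi2) ⟨u, hu, (h₂ _ _ h).1⟩
    by_cases hk : k = i
    · exact hk ▸ hi
    · obtain ⟨a, ha, b, hb, hab⟩ := hm.adj k i hk
      rcases hJ _ _ hab with h' | h'
      · exact absurd (h₁ _ _ h').2 (hi hb).2
      · exact side₂ k hx hy ⟨a, ha, (h₂ _ _ h').1⟩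

/-- Pigeonhole: each of the four disjoint parts contains the end of an edge, hence one of the three
vertices. -/
theorem not_isKFourModel_of_card {J : V → V → Prop} {a b c : V}
    (h : ∀ u v, J u v → u = a ∨ u = b ∨ u = c) (P : Fin 4 → Set V) : ¬ IsKFourModel J P := by
  intro hm
  have hex : ∀ i : Fin 4, ∃ k : Fin 3, (![a, b, c] k) ∈ P i := by
    intro i
    obtain ⟨j, hj⟩ : ∃ j, i ≠ j := by revert i; decide
    obtain ⟨x, hx, y, hy, hxy⟩ := hm.adj i j hj
    rcases h _ _ hxy with rfl | rfl | rfl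
    exacts [⟨0, hx⟩, ⟨1, hx⟩, ⟨2, hx⟩]
  choose f hf using hex
  obtain ⟨i, j, hij, he⟩ := Fintype.exists_ne_map_eq_of_card_lt f (by simp)
  exact Set.disjoint_left.1 (hm.disj i j hij) (hf i) (he ▸ hf j)

/-! ### Excluding K₄ models from compositions, and reduction to a biconnected component. -/

variable {G : SimpleGraph V}

theorem IsTwoTerminalSP.terminals_mem {H : G.Subgraph} {s t : V} (h : IsTwoTerminalSP H s t) :
    s ∈ H.verts ∧ t ∈ H.verts := by
  induction h with
  | edge h => simp
  | series _ _ _ ih₁ ih₂ => exact ⟨Or.inl ih₁.1, Or.inr ih₂.2⟩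
  | parallel _ _ _ _ ih₁ ih₂ => exact ⟨Or.inl ih₁.1, Or.inl ih₁.2⟩

/-- The edge between the terminals is added to make the induction work: the virtual edge produced by
a separation is then exactly the one in the induction hypothesis. A parallel composition is
separated along `s, t`; a series composition first along `s, m`, then along `m, t`. -/
theorem IsTwoTerminalSP.not_isKFourModel {H : G.Subgraph} {s t : V} (h : IsTwoTerminalSP H s t)
    (P : Fin 4 → Set V) : ¬ IsKFourModel (adjoinEdge H.Adj s t) P := by
  induction h generalizing P with
  | @edge s t h =>
    apply not_isKFourModel_of_card (a := s) (b := t) (c := t)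
    rintro u v (huv | huv | huv)
    · simp only [SimpleGraph.subgraphOfAdj_adj, Sym2.eq_iff] at huv
      rcases huv with ⟨rfl, rfl⟩ | ⟨rfl, rfl⟩ <;> simp
    · simp [huv.1]
    · simp [huv.1]
  | @series H₁ H₂ s m t h₁ h₂ hV ih₁ ih₂ =>
    intro hm
    have hs := h₁.terminals_mem
    have ht := h₂.terminals_mem
    rcases hm.of_separation (J₁ := H₁.Adj) (J₂ := adjoinEdge H₂.Adj s t) (V₁ := H₁.verts)
      (V₂ := H₂.verts ∪ {s}) (x := s) (y := m) (by
        rintro u v ((h | h) | h)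
        exacts [Or.inl h, Or.inr (Or.inl h), Or.inr (Or.inr h)]) (fun _ _ h => h.symm)
        (adjoinEdge_symm (fun _ _ h => h.symm) _ _) (fun u v h => ⟨h.fst_mem, h.snd_mem⟩) (by
        rintro u v (h | ⟨rfl, rfl⟩ | ⟨rfl, rfl⟩)
        · exact ⟨Or.inl h.fst_mem, Or.inl h.snd_mem⟩
        · exact ⟨Or.inr rfl, Or.inl ht.2⟩
        · exact ⟨Or.inl ht.2, Or.inr rfl⟩) (by
        rintro z ⟨hz, hz' | hz'⟩
        · exact Or.inr (hV ▸ ⟨hz, hz'⟩ : z ∈ ({m} : Set V))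
        · exact Or.inl hz') with ⟨P', hP'⟩ | ⟨P', hP'⟩
    · exact ih₁ _ hP'
    -- The remaining side is `H₂` with the edges `st` and `sm`. Separating once more leaves `H₂`
    -- with `mt`, or a triangle on `s`, `t`, `m`.
    · rcases hP'.of_separation (J₁ := H₂.Adj)
        (J₂ := adjoinEdge (adjoinEdge (fun _ _ => False) s t) s m) (V₁ := H₂.verts)
        (V₂ := {s, t, m}) (x := m) (y := t) (by
          rintro u v ((h | h) | h)
          exacts [Or.inl h, Or.inr (Or.inl (Or.inr h)), Or.inr (Or.inr h)]) (fun _ _ h => h.symm)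
          (adjoinEdge_symm (adjoinEdge_symm (fun _ _ h => h) _ _) _ _)
          (fun u v h => ⟨h.fst_mem, h.snd_mem⟩) (by
          rintro u v ((h | ⟨rfl, rfl⟩ | ⟨rfl, rfl⟩) | ⟨rfl, rfl⟩ | ⟨rfl, rfl⟩) <;> simp_all) (by
          rintro z ⟨hz, rfl | rfl | rfl⟩
          · exact Or.inl (hV ▸ ⟨hs.1, hz⟩ : z ∈ ({m} : Set V))
          · exact Or.inr rfl
          · exact Or.inl rfl) with ⟨P'', hP''⟩ | ⟨P'', hP''⟩
      · exact ih₂ _ hP''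
      · refine not_isKFourModel_of_card (a := s) (b := t) (c := m) ?_ _ hP''
        rintro u v (((h | ⟨rfl, rfl⟩ | ⟨rfl, rfl⟩) | ⟨rfl, rfl⟩ | ⟨rfl, rfl⟩) | ⟨rfl, rfl⟩ | ⟨rfl, rfl⟩)
          <;> simp_all
  | @parallel H₁ H₂ s t h₁ h₂ hV _ ih₁ ih₂ =>
    intro hm
    have hs := h₁.terminals_mem
    rcases hm.of_separation (J₁ := adjoinEdge H₁.Adj s t) (J₂ := H₂.Adj) (V₁ := H₁.verts)
      (V₂ := H₂.verts) (x := s) (y := t) (by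
        rintro u v ((h | h) | h)
        exacts [Or.inl (Or.inl h), Or.inr h, Or.inl (Or.inr h)])
        (adjoinEdge_symm (fun _ _ h => h.symm) _ _) (fun _ _ h => h.symm) (by
        rintro u v (h | ⟨rfl, rfl⟩ | ⟨rfl, rfl⟩)
        · exact ⟨h.fst_mem, h.snd_mem⟩
        · exact hs
        · exact hs.symm) (fun u v h => ⟨h.fst_mem, h.snd_mem⟩) hV.subset
        with ⟨P', hP'⟩ | ⟨P', hP'⟩
    · refine ih₁ P' (hP'.mono ?_)
      rintro u v (h | h)
      exacts [h, Or.inr h]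
    · exact ih₂ _ hP'

theorem ConnOn.subgraph_preconnected {H : G.Subgraph} (h : ConnOn H.Adj H.verts) :
    H.Preconnected := by
  rw [SimpleGraph.Subgraph.preconnected_iff]
  rintro ⟨u, hu⟩ ⟨v, hv⟩
  have hp := h u hu v hv
  induction hp with
  | refl => exact SimpleGraph.Reachable.refl _
  | tail _ hab ih =>
    refine (ih hab.2.1).trans (SimpleGraph.Adj.reachable ?_)
    exact hab.1

theorem ConnOn.induce {S : Set V} (h : ConnOn G.Adj S) :
    ConnOn ((⊤ : G.Subgraph).induce S).Adj ((⊤ : G.Subgraph).induce S).verts := fun x hx y hy =>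
  ReflTransGen.mono (fun _ _ h => ⟨⟨h.2.1, h.2.2, h.1⟩, h.2⟩) _ _ (h x hx y hy)

theorem ConnOn.iUnion {ι : Type*} {J : V → V → Prop} {Q : ι → Set V}
    (hc : ∀ i, ConnOn J (Q i)) (ha : ∀ i j, i ≠ j → ∃ x ∈ Q i, ∃ y ∈ Q j, J x y) :
    ConnOn J (⋃ i, Q i) := by
  have hsub : ∀ i, ∀ x ∈ Q i, ∀ y ∈ Q i,
      ReflTransGen (fun a b => J a b ∧ a ∈ (⋃ i, Q i) ∧ b ∈ ⋃ i, Q i) x y := fun i x hx y hy =>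
    ReflTransGen.mono (fun _ _ h => ⟨h.1, Set.mem_iUnion.2 ⟨i, h.2.1⟩, Set.mem_iUnion.2 ⟨i, h.2.2⟩⟩)
      _ _ (hc i x hx y hy)
  intro x hx y hy
  obtain ⟨i, hi⟩ := Set.mem_iUnion.1 hx
  obtain ⟨j, hj⟩ := Set.mem_iUnion.1 hy
  by_cases hij : i = j
  · subst hij
    exact hsub i x hi y hj
  · obtain ⟨u, hu, v, hv, huv⟩ := ha i j hij
    exact ((hsub i x hi u hu).tail
      ⟨huv, Set.mem_iUnion.2 ⟨i, hu⟩, Set.mem_iUnion.2 ⟨j, hv⟩⟩).trans (hsub j v hv y hj)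

/-- A model with the fewest vertices works. If deleting `v` disconnected its vertex set, the three
parts without `v` would lie in one component, and the part of `v` could be cut down to that
component together with `v`, giving a smaller model. -/
theorem exists_isBiconnected_of_isKFourModel [Finite V] {P : Fin 4 → Set V}
    (hP : IsKFourModel G.Adj P) :
    ∃ (Q : Fin 4 → Set V), IsKFourModel G.Adj Q ∧
      IsBiconnected ((⊤ : G.Subgraph).induce (⋃ i, Q i)) := by
  obtain ⟨Q, hQ, hmin⟩ : ∃ Q, IsKFourModel G.Adj Q ∧
      ∀ Q', IsKFourModel G.Adj Q' → (⋃ i, Q i).ncard ≤ (⋃ i, Q' i).ncard := by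
    have := (measure fun Q : Fin 4 → Set V => (⋃ i, Q i).ncard).wf.has_min
      {Q | IsKFourModel G.Adj Q} ⟨P, hP⟩
    obtain ⟨Q, hQ, h⟩ := this
    exact ⟨Q, hQ, fun Q' h' => not_lt.1 (h Q' h')⟩
  have hS : ∀ i, Q i ⊆ ⋃ i, Q i := Set.subset_iUnion Q
  refine ⟨Q, hQ, ?_, ?_⟩
  · rw [SimpleGraph.Subgraph.connected_iff]
    refine ⟨ConnOn.subgraph_preconnected ?_, ?_⟩
    · exact (ConnOn.iUnion hQ.conn hQ.adj).induce
    · obtain ⟨x, hx, -⟩ := hQ.adj 0 1 (by decide)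
      exact ⟨x, hS 0 hx⟩
  · intro v hv
    obtain ⟨i₀, hv₀⟩ := Set.mem_iUnion.1 hv
    have hne : ∀ i, i ≠ i₀ → v ∉ Q i := fun i hi h =>
      Set.disjoint_left.1 (hQ.disj i i₀ hi) h hv₀
    obtain ⟨k, hk⟩ : ∃ k, k ≠ i₀ := by
      clear hv₀ hne
      revert i₀
      decide
    obtain ⟨z, hz, -⟩ := hQ.adj k i₀ hk
    set D : Set V := (⋃ i, Q i) \ {v} with hD
    set R : Set V := {y | y ∈ D ∧ ReflTransGen (fun a b => G.Adj a b ∧ a ∈ D ∧ b ∈ D) z y} with hR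
    have hzD : z ∈ D := ⟨hS k hz, fun h => hne k hk (h ▸ hz)⟩
    have hstep : ∀ y ∈ R, ∀ y' ∈ D, G.Adj y y' → y' ∈ R := fun y hy y' hy' h =>
      ⟨hy', hy.2.tail ⟨h, hy.1, hy'⟩⟩
    have hDi : ∀ i, i ≠ i₀ → Q i ⊆ D := fun i hi y hy => ⟨hS i hy, fun h => hne i hi (h ▸ hy)⟩
    have hall : ∀ i, i ≠ i₀ → ∀ y ∈ Q i, y ∈ R → Q i ⊆ R := by
      intro i hi y hy hyR x hx
      have hp := hQ.conn i y hy x hx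
      induction hp with
      | refl => exact hyR
      | tail _ hab ih => exact hstep _ (ih hab.2.1) _ (hDi i hi hx) hab.1
    have hkR : Q k ⊆ R := hall k hk z hz ⟨hzD, .refl⟩
    have hiR : ∀ i, i ≠ i₀ → Q i ⊆ R := by
      intro i hi
      by_cases hik : i = k
      · exact hik ▸ hkR
      · obtain ⟨x, hx, y, hy, hxy⟩ := hQ.adj k i (Ne.symm hik)
        exact hall i hi y hy (hstep x (hkR hx) y (hDi i hi hy) hxy)
    have hvR : ∀ i, ∀ y ∈ Q i, ∀ x ∈ R, G.Adj x y → y = v ∨ y ∈ R := by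
      intro i y hy x hx hxy
      by_cases hyv : y = v
      · exact Or.inl hyv
      · exact Or.inr (hstep x hx y ⟨hS i hy, hyv⟩ hxy)
    -- Only the part containing `v` shrinks. Chains in it are followed up to the first visit of `v`,
    -- and until then they cannot leave the component `R`.
    have hmod : IsKFourModel G.Adj fun i => {y | y ∈ Q i ∧ (y = v ∨ y ∈ R)} := by
      refine ⟨fun i => ?_, fun i j hij => ?_, fun i j hij => ?_⟩
      · by_cases hi : i = i₀
        · subst hi
          refine ConnOn.of_center (fun _ _ h => h.symm) v ?_
          rintro y ⟨hy, hyR⟩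
          have hp := hQ.conn i y hy v hv₀
          induction hp using ReflTransGen.head_induction_on with
          | refl => exact .refl
          | head hab hp' ih =>
            rename_i a b
            rcases hyR with rfl | haR
            · exact .refl
            · have hb := hvR i b hab.2.2 a haR hab.1
              exact .head ⟨hab.1, ⟨hab.2.1, Or.inr haR⟩, ⟨hab.2.2, hb⟩⟩ (ih hab.2.2 hb)
        · have : {y | y ∈ Q i ∧ (y = v ∨ y ∈ R)} = Q i := by
            ext y
            exact ⟨fun h => h.1, fun h => ⟨h, Or.inr (hiR i hi h)⟩⟩
          rw [this]
          exact hQ.conn i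
      · exact (hQ.disj i j hij).mono (fun _ h => h.1) (fun _ h => h.1)
      · obtain ⟨x, hx, y, hy, hxy⟩ := hQ.adj i j hij
        by_cases hi : i = i₀
        · have hj : j ≠ i₀ := fun h => hij (hi.trans h.symm)
          exact ⟨x, ⟨hx, hvR i x hx y (hiR j hj hy) hxy.symm⟩, y, ⟨hy, Or.inr (hiR j hj hy)⟩, hxy⟩
        · exact ⟨x, ⟨hx, Or.inr (hiR i hi hx)⟩, y, ⟨hy, hvR j y hy x (hiR i hi hx) hxy⟩, hxy⟩
    have heq := Set.eq_of_subset_of_ncard_le (Set.iUnion_mono fun i y (hy : y ∈ Q i ∧ _) => hy.1)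
      (hmin _ hmod) (Set.toFinite _)
    have hDR : ∀ y ∈ D, y ∈ R := by
      rintro y ⟨hy, hyv⟩
      rw [← heq] at hy
      obtain ⟨i, hi⟩ := Set.mem_iUnion.1 hy
      exact hi.2.resolve_left hyv
    apply ConnOn.subgraph_preconnected
    have hc : ConnOn G.Adj D := by
      refine ConnOn.of_center (fun _ _ h => h.symm) z fun x hx => ?_
      exact reflTransGen_restrict_symm (fun _ _ h => h.symm) (hDR x hx).2
    intro x hx y hy
    refine ReflTransGen.mono (fun a b hab => ?_) _ _ (hc x hx y hy)
    refine ⟨?_, hab.2.1, hab.2.2⟩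
    rw [SimpleGraph.Subgraph.deleteVerts_adj]
    exact ⟨hab.2.1.1, hab.2.1.2, hab.2.2.1, hab.2.2.2, hab.2.1.1, hab.2.2.1, hab.1⟩

/-- The biconnected carrier of a minimal model extends to a maximal biconnected subgraph, where
`IsTwoTerminalSP.not_isKFourModel` applies. -/
theorem IsSeriesParallel.not_isKFourModel [Finite V] (hG : IsSeriesParallel G)
    (P : Fin 4 → Set V) : ¬ IsKFourModel G.Adj P := by
  intro hP
  obtain ⟨Q, hQ, hbi⟩ := exists_isBiconnected_of_isKFourModel hP
  obtain ⟨B, hB, hmax⟩ := Finite.exists_le_maximal hbi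
  have hadj : ∀ i j, ∀ x ∈ Q i, ∀ y ∈ Q j, G.Adj x y → B.Adj x y := fun i j x hx y hy h =>
    hB.2 ⟨Set.mem_iUnion.2 ⟨i, hx⟩, Set.mem_iUnion.2 ⟨j, hy⟩, h⟩
  obtain ⟨x, hx, y, hy, hxy⟩ := hQ.adj 0 1 (by decide)
  obtain ⟨s, t, hst⟩ := hG B hmax ⟨s(x, y), hadj 0 1 x hx y hy hxy⟩
  refine hst.not_isKFourModel Q ⟨fun i u hu v hv => ?_, hQ.disj, fun i j hij => ?_⟩
  · refine ReflTransGen.mono (fun a b h => ?_) _ _ (hQ.conn i u hu v hv)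
    exact ⟨Or.inl (hadj i i a h.2.1 b h.2.2 h.1), h.2⟩
  · obtain ⟨x, hx, y, hy, hxy⟩ := hQ.adj i j hij
    exact ⟨x, hx, y, hy, Or.inl (hadj i j x hx y hy hxy)⟩

/-- A series-parallel graph has no four disjoint connected pairwise adjacent sets. -/
theorem IsSeriesParallel.false_of_four_sets [Finite V] (hG : IsSeriesParallel G)
    {A B C D : Set V} (hA : ConnOn G.Adj A) (hB : ConnOn G.Adj B) (hC : ConnOn G.Adj C)
    (hD : ConnOn G.Adj D) (dAB : Disjoint A B) (dAC : Disjoint A C) (dAD : Disjoint A D)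
    (dBC : Disjoint B C) (dBD : Disjoint B D) (dCD : Disjoint C D)
    (eAB : ∃ x ∈ A, ∃ y ∈ B, G.Adj x y) (eAC : ∃ x ∈ A, ∃ y ∈ C, G.Adj x y)
    (eAD : ∃ x ∈ A, ∃ y ∈ D, G.Adj x y) (eBC : ∃ x ∈ B, ∃ y ∈ C, G.Adj x y)
    (eBD : ∃ x ∈ B, ∃ y ∈ D, G.Adj x y) (eCD : ∃ x ∈ C, ∃ y ∈ D, G.Adj x y) : False := by
  have sw : ∀ {A B : Set V}, (∃ x ∈ A, ∃ y ∈ B, G.Adj x y) → ∃ x ∈ B, ∃ y ∈ A, G.Adj x y :=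
    fun ⟨x, hx, y, hy, h⟩ => ⟨y, hy, x, hx, h.symm⟩
  refine hG.not_isKFourModel ![A, B, C, D] ⟨fun i => ?_, fun i j hij => ?_, fun i j hij => ?_⟩
  · fin_cases i <;> assumption
  · fin_cases i <;> fin_cases j <;>
      first | exact absurd rfl hij | assumption | (apply Disjoint.symm; assumption)
  · fin_cases i <;> fin_cases j <;>
      first | exact absurd rfl hij | assumption | (apply sw; assumption)

end KFour

/-! ### Rooted trees -/

section RootedTree

open Relation

variable {V : Type*} {T : SimpleGraph V} {r : V}

namespace AncestorOrEq

theorem refl (hT : T.IsTree) (v : V) : AncestorOrEq T r v v := by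
  obtain ⟨p, hp, -⟩ := hT.existsUnique_path r v
  exact ⟨p, hp, p.end_mem_support⟩

theorem root (hT : T.IsTree) (v : V) : AncestorOrEq T r r v := by
  obtain ⟨p, hp, -⟩ := hT.existsUnique_path r v
  exact ⟨p, hp, p.start_mem_support⟩

theorem trans (hT : T.IsTree) {u v w : V} (h₁ : AncestorOrEq T r u v)
    (h₂ : AncestorOrEq T r v w) : AncestorOrEq T r u w := by
  classical
  obtain ⟨p, hp, hu⟩ := h₁
  obtain ⟨q, hq, hv⟩ := h₂
  have := (hT.existsUnique_path r v).unique hp (hq.takeUntil hv)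
  subst this
  exact ⟨q, hq, q.support_takeUntil_subset_support hv hu⟩

/-- The number of edges between the root and `v`. -/
theorem exists_depth (hT : T.IsTree) (r : V) : ∃ d : V → ℕ,
    (∀ u v, AncestorOrEq T r u v → d u ≤ d v) ∧
      (∀ u v, AncestorOrEq T r u v → d u = d v → u = v) := by
  classical
  choose p hp hu using fun v => hT.existsUnique_path r v
  have key : ∀ u v, AncestorOrEq T r u v → ∃ h : u ∈ (p v).support, (p v).takeUntil u h = p u := by
    rintro u v ⟨q, hq, h⟩
    obtain rfl := hu v q hq
    exact ⟨h, hu u _ (hq.takeUntil h)⟩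
  refine ⟨fun v => (p v).length, fun u v h => ?_, fun u v h he => ?_⟩
  · obtain ⟨h, h'⟩ := key u v h
    simp only [← h']
    exact (p v).length_takeUntil_le_length h
  · obtain ⟨h, h'⟩ := key u v h
    by_contra hne
    have := SimpleGraph.Walk.length_takeUntil_lt_length h hne
    rw [h'] at this
    exact this.ne he

theorem antisymm (hT : T.IsTree) {u v : V} (h₁ : AncestorOrEq T r u v)
    (h₂ : AncestorOrEq T r v u) : u = v := by
  obtain ⟨d, hd, hd'⟩ := exists_depth hT r
  exact hd' u v h₁ (le_antisymm (hd _ _ h₁) (hd _ _ h₂))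

theorem exists_parent {u v : V} (h : AncestorOrEq T r u v) (hne : u ≠ v) :
    ∃ q, IsTreeParent T r q v ∧ AncestorOrEq T r u q := by
  classical
  obtain ⟨p, hp, hu⟩ := h
  have hnil : ¬ p.Nil := by
    intro hn
    have h1 := hn.eq
    subst h1
    have := SimpleGraph.Walk.nil_iff_support_eq.1 hn
    rw [this] at hu
    exact hne (by simpa using hu)
  refine ⟨p.penultimate, ⟨p.adj_penultimate hnil, p, hp, ?_⟩, p.dropLast, hp.dropLast, ?_⟩
  · exact p.getVert_mem_support _
  · have := p.support_dropLast_concat hnil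
    rw [← this] at hu
    simpa [hne] using hu

end AncestorOrEq

namespace IsTreeParent

theorem ne {q v : V} (h : IsTreeParent T r q v) : q ≠ v := h.1.ne

theorem not_anc (hT : T.IsTree) {q v : V} (h : IsTreeParent T r q v) :
    ¬ AncestorOrEq T r v q := fun h' => h.ne (h.2.antisymm hT h')

/-- The parent of `v` must be the penultimate vertex of the path from the root to `v`. -/
theorem unique (hT : T.IsTree) {q q' v : V} (h : IsTreeParent T r q v)
    (h' : IsTreeParent T r q' v) : q = q' := by
  classical
  have key : ∀ q, IsTreeParent T r q v → ∀ p : T.Walk r v, p.IsPath → q = p.penultimate := by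
    intro q h p hp
    obtain ⟨p', hp', -⟩ := hT.existsUnique_path r q
    have hv : v ∉ p'.support := fun hv => h.not_anc hT ⟨p', hp', hv⟩
    have := (hT.existsUnique_path r v).unique hp (hp'.concat hv h.1)
    rw [this]
    simp
  obtain ⟨p, hp, -⟩ := hT.existsUnique_path r v
  rw [key q h p hp, key q' h' p hp]

theorem anc_of_ne (hT : T.IsTree) {q u v : V} (h : IsTreeParent T r q v)
    (hu : AncestorOrEq T r u v) (hne : u ≠ v) : AncestorOrEq T r u q := by
  obtain ⟨q', hq', h'⟩ := hu.exists_parent hne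
  rwa [h.unique hT hq']

end IsTreeParent

theorem not_isTreeParent_root (hT : T.IsTree) {q : V} : ¬ IsTreeParent T r q r := fun h =>
  h.not_anc hT (AncestorOrEq.root hT q)

theorem exists_isTreeParent (hT : T.IsTree) {v : V} (hv : v ≠ r) : ∃ q, IsTreeParent T r q v := by
  obtain ⟨q, hq, -⟩ := (AncestorOrEq.root hT v).exists_parent hv.symm
  exact ⟨q, hq⟩

theorem isTreeParent_or_of_adj (hT : T.IsTree) {x y : V} (h : T.Adj x y) :
    IsTreeParent T r x y ∨ IsTreeParent T r y x := by
  obtain ⟨p, hp, -⟩ := hT.existsUnique_path r x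
  by_cases hy : y ∈ p.support
  · exact Or.inr ⟨h.symm, p, hp, hy⟩
  · refine Or.inl ⟨h, p.concat h, hp.concat hy h, ?_⟩
    simp [SimpleGraph.Walk.support_concat]

/-- Induction from the root downwards. -/
theorem IsTree.topDown_induction (hT : T.IsTree) {p : V → Prop} (root : p r)
    (step : ∀ q v, IsTreeParent T r q v → p q → p v) (v : V) : p v := by
  obtain ⟨d, hd, hd'⟩ := AncestorOrEq.exists_depth hT r
  induction h : d v using Nat.strong_induction_on generalizing v with
  | _ n ih =>
    by_cases hv : v = r
    · exact hv ▸ root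
    · obtain ⟨q, hq⟩ := exists_isTreeParent hT hv
      refine step q v hq (ih (d q) ?_ q rfl)
      have h1 := hd _ _ hq.2
      have h2 : d q ≠ d v := fun h => hq.ne (hd' _ _ hq.2 h)
      omega

/-- Induction downwards from an ancestor. -/
theorem AncestorOrEq.induction (hT : T.IsTree) {a : V} {p : V → Prop} (base : p a)
    (step : ∀ q v, IsTreeParent T r q v → AncestorOrEq T r a q → p q → p v) {v : V}
    (h : AncestorOrEq T r a v) : p v := by
  refine IsTree.topDown_induction (r := r) hT (p := fun v => AncestorOrEq T r a v → p v) ?_ ?_ v h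
  · intro h
    rwa [← h.antisymm hT (AncestorOrEq.root hT a)]
  · intro q v hq ih h
    by_cases hav : a = v
    · rwa [← hav]
    · have := hq.anc_of_ne hT h hav
      exact step q v hq this (ih this)

theorem AncestorOrEq.total (hT : T.IsTree) {u u' v : V} (h : AncestorOrEq T r u v)
    (h' : AncestorOrEq T r u' v) : AncestorOrEq T r u u' ∨ AncestorOrEq T r u' u := by
  refine AncestorOrEq.induction (p := fun v => AncestorOrEq T r u' v →
    AncestorOrEq T r u u' ∨ AncestorOrEq T r u' u) hT (fun h => Or.inr h) ?_ h h'
  intro q v hq hu ih h'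
  by_cases hv : u' = v
  · subst hv
    exact Or.inl (hu.trans hT hq.2)
  · exact ih (hq.anc_of_ne hT h' hv)

/-- The child of a proper ancestor `c` of `v` towards `v`. -/
theorem AncestorOrEq.exists_child (hT : T.IsTree) {c v : V} (h : AncestorOrEq T r c v)
    (hne : c ≠ v) : ∃ a, IsTreeParent T r c a ∧ AncestorOrEq T r a v := by
  refine AncestorOrEq.induction (p := fun v => c ≠ v →
    ∃ a, IsTreeParent T r c a ∧ AncestorOrEq T r a v) hT (fun h => absurd rfl h) ?_ h hne
  intro q v hq hc ih hne
  by_cases hcq : c = q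
  · subst hcq
    exact ⟨v, hq, .refl hT v⟩
  · obtain ⟨a, ha, ha'⟩ := ih hcq
    exact ⟨a, ha, ha'.trans hT hq.2⟩

/-- Distinct siblings are unrelated. -/
theorem IsTreeParent.eq_of_anc (hT : T.IsTree) {c a b : V} (ha : IsTreeParent T r c a)
    (hb : IsTreeParent T r c b) (h : AncestorOrEq T r a b) : a = b := by
  by_contra hne
  exact ha.not_anc hT (hb.anc_of_ne hT h hne)

theorem IsTreeParent.eq_of_common (hT : T.IsTree) {c a b x : V} (ha : IsTreeParent T r c a)
    (hb : IsTreeParent T r c b) (h : AncestorOrEq T r a x) (h' : AncestorOrEq T r b x) : a = b := by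
  rcases h.total hT h' with h | h
  · exact ha.eq_of_anc hT hb h
  · exact (hb.eq_of_anc hT ha h).symm

/-- The branches of the tree towards two unrelated vertices. -/
theorem exists_branch (hT : T.IsTree) {x y : V} (hxy : ¬ AncestorOrEq T r x y)
    (hyx : ¬ AncestorOrEq T r y x) : ∃ c a b, IsTreeParent T r c a ∧ IsTreeParent T r c b ∧
      a ≠ b ∧ AncestorOrEq T r a x ∧ AncestorOrEq T r b y := by
  have key : ∀ z, AncestorOrEq T r z x → ¬ AncestorOrEq T r z y →
      ∃ c a b, IsTreeParent T r c a ∧ IsTreeParent T r c b ∧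
      a ≠ b ∧ AncestorOrEq T r a x ∧ AncestorOrEq T r b y := by
    refine IsTree.topDown_induction (r := r) hT (fun _ h => absurd (.root hT y) h) ?_
    intro q v hq ih hx hy
    by_cases hqy : AncestorOrEq T r q y
    · have hne : q ≠ y := by
        rintro rfl
        exact hyx (hq.2.trans hT hx)
      obtain ⟨b, hb, hb'⟩ := hqy.exists_child hT hne
      refine ⟨q, v, b, hq, hb, ?_, hx, hb'⟩
      rintro rfl
      exact hy hb'
    · exact ih (hq.2.trans hT hx) hqy
  exact key x (.refl hT x) hxy

theorem isLca_of_branch (hT : T.IsTree) {c a b x y : V} (ha : IsTreeParent T r c a)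
    (hb : IsTreeParent T r c b) (hab : a ≠ b) (hx : AncestorOrEq T r a x)
    (hy : AncestorOrEq T r b y) : IsLca T r c x y := by
  refine ⟨ha.2.trans hT hx, hb.2.trans hT hy, fun z hzx hzy => ?_⟩
  rcases hzx.total hT hx with h | h
  · by_cases hza : z = a
    · subst hza
      exact absurd (ha.eq_of_common hT hb hzy hy) hab
    · exact ha.anc_of_ne hT h hza
  · exact absurd (ha.eq_of_common hT hb (h.trans hT hzy) hy) hab

/-- Ancestors are the vertices separating from the root. -/
theorem ancestorOrEq_iff_not_reach (hT : T.IsTree) (u v : V) : AncestorOrEq T r u v ↔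
    ¬ (r ≠ u ∧ ReflTransGen (fun x y => T.Adj x y ∧ y ≠ u) r v) := by
  constructor
  · rintro h ⟨hr, hp⟩
    have key : ∀ v, ReflTransGen (fun x y => T.Adj x y ∧ y ≠ u) r v → ¬ AncestorOrEq T r u v := by
      intro v hp
      induction hp with
      | refl => exact fun h => hr ((h.antisymm hT (.root hT u)).symm)
      | tail _ hab ih =>
        intro h
        rcases isTreeParent_or_of_adj (r := r) hT hab.1 with h' | h'
        · exact ih (h'.anc_of_ne hT h hab.2.symm)
        · exact ih (h.trans hT h'.2)
    exact key v hp h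
  · intro h
    by_contra hv
    refine h ⟨fun h => hv (h ▸ .root hT v), ?_⟩
    refine IsTree.topDown_induction (r := r) hT (p := fun v => ¬ AncestorOrEq T r u v →
      ReflTransGen (fun x y => T.Adj x y ∧ y ≠ u) r v) (fun _ => .refl) ?_ v hv
    intro q v hq ih hv
    refine (ih fun h => hv (h.trans hT hq.2)).tail ⟨hq.1, ?_⟩
    rintro rfl
    exact hv (.refl hT _)

variable {G : SimpleGraph V}

/-- An upward closed set is connected. -/
theorem connOn_of_upward_closed (hT : T.IsTree) (hle : T ≤ G) (a : V) {S : Set V}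
    (hS : ∀ x ∈ S, AncestorOrEq T r a x)
    (h : ∀ x ∈ S, x ≠ a → ∀ q, IsTreeParent T r q x → q ∈ S) : ConnOn G.Adj S := by
  refine ConnOn.of_center (fun _ _ h => h.symm) a fun x hx => ?_
  refine AncestorOrEq.induction (p := fun x => x ∈ S → ReflTransGen _ x a) hT (fun _ => .refl) ?_
    (hS x hx) hx
  intro q x hq hv ih hx
  by_cases hxa : x = a
  · rw [hxa]
  · have := h x hx hxa q hq
    exact .head ⟨(hle hq.1).symm, hx, this⟩ (ih this)

theorem connOn_subtree (hT : T.IsTree) (hle : T ≤ G) (v : V) :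
    ConnOn G.Adj {x | AncestorOrEq T r v x} :=
  connOn_of_upward_closed (r := r) hT hle v (fun _ hx => hx)
    fun _ hx hne _ hq => hq.anc_of_ne hT hx hne.symm

end RootedTree

/-! ### The canonical decomposition -/

open Relation in
/-- After its last visit to `a`, a chain avoids `a`. -/
theorem exists_last_exit {α : Type*} {s : α → α → Prop} {a b : α} (h : ReflTransGen s a b) :
    a = b ∨ ∃ x, s a x ∧ x ≠ a ∧ b ≠ a ∧ ReflTransGen (fun x y => s x y ∧ x ≠ a ∧ y ≠ a) x b := by
  induction h with
  | refl => exact Or.inl rfl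
  | @tail b c _ hbc ih =>
    by_cases hc : c = a
    · exact Or.inl hc.symm
    · right
      rcases ih with rfl | ⟨x, hx, hxa, hb, hp⟩
      · exact ⟨c, hbc, hc, hc, .refl⟩
      · exact ⟨x, hx, hxa, hc, hp.tail ⟨hbc, hb, hc⟩⟩

/-- A graph with a rooted spanning tree. -/
structure RootedGraph (V : Type*) where
  graph : SimpleGraph V
  tree : SimpleGraph V
  root : V

namespace RootedGraph

open Relation

variable {V : Type*} (R : RootedGraph V)

abbrev anc (u v : V) : Prop := AncestorOrEq R.tree R.root u v

abbrev par (u v : V) : Prop := IsTreeParent R.tree R.root u v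

/-- The subtrees below `a` and `b` are adjacent. -/
def SubAdj (a b : V) : Prop := ∃ x y, R.anc a x ∧ R.anc b y ∧ R.graph.Adj x y

/-- Siblings with adjacent subtrees. -/
def SibAdj (a b : V) : Prop := a ≠ b ∧ (∃ c, R.par c a ∧ R.par c b) ∧ R.SubAdj a b

/-- There is an edge from the subtree below `v` leaving the subtree below the parent of `v`. -/
def Out (v : V) : Prop :=
  ∃ q x y, R.par q v ∧ R.anc v x ∧ ¬ R.anc q y ∧ R.graph.Adj x y

/-- The designated vertex of a component of the sibling graph. -/
def IsStarter [LT V] (a : V) : Prop :=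
  R.Out a ∨ ((∀ a', ReflTransGen R.SibAdj a a' → ¬ R.Out a') ∧
    ∀ a', ReflTransGen R.SibAdj a a' → ¬ a' < a)

/-- `x` is joined to a starter by a path of the sibling graph avoiding `b`. -/
def Avoids [LT V] (b x : V) : Prop :=
  ∃ s, (R.IsStarter s ∧ s ≠ b) ∧ ReflTransGen (fun x y => R.SibAdj x y ∧ x ≠ b ∧ y ≠ b) s x

/-- `a` is the parent of `b` in the sibling graph rooted at the starters. -/
def IsSibParent [LT V] (a b : V) : Prop := R.SibAdj a b ∧ R.Avoids b a

/-- Some edge between the subtrees below `b` and below its sibling parent leaves the subtree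
below `v`, where `v` is a proper descendant of one of these two vertices. -/
def Crosses [LT V] (v b : V) : Prop :=
  ∃ a, R.IsSibParent a b ∧
    ((R.anc a v ∧ a ≠ v ∧ R.SubAdj v b) ∨ (R.anc b v ∧ b ≠ v ∧ R.SubAdj v a))

/-- The label `b` has priority over `b'` at `v`. -/
def Before [LT V] (v b b' : V) : Prop :=
  (∃ c c', R.par c b ∧ R.par c' b' ∧ R.anc c c' ∧ c ≠ c') ∨
    ∃ c, R.par c b ∧ R.par c b' ∧ (R.anc b v ∨ (¬ R.anc b' v ∧ b < b'))

/-- `b` is the first label crossing `v`. -/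
def First [LT V] (v b : V) : Prop :=
  R.Crosses v b ∧ ∀ b', R.Crosses v b' → b' = b ∨ R.Before v b b'

/-- The parent edge of `v`, if it is not the parent edge of `v = b`, belongs to the hammock with
right root `b`. -/
def Owner [LT V] (v b : V) : Prop :=
  ∃ v₀, ((v₀ = b ∧ ¬ R.IsStarter b) ∨ R.First v₀ b) ∧
    ReflTransGen (fun x y => R.par x y ∧ R.IsStarter y ∧ ¬ R.Out y) v₀ v

/-- The candidates for the left root of the hammock with right root `b`. -/
def LeftCand [LT V] (b u : V) : Prop :=
  R.IsSibParent u b ∨ ∃ a, R.IsSibParent a b ∧ R.anc a u ∧ a ≠ u ∧ R.SubAdj u b ∧ ¬ R.First u b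

/-- `u` is the left root of the hammock with right root `b`. -/
def IsLeftRoot [LT V] (b u : V) : Prop := R.LeftCand b u ∧ ∀ v, R.LeftCand b v → R.anc v u

/-- `R.tree` is a spanning tree of a series-parallel graph, and the other edges join unrelated
vertices. -/
structure Valid : Prop where
  isTree : R.tree.IsTree
  le : R.tree ≤ R.graph
  seriesParallel : IsSeriesParallel R.graph
  cross : ∀ x y, R.graph.Adj x y → ¬ R.tree.Adj x y → ¬ R.anc x y

variable {R}

theorem SubAdj.symm {a b : V} (h : R.SubAdj a b) : R.SubAdj b a := by
  obtain ⟨x, y, hx, hy, h⟩ := h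
  exact ⟨y, x, hy, hx, h.symm⟩

theorem SibAdj.symm {a b : V} (h : R.SibAdj a b) : R.SibAdj b a := by
  obtain ⟨h1, ⟨c, h2, h3⟩, h4⟩ := h
  exact ⟨h1.symm, ⟨c, h3, h2⟩, h4.symm⟩

theorem reflTransGen_sibAdj_symm {a b : V} (h : ReflTransGen R.SibAdj a b) :
    ReflTransGen R.SibAdj b a := by
  induction h with
  | refl => exact .refl
  | tail _ h ih => exact .head h.symm ih

theorem reflTransGen_avoid_symm {c a b : V}
    (h : ReflTransGen (fun x y => R.SibAdj x y ∧ x ≠ c ∧ y ≠ c) a b) :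
    ReflTransGen (fun x y => R.SibAdj x y ∧ x ≠ c ∧ y ≠ c) b a := by
  induction h with
  | refl => exact .refl
  | tail _ h ih => exact .head ⟨h.1.symm, h.2.2, h.2.1⟩ ih

/-! ### What the K₄ obstruction says about subtrees and the sibling graph. -/

namespace Valid

variable (h : R.Valid)

include h

theorem SubAdj_mono {a a' b : V} (ha : R.anc a' a) (hab : R.SubAdj a b) : R.SubAdj a' b := by
  obtain ⟨x, y, hx, hy, hxy⟩ := hab
  exact ⟨x, y, ha.trans h.isTree hx, hy, hxy⟩

theorem par_of_sibAdj {a b c : V} (hab : R.SibAdj a b) (hc : R.par c a) : R.par c b := by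
  obtain ⟨-, ⟨c', h1, h2⟩, -⟩ := hab
  rwa [hc.unique h.isTree h1]

theorem par_of_reach {a b c : V} (hab : ReflTransGen R.SibAdj a b) (hc : R.par c a) :
    R.par c b := by
  induction hab with
  | refl => exact hc
  | tail _ hs ih => exact h.par_of_sibAdj hs ih

theorem ne_root_of_out {v : V} (hv : R.Out v) : v ≠ R.root := by
  obtain ⟨q, -, -, hq, -⟩ := hv
  rintro rfl
  exact not_isTreeParent_root h.isTree hq

/-- The union of the subtrees below a chain of siblings is connected. -/
theorem connOn_chain {x : V} {s : V → V → Prop} (hs : ∀ a b, s a b → R.SibAdj a b) :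
    ConnOn R.graph.Adj {y | ∃ z, ReflTransGen s x z ∧ R.anc z y} := by
  set U : Set V := {y | ∃ z, ReflTransGen s x z ∧ R.anc z y} with hU
  have sub : ∀ z, ReflTransGen s x z → ∀ y₁ y₂, R.anc z y₁ → R.anc z y₂ →
      ReflTransGen (fun a b => R.graph.Adj a b ∧ a ∈ U ∧ b ∈ U) y₁ y₂ := by
    intro z hz y₁ y₂ h₁ h₂
    refine ReflTransGen.mono (fun a b hab => ?_) _ _
      (connOn_subtree (r := R.root) h.isTree h.le z y₁ h₁ y₂ h₂)
    exact ⟨hab.1, ⟨z, hz, hab.2.1⟩, ⟨z, hz, hab.2.2⟩⟩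
  have key : ∀ z, ReflTransGen s x z →
      ReflTransGen (fun a b => R.graph.Adj a b ∧ a ∈ U ∧ b ∈ U) z x := by
    intro z hz
    induction hz with
    | refl => exact .refl
    | @tail z w hz hzw ih =>
      obtain ⟨-, -, p, q, hp, hq, hpq⟩ := hs _ _ hzw
      have hw := hz.tail hzw
      refine (sub w hw w q (.refl h.isTree w) hq).trans (.head ⟨hpq.symm, ⟨w, hw, hq⟩, ⟨z, hz, hp⟩⟩ ?_)
      exact (sub z hz p z hp (.refl h.isTree z)).trans ih
  refine ConnOn.of_center (fun _ _ h => h.symm) x ?_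
  rintro y ⟨z, hz, hy⟩
  exact (sub z hz y z hy (.refl h.isTree z)).trans (key z hz)

theorem connOn_compl (c : V) : ConnOn R.graph.Adj {y | ¬ R.anc c y} :=
  connOn_of_upward_closed (r := R.root) h.isTree h.le R.root (fun x _ => .root h.isTree x)
    fun _ hx _ _ hq hc => hx (hc.trans h.isTree hq.2)

/-- Otherwise there is a K₄: the subtree of `a`, the union of the subtrees along the chain after its
last visit to `a`, the common parent, and everything outside the subtree of that parent. Both `a`
and `a'` have edges to the outside, and the parent is not the root since the outside is nonempty. -/
theorem out_unique [Finite V] {a a' : V} (ha : R.Out a) (ha' : R.Out a')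
    (haa : ReflTransGen R.SibAdj a a') : a = a' := by
  rcases exists_last_exit haa with rfl | ⟨x, hx, hxa, ha'a, hp⟩
  · rfl
  exfalso
  have hT := h.isTree
  obtain ⟨c, x₁, y₁, hca, hx₁, hy₁, hxy₁⟩ := ha
  obtain ⟨c', x₂, y₂, hca', hx₂, hy₂, hxy₂⟩ := ha'
  obtain rfl : c' = c := hca'.unique hT (h.par_of_reach haa hca)
  have hcx := h.par_of_sibAdj hx hca
  have hz : ∀ z, ReflTransGen (fun x y => R.SibAdj x y ∧ x ≠ a ∧ y ≠ a) x z →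
      R.par c' z ∧ z ≠ a := by
    intro z hz
    refine ⟨h.par_of_reach (ReflTransGen.mono (fun _ _ h => h.1) _ _ hz) hcx, ?_⟩
    rcases ReflTransGen.cases_tail hz with rfl | ⟨_, -, h⟩
    · exact hxa
    · exact h.2.2
  have hcr : c' ≠ R.root := by
    rintro rfl
    exact hy₁ (.root hT y₁)
  obtain ⟨q, hq⟩ := exists_isTreeParent hT hcr
  obtain ⟨-, -, p₁, p₂, hp₁, hp₂, hpp⟩ := hx
  refine h.seriesParallel.false_of_four_sets (A := {y | R.anc a y})
    (B := {y | ∃ z, ReflTransGen (fun x y => R.SibAdj x y ∧ x ≠ a ∧ y ≠ a) x z ∧ R.anc z y})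
    (C := {c'}) (D := {y | ¬ R.anc c' y}) (connOn_subtree hT h.le a)
    (h.connOn_chain fun _ _ h => h.1) ?_ (h.connOn_compl c') ?_ ?_ ?_ ?_ ?_ ?_ ?_ ?_ ?_ ?_ ?_ ?_
  · rintro u rfl v rfl
    exact .refl
  · rw [Set.disjoint_left]
    rintro y hy ⟨z, hz', hzy⟩
    exact (hz z hz').2 ((hz z hz').1.eq_of_common hT hca hzy hy)
  · rw [Set.disjoint_left]
    rintro y hy rfl
    exact hca.not_anc hT hy
  · rw [Set.disjoint_left]
    intro y hy hy'
    exact hy' (hca.2.trans hT hy)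
  · rw [Set.disjoint_left]
    rintro y ⟨z, hz', hzy⟩ rfl
    exact (hz z hz').1.not_anc hT hzy
  · rw [Set.disjoint_left]
    rintro y ⟨z, hz', hzy⟩ hy'
    exact hy' ((hz z hz').1.2.trans hT hzy)
  · rw [Set.disjoint_left]
    rintro y rfl hy'
    exact hy' (.refl hT y)
  · exact ⟨p₁, hp₁, p₂, ⟨x, .refl, hp₂⟩, hpp⟩
  · exact ⟨a, .refl hT a, c', rfl, (h.le hca.1).symm⟩
  · exact ⟨x₁, hx₁, y₁, hy₁, hxy₁⟩
  · exact ⟨x, ⟨x, .refl, .refl hT x⟩, c', rfl, (h.le hcx.1).symm⟩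
  · exact ⟨x₂, ⟨a', hp, hx₂⟩, y₂, hy₂, hxy₂⟩
  · exact ⟨c', rfl, q, hq.not_anc hT, (h.le hq.1).symm⟩

/-- A cycle through `b` in the sibling graph gives a K₄: the subtree of `a`, the subtrees on the
rest of the chain, the subtree of `b`, and the common parent `c` together with everything outside
its subtree. Hence the sibling graph is a forest. -/
theorem sibParent_unique_aux [Finite V] {a a' b : V} (hab : R.SibAdj a b) (hab' : R.SibAdj a' b)
    (hp : ReflTransGen (fun x y => R.SibAdj x y ∧ x ≠ b ∧ y ≠ b) a a') : a = a' := by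
  rcases exists_last_exit hp with rfl | ⟨x, ⟨hax, -, hxb⟩, hxa, ha'a, hp'⟩
  · rfl
  exfalso
  have hT := h.isTree
  obtain ⟨hne, ⟨c, hca, hcb⟩, hs⟩ := id hab
  have hcx := h.par_of_sibAdj hax hca
  have hz : ∀ z, ReflTransGen (fun x y => (R.SibAdj x y ∧ x ≠ b ∧ y ≠ b) ∧ x ≠ a ∧ y ≠ a) x z →
      R.par c z ∧ z ≠ a ∧ z ≠ b := by
    intro z hz
    refine ⟨h.par_of_reach (ReflTransGen.mono (fun _ _ h => h.1.1) _ _ hz) hcx, ?_⟩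
    rcases ReflTransGen.cases_tail hz with rfl | ⟨_, -, h⟩
    · exact ⟨hxa, hxb⟩
    · exact ⟨h.2.2, h.1.2.2⟩
  obtain ⟨-, -, p₁, p₂, hp₁, hp₂, hpp⟩ := hax
  obtain ⟨-, -, p₃, p₄, hp₃, hp₄, hpp'⟩ := hab'
  obtain ⟨p₅, p₆, hp₅, hp₆, hpp''⟩ := hs
  refine h.seriesParallel.false_of_four_sets (A := {y | R.anc a y}) (B := {y | ∃ z,
    ReflTransGen (fun x y => (R.SibAdj x y ∧ x ≠ b ∧ y ≠ b) ∧ x ≠ a ∧ y ≠ a) x z ∧ R.anc z y})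
    (C := {y | R.anc b y}) (D := {y | R.anc c y → y = c}) (connOn_subtree hT h.le a)
    (h.connOn_chain fun _ _ h => h.1.1) (connOn_subtree hT h.le b)
    (connOn_of_upward_closed (r := R.root) hT h.le R.root (fun x _ => .root hT x) ?_)
    ?_ ?_ ?_ ?_ ?_ ?_ ?_ ?_ ?_ ?_ ?_ ?_
  · intro x hx _ q hq hcq
    have := hx (hcq.trans hT hq.2)
    subst this
    exact absurd hcq (hq.not_anc hT)
  · rw [Set.disjoint_left]
    rintro y hy ⟨z, hz', hzy⟩
    exact (hz z hz').2.1 ((hz z hz').1.eq_of_common hT hca hzy hy)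
  · rw [Set.disjoint_left]
    intro y hy hy'
    exact hne (hca.eq_of_common hT hcb hy hy')
  · rw [Set.disjoint_left]
    intro y hy hy'
    have := hy' (hca.2.trans hT hy)
    subst this
    exact hca.not_anc hT hy
  · rw [Set.disjoint_left]
    rintro y ⟨z, hz', hzy⟩ hy
    exact (hz z hz').2.2 ((hz z hz').1.eq_of_common hT hcb hzy hy)
  · rw [Set.disjoint_left]
    rintro y ⟨z, hz', hzy⟩ hy'
    have := hy' ((hz z hz').1.2.trans hT hzy)
    subst this
    exact (hz z hz').1.not_anc hT hzy
  · rw [Set.disjoint_left]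
    intro y hy hy'
    have := hy' (hcb.2.trans hT hy)
    subst this
    exact hcb.not_anc hT hy
  · exact ⟨p₁, hp₁, p₂, ⟨x, .refl, hp₂⟩, hpp⟩
  · exact ⟨p₅, hp₅, p₆, hp₆, hpp''⟩
  · exact ⟨a, .refl hT a, c, fun _ => rfl, (h.le hca.1).symm⟩
  · exact ⟨p₃, ⟨a', hp', hp₃⟩, p₄, hp₄, hpp'⟩
  · exact ⟨x, ⟨x, .refl, .refl hT x⟩, c, fun _ => rfl, (h.le hcx.1).symm⟩
  · exact ⟨b, .refl hT b, c, fun _ => rfl, (h.le hcb.1).symm⟩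

theorem connOn_diff {a v : V} :
    ConnOn R.graph.Adj {y | R.anc a y ∧ ¬ R.anc v y} := by
  have hT := h.isTree
  refine connOn_of_upward_closed (r := R.root) hT h.le a (fun x hx => hx.1) ?_
  intro x hx hxa q hq
  exact ⟨hq.anc_of_ne hT hx.1 (Ne.symm hxa), fun h => hx.2 (h.trans hT hq.2)⟩

/-- If the subtree below a proper descendant `v` of `a` is adjacent to that of the sibling `b` of
`a` and to the outside, then all neighbours of the subtree below `b` are below `v`. -/
theorem anc_of_subAdj_sibling [Finite V] {c a b v x y x' y' : V} (hca : R.par c a)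
    (hcb : R.par c b) (hab : a ≠ b) (hav : R.anc a v) (hne : a ≠ v) (hvb : R.SubAdj v b)
    (hx : R.anc v x) (hya : ¬ R.anc a y) (hyb : ¬ R.anc b y) (hxy : R.graph.Adj x y)
    (hx' : R.anc a x') (hy' : R.anc b y') (hxy' : R.graph.Adj x' y') : R.anc v x' := by
  by_contra hvx'
  have hT := h.isTree
  obtain ⟨p, q, hp, hq, hpq⟩ := hvb
  obtain ⟨t, ht, hat⟩ := hav.exists_parent hne
  -- An edge to the subtree of `b` starting off `v` would make the rest of the subtree of `a`
  -- adjacent to that of `b`. Its other links are the parent edges of `v` and `a`.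
  refine h.seriesParallel.false_of_four_sets (A := {y | R.anc v y})
    (B := {y | R.anc a y ∧ ¬ R.anc v y}) (C := {y | R.anc b y})
    (D := {y | ¬ R.anc a y ∧ ¬ R.anc b y}) (connOn_subtree hT h.le v) h.connOn_diff
    (connOn_subtree hT h.le b)
    (connOn_of_upward_closed (r := R.root) hT h.le R.root (fun x _ => .root hT x) ?_)
    ?_ ?_ ?_ ?_ ?_ ?_ ?_ ?_ ?_ ?_ ?_ ?_
  · intro x hx _ q hq
    exact ⟨fun h => hx.1 (h.trans hT hq.2), fun h => hx.2 (h.trans hT hq.2)⟩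
  · exact Set.disjoint_left.2 fun y hy hy' => hy'.2 hy
  · exact Set.disjoint_left.2 fun y hy hy' =>
      hab (hca.eq_of_common hT hcb (hav.trans hT hy) hy')
  · exact Set.disjoint_left.2 fun y hy hy' => hy'.1 (hav.trans hT hy)
  · exact Set.disjoint_left.2 fun y hy hy' => hab (hca.eq_of_common hT hcb hy.1 hy')
  · exact Set.disjoint_left.2 fun y hy hy' => hy'.1 hy.1
  · exact Set.disjoint_left.2 fun y hy hy' => hy'.2 hy
  · exact ⟨v, .refl hT v, t, ⟨hat, ht.not_anc hT⟩, (h.le ht.1).symm⟩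
  · exact ⟨p, hp, q, hq, hpq⟩
  · exact ⟨x, hx, y, ⟨hya, hyb⟩, hxy⟩
  · exact ⟨x', ⟨hx', hvx'⟩, y', hy', hxy'⟩
  · exact ⟨a, ⟨.refl hT a, fun h => hne (hav.antisymm hT h)⟩, c,
      ⟨hca.not_anc hT, hcb.not_anc hT⟩, (h.le hca.1).symm⟩
  · exact ⟨b, .refl hT b, c, ⟨hca.not_anc hT, hcb.not_anc hT⟩, (h.le hcb.1).symm⟩

/-- If the subtree below a proper descendant `v` of `a` is adjacent to that of the sibling `b` of
`a` and to the outside of the subtree below their parent `c`, then all edges from the subtree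
below `a` to the outside of that below `c` start below `v`. -/
theorem anc_of_subAdj_outside [Finite V] {c a b v x y x' y' : V} (hca : R.par c a)
    (hcb : R.par c b) (hab : a ≠ b) (hav : R.anc a v) (hne : a ≠ v) (hvb : R.SubAdj v b)
    (hx : R.anc v x) (hy : ¬ R.anc c y) (hxy : R.graph.Adj x y)
    (hx' : R.anc a x') (hy' : ¬ R.anc c y') (hxy' : R.graph.Adj x' y') : R.anc v x' := by
  by_contra hvx'
  have hT := h.isTree
  obtain ⟨p, q, hp, hq, hpq⟩ := hvb
  obtain ⟨t, ht, hat⟩ := hav.exists_parent hne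
  have hcr : c ≠ R.root := by
    rintro rfl
    exact hy (.root hT y)
  obtain ⟨d, hd⟩ := exists_isTreeParent hT hcr
  -- Here `c` is put together with the subtree of `b`, which leaves the complement of the subtree of
  -- `c` as a separate fourth set. The edge assumed to start off `v` supplies the adjacency between
  -- it and the rest of the subtree of `a`.
  refine h.seriesParallel.false_of_four_sets (A := {y | R.anc v y})
    (B := {y | R.anc a y ∧ ¬ R.anc v y}) (C := {y | R.anc b y ∨ y = c})
    (D := {y | ¬ R.anc c y}) (connOn_subtree hT h.le v) h.connOn_diff
    (connOn_of_upward_closed (r := R.root) hT h.le c ?_ ?_) (h.connOn_compl c)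
    ?_ ?_ ?_ ?_ ?_ ?_ ?_ ?_ ?_ ?_ ?_ ?_
  · rintro x (hx | rfl)
    exacts [hcb.2.trans hT hx, .refl hT x]
  · rintro x (hx | rfl) hne q hq
    · by_cases hbx : b = x
      · subst hbx
        exact Or.inr (hq.unique hT hcb)
      · exact Or.inl (hq.anc_of_ne hT hx hbx)
    · exact absurd rfl hne
  · exact Set.disjoint_left.2 fun y hy hy' => hy'.2 hy
  · rw [Set.disjoint_left]
    rintro z hz (hz' | rfl)
    · exact hab (hca.eq_of_common hT hcb (hav.trans hT hz) hz')
    · exact hca.not_anc hT (hav.trans hT hz)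
  · exact Set.disjoint_left.2 fun y hy hy' => hy' (hca.2.trans hT (hav.trans hT hy))
  · rw [Set.disjoint_left]
    rintro z hz (hz' | rfl)
    · exact hab (hca.eq_of_common hT hcb hz.1 hz')
    · exact hca.not_anc hT hz.1
  · exact Set.disjoint_left.2 fun y hy hy' => hy' (hca.2.trans hT hy.1)
  · rw [Set.disjoint_left]
    rintro y (hy | rfl) hy'
    · exact hy' (hcb.2.trans hT hy)
    · exact hy' (.refl hT y)
  · exact ⟨v, .refl hT v, t, ⟨hat, ht.not_anc hT⟩, (h.le ht.1).symm⟩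
  · exact ⟨p, hp, q, Or.inl hq, hpq⟩
  · exact ⟨x, hx, y, hy, hxy⟩
  · exact ⟨a, ⟨.refl hT a, fun h => hne (hav.antisymm hT h)⟩, c, Or.inr rfl, (h.le hca.1).symm⟩
  · exact ⟨x', ⟨hx', hvx'⟩, y', hy', hxy'⟩
  · exact ⟨c, Or.inr rfl, d, hd.not_anc hT, (h.le hd.1).symm⟩

/-- The branches of the tree towards the ends of an edge outside the tree. -/
theorem exists_branch_of_adj {x y : V} (hxy : R.graph.Adj x y) (hn : ¬ R.tree.Adj x y) :
    ∃ c a b, R.par c a ∧ R.par c b ∧ a ≠ b ∧ R.anc a x ∧ R.anc b y :=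
  exists_branch h.isTree (h.cross x y hxy hn) (h.cross y x hxy.symm fun h => hn h.symm)

/-- A tree edge starting below `v` cannot leave the subtree of `q`, so the edge is a cross edge. It
branches strictly above `q`, since otherwise `y` would be below `q`. -/
theorem exists_branch_of_out {q v x y : V} (hq : R.par q v) (hx : R.anc v x) (hy : ¬ R.anc q y)
    (hxy : R.graph.Adj x y) :
    ¬ R.tree.Adj x y ∧ ∃ c a b, R.par c a ∧ R.par c b ∧ a ≠ b ∧ R.anc a q ∧ R.anc a x ∧
      R.anc b y := by
  have hT := h.isTree
  have hn : ¬ R.tree.Adj x y := by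
    intro hn
    rcases isTreeParent_or_of_adj (r := R.root) hT hn with h' | h'
    · exact hy (hq.2.trans hT (hx.trans hT h'.2))
    · by_cases hvx : v = x
      · subst hvx
        rw [h'.unique hT hq] at hy
        exact hy (.refl hT q)
      · exact hy (hq.2.trans hT (h'.anc_of_ne hT hx hvx))
  refine ⟨hn, ?_⟩
  obtain ⟨c, a, b, ha, hb, hab, hax, hby⟩ := h.exists_branch_of_adj hxy hn
  refine ⟨c, a, b, ha, hb, hab, ?_, hax, hby⟩
  rcases hax.total hT (hq.2.trans hT hx) with h' | h'
  · exact h'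
  · by_cases hqa : q = a
    · exact hqa ▸ .refl hT _
    · exact absurd ((ha.anc_of_ne hT h' hqa).trans hT (hb.2.trans hT hby)) hy

end Valid

end RootedGraph

set_option linter.unusedSectionVars false

/-! ### Starters, the rooted sibling forest, and the priority among crossing labels. -/

namespace RootedGraph

open Relation

variable {V : Type*} [LinearOrder V] [Finite V] {R : RootedGraph V}

namespace Valid

variable (h : R.Valid)

theorem exists_starter (b : V) : ∃ s, R.IsStarter s ∧ ReflTransGen R.SibAdj b s := by
  by_cases ho : ∃ a, ReflTransGen R.SibAdj b a ∧ R.Out a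
  · obtain ⟨a, ha, ho⟩ := ho
    exact ⟨a, Or.inl ho, ha⟩
  · push Not at ho
    obtain ⟨s, hs, hmin⟩ := Set.exists_min_image {a | ReflTransGen R.SibAdj b a} id
      (Set.toFinite _) ⟨b, .refl⟩
    refine ⟨s, Or.inr ⟨fun a ha => ho a (hs.trans ha), fun a ha => not_lt.2 (hmin a (hs.trans ha))⟩, hs⟩

include h

/-- A component containing an `Out` vertex has only that one as starter, by `out_unique`; in the
other components the starter is the minimum. -/
theorem starter_unique {s s' : V} (hs : R.IsStarter s) (hs' : R.IsStarter s')
    (hp : ReflTransGen R.SibAdj s s') : s = s' := by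
  have hp' := reflTransGen_sibAdj_symm hp
  rcases hs with hs | ⟨hs, hm⟩ <;> rcases hs' with hs' | ⟨hs', hm'⟩
  · exact h.out_unique hs hs' hp
  · exact absurd hs (hs' s hp')
  · exact absurd hs' (hs s' hp)
  · exact le_antisymm (not_lt.1 (hm _ hp)) (not_lt.1 (hm' _ hp'))

theorem isStarter_root : R.IsStarter R.root := by
  obtain ⟨s, hs, hp⟩ := exists_starter (R := R) R.root
  rcases ReflTransGen.cases_head hp with rfl | ⟨x, hx, -⟩
  · exact hs
  · obtain ⟨-, ⟨c, hc, -⟩, -⟩ := hx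
    exact absurd hc (not_isTreeParent_root h.isTree)

omit h in
theorem avoids_step {b x y : V} (hx : R.Avoids b x) (hxy : R.SibAdj x y) (hy : y ≠ b) :
    R.Avoids b y := by
  obtain ⟨s, hs, hp⟩ := hx
  refine ⟨s, hs, hp.tail ⟨hxy, ?_, hy⟩⟩
  rcases ReflTransGen.cases_tail hp with rfl | ⟨_, -, h⟩
  exacts [hs.2, h.2.2]

omit h in
theorem not_avoids_self (b : V) : ¬ R.Avoids b b := by
  rintro ⟨s, hs, hp⟩
  rcases ReflTransGen.cases_tail hp with rfl | ⟨_, -, h⟩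
  exacts [hs.2 rfl, h.2.2 rfl]

omit h in
theorem Avoids.exists_starter {b x : V} (hx : R.Avoids b x) :
    ∃ s, R.IsStarter s ∧ s ≠ b ∧ ReflTransGen R.SibAdj s x := by
  obtain ⟨s, hs, hp⟩ := hx
  exact ⟨s, hs.1, hs.2, ReflTransGen.mono (fun _ _ h => h.1) _ _ hp⟩

/-- The chain witnessing `Avoids` begins at a starter different from `b` in the component of `b`. -/
theorem not_isStarter_of_isSibParent {a b : V} (hab : R.IsSibParent a b) : ¬ R.IsStarter b := by
  intro hb
  obtain ⟨s, hs, hsb, hp⟩ := Avoids.exists_starter hab.2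
  exact hsb (h.starter_unique hs hb (hp.tail hab.1))

theorem sibParent_unique {a a' b : V} (hab : R.IsSibParent a b) (hab' : R.IsSibParent a' b) :
    a = a' := by
  obtain ⟨s, ⟨hs, hsb⟩, hp⟩ := id hab.2
  obtain ⟨s', ⟨hs', hsb'⟩, hp'⟩ := id hab'.2
  have h1 : ReflTransGen R.SibAdj s b := (ReflTransGen.mono (fun _ _ h => h.1) _ _ hp).tail hab.1
  have h2 : ReflTransGen R.SibAdj s' b := (ReflTransGen.mono (fun _ _ h => h.1) _ _ hp').tail hab'.1
  obtain rfl := h.starter_unique hs hs' (h1.trans (reflTransGen_sibAdj_symm h2))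
  exact h.sibParent_unique_aux hab.1 hab'.1 ((reflTransGen_avoid_symm hp).trans hp')

omit h in
theorem exists_sibParent {b : V} (hb : ¬ R.IsStarter b) : ∃ a, R.IsSibParent a b := by
  obtain ⟨s, hs, hp⟩ := Valid.exists_starter (R := R) b
  rcases exists_last_exit hp with rfl | ⟨x, hx, hxb, hsb, hp⟩
  · exact absurd hs hb
  · exact ⟨x, hx.symm, s, ⟨hs, hsb⟩, reflTransGen_avoid_symm hp⟩

omit h in
-- Follow a chain from the starter: whichever of `a`, `b` is met first is reached while avoiding the
-- other, and is its sibling parent.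
theorem sibParent_or {a b : V} (hab : R.SibAdj a b) : R.IsSibParent a b ∨ R.IsSibParent b a := by
  suffices R.Avoids b a ∨ R.Avoids a b by
    rcases this with h | h
    exacts [Or.inl ⟨hab, h⟩, Or.inr ⟨hab.symm, h⟩]
  obtain ⟨s, hs, hp⟩ := Valid.exists_starter (R := R) a
  have key : ∀ z, ReflTransGen R.SibAdj s z →
      (z ≠ a ∧ R.Avoids b z ∧ R.Avoids a z) ∨ R.Avoids b a ∨ R.Avoids a b := by
    intro z hz
    induction hz with
    | refl =>
      by_cases hsa : s = a
      · exact Or.inr (Or.inl ⟨s, ⟨hs, hsa ▸ hab.1⟩, hsa ▸ .refl⟩)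
      · by_cases hsb : s = b
        · exact Or.inr (Or.inr ⟨s, ⟨hs, hsa⟩, hsb ▸ .refl⟩)
        · exact Or.inl ⟨hsa, ⟨s, ⟨hs, hsb⟩, .refl⟩, ⟨s, ⟨hs, hsa⟩, .refl⟩⟩
    | @tail z w _ hzw ih =>
      rcases ih with ⟨hza, h1, h2⟩ | ih
      · by_cases hwa : w = a
        · exact Or.inr (Or.inl (avoids_step h1 (hwa ▸ hzw) hab.1))
        · by_cases hwb : w = b
          · exact Or.inr (Or.inr (avoids_step h2 (hwb ▸ hzw) hab.1.symm))
          · exact Or.inl ⟨hwa, avoids_step h1 hzw hwb, avoids_step h2 hzw hwa⟩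
      · exact Or.inr ih
  rcases key a (reflTransGen_sibAdj_symm hp) with ⟨h, -⟩ | h
  · exact absurd rfl h
  · exact h

/-- The chain from the starter to `a` avoids `b`; the vertex from which it finally enters `a` is a
sibling parent of `a`, hence the only one, and it is not `b`. -/
theorem sibParent_asymm {a b : V} (hab : R.IsSibParent a b) : ¬ R.IsSibParent b a := by
  intro hba
  obtain ⟨s, hs, hp⟩ := hab.2
  have hsa : s ≠ a := by
    rintro rfl
    exact h.not_isStarter_of_isSibParent hba hs.1
  rcases exists_last_exit (reflTransGen_avoid_symm hp) with rfl | ⟨x, hx, hxa, -, hp'⟩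
  · exact hsa rfl
  · have : R.IsSibParent x a := ⟨hx.1.symm, s, ⟨hs.1, hsa⟩, reflTransGen_avoid_symm
      (ReflTransGen.mono (fun _ _ h => ⟨h.1.1, h.2⟩) _ _ hp')⟩
    exact hx.2.2 (h.sibParent_unique this hba)

/-- The number of vertices separating `b` from the starter. -/
theorem ncard_avoids {a b : V} (hab : R.IsSibParent a b) :
    {x | ¬ R.Avoids x b}.ncard = {x | ¬ R.Avoids x a}.ncard + 1 := by
  have : {x | ¬ R.Avoids x b} = insert b {x | ¬ R.Avoids x a} := by
    ext x
    simp only [Set.mem_ofPred_eq, Set.mem_insert_iff]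
    constructor
    · intro hx
      by_contra hc
      push Not at hc
      exact hx (avoids_step hc.2 hab.1 (Ne.symm hc.1))
    · rintro (rfl | hx)
      · exact not_avoids_self x
      · intro hb
        by_cases hxa : a = x
        · subst hxa
          exact h.sibParent_asymm hab ⟨hab.1.symm, hb⟩
        · exact hx (avoids_step hb hab.1.symm hxa)
  rw [this, Set.ncard_insert_of_notMem (by simpa using hab.2) (Set.toFinite _)]

/-- The two sides of a label crossing `v`. -/
theorem Crosses_iff {v b : V} : R.Crosses v b ↔ ∃ c s t, R.par c b ∧ R.par c s ∧ R.par c t ∧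
    s ≠ t ∧ R.anc s v ∧ s ≠ v ∧ R.SubAdj v t ∧
    ((t = b ∧ R.IsSibParent s b) ∨ (s = b ∧ R.IsSibParent t b)) := by
  constructor
  · rintro ⟨a, hab, ⟨h1, h2, h3⟩ | ⟨h1, h2, h3⟩⟩
    · obtain ⟨hne, ⟨c, hca, hcb⟩, -⟩ := hab.1
      exact ⟨c, a, b, hcb, hca, hcb, hne, h1, h2, h3, Or.inl ⟨rfl, hab⟩⟩
    · obtain ⟨hne, ⟨c, hca, hcb⟩, -⟩ := hab.1
      exact ⟨c, b, a, hcb, hcb, hca, hne.symm, h1, h2, h3, Or.inr ⟨rfl, hab⟩⟩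
  · rintro ⟨c, s, t, -, -, -, -, h1, h2, h3, ⟨rfl, h4⟩ | ⟨rfl, h4⟩⟩
    · exact ⟨s, h4, Or.inl ⟨h1, h2, h3⟩⟩
    · exact ⟨t, h4, Or.inr ⟨h1, h2, h3⟩⟩

/-- The parent of `v` is still below `s`, so its subtree is disjoint from that of the sibling `t`.
-/
theorem out_of_edge {v s t c : V} (hs : R.par c s) (ht : R.par c t) (hst : s ≠ t)
    (hsv : R.anc s v) (hne : s ≠ v) (hv : R.SubAdj v t) : R.Out v := by
  have hT := h.isTree
  obtain ⟨q, hq, hsq⟩ := hsv.exists_parent hne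
  obtain ⟨x, y, hx, hy, hxy⟩ := hv
  exact ⟨q, x, y, hq, hx, fun hqy => hst (hs.eq_of_common hT ht (hsq.trans hT hqy) hy), hxy⟩

theorem out_of_crosses {v b : V} (hv : R.Crosses v b) : R.Out v := by
  obtain ⟨c, s, t, -, hs, ht, hst, hsv, hne, hvt, -⟩ := h.Crosses_iff.1 hv
  exact h.out_of_edge hs ht hst hsv hne hvt

theorem exists_crosses_of_out {v : V} (hv : R.Out v) : ∃ b, R.Crosses v b := by
  have hT := h.isTree
  obtain ⟨q, x, y, hq, hx, hy, hxy⟩ := hv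
  obtain ⟨-, c, a, b, ha, hb, hab, haq, hax, hby⟩ := h.exists_branch_of_out hq hx hy hxy
  have hav : R.anc a v := haq.trans hT hq.2
  have hne : a ≠ v := by
    rintro rfl
    exact hq.not_anc hT haq
  have hK : R.SibAdj a b := ⟨hab, ⟨c, ha, hb⟩, x, y, hax, hby, hxy⟩
  have hS : R.SubAdj v b := ⟨x, y, hx, hby, hxy⟩
  rcases sibParent_or hK with hp | hp
  · exact ⟨b, a, hp, Or.inl ⟨hav, hne, hS⟩⟩
  · exact ⟨a, b, hp, Or.inr ⟨hav, hne, hS⟩⟩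

theorem anc_of_crosses {v b c : V} (hv : R.Crosses v b) (hc : R.par c b) :
    R.anc c v ∧ c ≠ v := by
  have hT := h.isTree
  obtain ⟨c', s, t, hc', hs, ht, hst, hsv, hne, hvt, -⟩ := h.Crosses_iff.1 hv
  obtain rfl := hc.unique hT hc'
  refine ⟨hs.2.trans hT hsv, ?_⟩
  rintro rfl
  exact hs.not_anc hT hsv

theorem exists_par_of_not_isStarter {b : V} (hb : ¬ R.IsStarter b) : ∃ c, R.par c b :=
  exists_isTreeParent h.isTree (by
    rintro rfl
    exact hb h.isStarter_root)

theorem not_isStarter_of_crosses {v b : V} (hv : R.Crosses v b) : ¬ R.IsStarter b := by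
  obtain ⟨a, ha, -⟩ := hv
  exact h.not_isStarter_of_isSibParent ha

/-- `Before` is not assumed to be an order; a minimum is taken of a lexicographic key instead. The
parents of all labels crossing `v` are ancestors of `v`, hence comparable, so their depths decide
which is higher. -/
theorem exists_first {v : V} (hv : R.Out v) : ∃ b, R.First v b := by
  classical
  have hT := h.isTree
  obtain ⟨d, hd, hd'⟩ := AncestorOrEq.exists_depth hT R.root
  choose! f hf using fun b (hb : ¬ R.IsStarter b) => h.exists_par_of_not_isStarter hb
  obtain ⟨b, hb, hmin⟩ := Set.exists_min_image {b | R.Crosses v b}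
    (fun b => toLex (d (f b), toLex ((if R.anc b v then 0 else 1 : ℕ), b))) (Set.toFinite _)
    (h.exists_crosses_of_out hv)
  refine ⟨b, hb, fun b' hb' => ?_⟩
  have hc := hf b (h.not_isStarter_of_crosses hb)
  have hc' := hf b' (h.not_isStarter_of_crosses hb')
  have hcv := (h.anc_of_crosses hb hc).1
  have hcv' := (h.anc_of_crosses hb' hc').1
  have hle := hmin b' hb'
  simp only [Prod.Lex.toLex_le_toLex] at hle
  rcases hle with hlt | ⟨heq, hle⟩
  · refine Or.inr (Or.inl ⟨_, _, hc, hc', ?_, fun h => hlt.ne (by rw [h])⟩)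
    rcases hcv.total hT hcv' with h1 | h1
    · exact h1
    · exact absurd (hd _ _ h1) (not_le.2 hlt)
  · have hcc : f b = f b' := by
      rcases hcv.total hT hcv' with h1 | h1
      · exact hd' _ _ h1 heq
      · exact (hd' _ _ h1 heq.symm).symm
    rw [← hcc] at hc'
    by_cases hbv : R.anc b v
    · exact Or.inr (Or.inr ⟨_, hc, hc', Or.inl hbv⟩)
    · by_cases hbv' : R.anc b' v
      · simp [hbv, hbv'] at hle
      · simp only [hbv, hbv', if_false, lt_irrefl, true_and, false_or] at hle
        rcases hle.lt_or_eq with hlt | heq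
        · exact Or.inr (Or.inr ⟨_, hc, hc', Or.inr ⟨hbv', hlt⟩⟩)
        · exact Or.inl heq.symm

theorem before_asymm {v b b' : V} (hb : R.Before v b b') (hb' : R.Before v b' b) : b = b' := by
  have hT := h.isTree
  rcases hb with ⟨c, c', h1, h2, h3, h4⟩ | ⟨c, h1, h2, h3⟩ <;>
    rcases hb' with ⟨d, d', k1, k2, k3, k4⟩ | ⟨d, k1, k2, k3⟩
  · obtain rfl := h1.unique hT k2
    obtain rfl := h2.unique hT k1
    exact absurd (h3.antisymm hT k3) h4
  · obtain rfl := h1.unique hT k2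
    obtain rfl := h2.unique hT k1
    exact absurd rfl h4
  · obtain rfl := h1.unique hT k2
    obtain rfl := h2.unique hT k1
    exact absurd rfl k4
  · rcases h3 with h3 | ⟨h3, h3'⟩ <;> rcases k3 with k3 | ⟨k3, k3'⟩
    · exact h1.eq_of_common hT h2 h3 k3
    · exact absurd h3 k3
    · exact absurd k3 h3
    · exact absurd h3' k3'.asymm

theorem first_unique {v b b' : V} (hb : R.First v b) (hb' : R.First v b') : b = b' := by
  rcases hb.2 b' hb'.1 with h1 | h1
  · exact h1.symm
  · rcases hb'.2 b hb.1 with h2 | h2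
    · exact h2
    · exact h.before_asymm h1 h2

/-! #### Owners -/

omit h in
theorem owner_iff {v b : V} : R.Owner v b ↔ (v = b ∧ ¬ R.IsStarter b) ∨ R.First v b ∨
    ∃ q, R.par q v ∧ R.IsStarter v ∧ ¬ R.Out v ∧ R.Owner q b := by
  constructor
  · rintro ⟨v₀, h0, hp⟩
    rcases ReflTransGen.cases_tail hp with rfl | ⟨q, hp, hq⟩
    · tauto
    · exact Or.inr (Or.inr ⟨q, hq.1, hq.2.1, hq.2.2, v₀, h0, hp⟩)
  · rintro (h0 | h0 | ⟨q, h1, h2, h3, v₀, h0, hp⟩)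
    · exact ⟨v, Or.inl h0, .refl⟩
    · exact ⟨v, Or.inr h0, .refl⟩
    · exact ⟨v₀, h0, hp.tail ⟨h1, h2, h3⟩⟩

omit h in
theorem owner_self {b : V} (hb : ¬ R.IsStarter b) : R.Owner b b := owner_iff.2 (Or.inl ⟨rfl, hb⟩)

omit h in
theorem First.owner {v b : V} (hb : R.First v b) : R.Owner v b := owner_iff.2 (Or.inr (Or.inl hb))

theorem owner_of_not_isStarter {v b : V} (hv : ¬ R.IsStarter v) : R.Owner v b ↔ v = b := by
  rw [owner_iff]
  constructor
  · rintro (h0 | h0 | ⟨q, -, h1, -⟩)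
    · exact h0.1
    · exact absurd (Or.inl (h.out_of_crosses h0.1)) hv
    · exact absurd h1 hv
  · rintro rfl
    exact Or.inl ⟨rfl, hv⟩

omit h in
theorem owner_of_out {v b : V} (hv : R.Out v) : R.Owner v b ↔ R.First v b := by
  rw [owner_iff]
  constructor
  · rintro (h0 | h0 | ⟨q, -, -, h1, -⟩)
    · exact absurd (Or.inl (h0.1 ▸ hv)) h0.2
    · exact h0
    · exact absurd hv h1
  · exact fun h => Or.inr (Or.inl h)

theorem owner_of_par {q v b : V} (hs : R.IsStarter v) (ho : ¬ R.Out v) (hq : R.par q v) :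
    R.Owner v b ↔ R.Owner q b := by
  rw [owner_iff]
  constructor
  · rintro (h0 | h0 | ⟨q', hq', -, -, h1⟩)
    · exact absurd hs (h0.1 ▸ h0.2)
    · exact absurd (h.out_of_crosses h0.1) ho
    · rwa [hq.unique h.isTree hq']
  · exact fun h => Or.inr (Or.inr ⟨q, hq, hs, ho, h⟩)

theorem not_owner_root (b : V) : ¬ R.Owner R.root b := by
  intro hb
  rcases owner_iff.1 hb with h0 | h0 | ⟨q, hq, -⟩
  · exact h0.2 (h0.1 ▸ h.isStarter_root)
  · exact h.ne_root_of_out (h.out_of_crosses h0.1) rfl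
  · exact not_isTreeParent_root h.isTree hq

theorem owner_unique {v b b' : V} (hb : R.Owner v b) (hb' : R.Owner v b') : b = b' := by
  revert hb hb'
  refine IsTree.topDown_induction (r := R.root) h.isTree
    (p := fun v => R.Owner v b → R.Owner v b' → b = b') ?_ ?_ v
  · exact fun hb => absurd hb (h.not_owner_root b)
  · intro q v hq ih hb hb'
    by_cases hs : R.IsStarter v
    · by_cases ho : R.Out v
      · exact h.first_unique ((owner_of_out ho).1 hb) ((owner_of_out ho).1 hb')
      · exact ih ((h.owner_of_par hs ho hq).1 hb) ((h.owner_of_par hs ho hq).1 hb')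
    · exact ((h.owner_of_not_isStarter hs).1 hb).symm.trans ((h.owner_of_not_isStarter hs).1 hb')

theorem owner_anc {v b c : V} (hb : R.Owner v b) (hc : R.par c b) : R.anc c v ∧ c ≠ v := by
  have hT := h.isTree
  revert hb
  refine IsTree.topDown_induction (r := R.root) hT
    (p := fun v => R.Owner v b → R.anc c v ∧ c ≠ v) ?_ ?_ v
  · exact fun hb => absurd hb (h.not_owner_root b)
  · intro q v hq ih hb
    rcases owner_iff.1 hb with h0 | h0 | ⟨q', hq', -, -, h1⟩
    · exact h0.1 ▸ ⟨hc.2, hc.ne⟩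
    · exact h.anc_of_crosses h0.1 hc
    · obtain rfl := hq.unique hT hq'
      refine ⟨(ih h1).1.trans hT hq.2, ?_⟩
      rintro rfl
      exact hq.not_anc hT (ih h1).1

theorem not_isStarter_of_owner {v b : V} (hb : R.Owner v b) : ¬ R.IsStarter b := by
  obtain ⟨v₀, h0 | h0, -⟩ := hb
  · exact h0.2
  · exact h.not_isStarter_of_crosses h0.1

/-- A competing label could win only by branching strictly above the parent of `b`. Its edge from
below `v` would then leave the subtree of that parent, so `Out b` would hold and `b` would be a
starter. -/
theorem first_of_anc {v b : V} (hv : R.Crosses v b) (hbv : R.anc b v) : R.First v b := by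
  have hT := h.isTree
  refine ⟨hv, fun b' hb' => ?_⟩
  have hbs := h.not_isStarter_of_crosses hv
  obtain ⟨c, hc⟩ := h.exists_par_of_not_isStarter hbs
  obtain ⟨c', s, t, hc', hs, ht, hst, hsv, hne, hvt, -⟩ := h.Crosses_iff.1 hb'
  have hcv := (h.anc_of_crosses hv hc).1
  by_cases hcc : c = c'
  · subst hcc
    exact Or.inr (Or.inr ⟨c, hc, hc', Or.inl hbv⟩)
  · rcases hcv.total hT (hs.2.trans hT hsv) with h1 | h1
    · exact Or.inr (Or.inl ⟨c, c', hc, hc', h1, hcc⟩)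
    · exfalso
      refine hbs (Or.inl (h.out_of_edge (v := b) hs ht hst ?_ ?_ (h.SubAdj_mono hbv hvt)))
      · rcases hsv.total hT hbv with h2 | h2
        · exact h2
        · by_cases hsb : b = s
          · subst hsb
            exact absurd (hc.unique hT hs) hcc
          · exact absurd ((hc.2.trans hT (hs.anc_of_ne hT h2 hsb)).antisymm hT h1) hcc
      · rintro rfl
        exact hcc (hc.unique hT hs)

/-- Right trees are closed under parents down from `b`: a label crossing `v` from below `b` also
crosses the parent of `v`, and wins there by `first_of_anc`. -/
theorem owner_parent_right {v b q : V} (hv : R.Owner v b) (hbv : R.anc b v) (hne : v ≠ b)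
    (hq : R.par q v) : R.Owner q b := by
  have hT := h.isTree
  have hbs := h.not_isStarter_of_owner hv
  have hbq := hq.anc_of_ne hT hbv hne.symm
  by_cases hqb : q = b
  · subst hqb
    exact owner_self hbs
  rcases owner_iff.1 hv with h0 | h0 | ⟨q', hq', -, -, h1⟩
  · exact absurd h0.1 hne
  · obtain ⟨a, ha, ⟨k1, k2, k3⟩ | ⟨k1, k2, k3⟩⟩ := h0.1
    · obtain ⟨hne, ⟨c, hca, hcb⟩, -⟩ := ha.1
      exact absurd (hca.eq_of_common hT hcb k1 hbv) hne
    · exact First.owner (h.first_of_anc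
        ⟨a, ha, Or.inr ⟨hbq, Ne.symm hqb, h.SubAdj_mono hq.2 k3⟩⟩ hbq)
  · rwa [hq.unique hT hq']

end Valid

end RootedGraph

/-! ### Left roots, connectedness of left trees, and the order of attachment. -/

namespace RootedGraph

open Relation

variable {V : Type*} [LinearOrder V] [Finite V] {R : RootedGraph V}

namespace Valid

variable (h : R.Valid)

include h

/-- A label preceding `b` at a vertex below `a` either branches strictly above `c`, or belongs to
another sibling edge at `a` itself, since `a` is the only child of `c` above `u`. -/
theorem crosses_before_cases {a b b' c u : V} (hca : R.par c a) (hcb : R.par c b)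
    (hau : R.anc a u) (hX : R.Crosses u b') (hB : R.Before u b' b) :
    (∃ c' s t, R.par c' b' ∧ R.par c' s ∧ R.par c' t ∧ s ≠ t ∧ R.anc s c ∧ R.SubAdj u t ∧
      R.anc c' c ∧ c' ≠ c ∧ ((t = b' ∧ R.IsSibParent s b') ∨ (s = b' ∧ R.IsSibParent t b'))) ∨
    (R.par c b' ∧ ∃ t, R.par c t ∧ a ≠ t ∧ R.SubAdj u t ∧
      ((t = b' ∧ R.IsSibParent a b') ∨ (a = b' ∧ R.IsSibParent t b')) ∧
      (R.anc b' u ∨ (¬ R.anc b u ∧ b' < b))) := by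
  have hT := h.isTree
  obtain ⟨c', s, t, hc', hs, ht, hst, hsu, hsne, hut, hside⟩ := h.Crosses_iff.1 hX
  rcases hB with ⟨d, d', h1, h2, h3, h4⟩ | ⟨d, h1, h2, h3⟩
  · obtain rfl := h1.unique hT hc'
    obtain rfl := h2.unique hT hcb
    refine Or.inl ⟨d, s, t, hc', hs, ht, hst, ?_, hut, h3, h4, hside⟩
    rcases hsu.total hT (hca.2.trans hT hau) with h5 | h5
    · exact h5
    · by_cases hds : d' = s
      · exact hds ▸ .refl hT _
      · exact absurd (h3.antisymm hT (hs.anc_of_ne hT h5 hds)) h4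
  · obtain rfl := h1.unique hT hc'
    obtain rfl := h2.unique hT hcb
    obtain rfl := hs.eq_of_common hT hca hsu hau
    exact Or.inr ⟨hc', t, ht, hst, hut, hside, h3⟩

/-- Labels with priority have an edge leaving both subtrees. -/
theorem exists_edge_outside {a b b' c u : V} (hab : R.IsSibParent a b) (hca : R.par c a)
    (hcb : R.par c b) (hau : R.anc a u) (hX : R.Crosses u b') (hne : b' ≠ b)
    (hB : R.Before u b' b) :
    ∃ x y, R.anc u x ∧ ¬ R.anc a y ∧ ¬ R.anc b y ∧ R.graph.Adj x y := by
  have hT := h.isTree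
  rcases h.crosses_before_cases hca hcb hau hX hB with
    ⟨c', s, t, -, hs, ht, hst, hsc, ⟨x, y, hx, hy, hxy⟩, -⟩ |
    ⟨-, t, ht, hat, ⟨x, y, hx, hy, hxy⟩, hside, -⟩
  · have : ¬ R.anc c y := fun hcy => hst (hs.eq_of_common hT ht (hsc.trans hT hcy) hy)
    exact ⟨x, y, hx, fun h => this (hca.2.trans hT h), fun h => this (hcb.2.trans hT h), hxy⟩
  · refine ⟨x, y, hx, fun hay => hat (hca.eq_of_common hT ht hay hy), fun hby => ?_, hxy⟩
    obtain rfl := hcb.eq_of_common hT ht hby hy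
    rcases hside with ⟨rfl, -⟩ | ⟨rfl, h1⟩
    · exact hne rfl
    · exact h.sibParent_asymm hab h1

theorem crosses_of_isSibParent {a b u : V} (hab : R.IsSibParent a b) (hau : R.anc a u)
    (hne : a ≠ u) (hub : R.SubAdj u b) : R.Crosses u b := ⟨a, hab, Or.inl ⟨hau, hne, hub⟩⟩

/-- A label that is not first is preceded by another one. -/
theorem exists_first_before {u b : V} (hX : R.Crosses u b) (hn : ¬ R.First u b) :
    ∃ b', R.First u b' ∧ b' ≠ b ∧ R.Before u b' b := by
  obtain ⟨b', hb'⟩ := h.exists_first (h.out_of_crosses hX)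
  have hne : b' ≠ b := by
    rintro rfl
    exact hn hb'
  exact ⟨b', hb', hne, (hb'.2 b hX).resolve_left hne.symm⟩

/-- A candidate strictly below `a` was lost to another label, which provides an edge from below `u`
to outside both subtrees. By `anc_of_subAdj_sibling` no edge of the label `b` can then start
elsewhere in the subtree of `a`. -/
theorem leftCand_anc {a b u x y : V} (hab : R.IsSibParent a b) (hu : R.LeftCand b u)
    (hx : R.anc a x) (hy : R.anc b y) (hxy : R.graph.Adj x y) : R.anc u x := by
  rcases hu with hu | ⟨a', ha', hau, hne, hub, hn⟩
  · rwa [h.sibParent_unique hu hab]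
  · obtain rfl := h.sibParent_unique ha' hab
    obtain ⟨hne', ⟨c, hca, hcb⟩, -⟩ := hab.1
    obtain ⟨b', hb', hbb, hB⟩ := h.exists_first_before (h.crosses_of_isSibParent hab hau hne hub) hn
    obtain ⟨x', y', hx', hya, hyb, hxy'⟩ := h.exists_edge_outside hab hca hcb hau hb'.1 hbb hB
    exact h.anc_of_subAdj_sibling hca hcb hne' hau hne hub hx' hya hyb hxy' hx hy hxy

theorem anc_of_leftCand {a b u : V} (hab : R.IsSibParent a b) (hu : R.LeftCand b u) :
    R.anc a u := by
  rcases hu with hu | ⟨a', ha', hau, -⟩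
  · exact h.sibParent_unique hu hab ▸ .refl h.isTree _
  · rwa [h.sibParent_unique hab ha']

/-- All candidates are ancestors of the end `x` of one edge of the label, so they form a chain, and
the deepest one is the left root. -/
theorem exists_isLeftRoot {b : V} (hb : ¬ R.IsStarter b) : ∃ u, R.IsLeftRoot b u := by
  have hT := h.isTree
  obtain ⟨a, hab⟩ := exists_sibParent hb
  obtain ⟨d, hd, hd'⟩ := AncestorOrEq.exists_depth hT R.root
  obtain ⟨u, hu, hmax⟩ := Set.exists_max_image {u | R.LeftCand b u} d (Set.toFinite _)
    ⟨a, Or.inl hab⟩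
  refine ⟨u, hu, fun v hv => ?_⟩
  obtain ⟨-, -, x, y, hx, hy, hxy⟩ := hab.1
  rcases (h.leftCand_anc hab hv hx hy hxy).total hT (h.leftCand_anc hab hu hx hy hxy) with h1 | h1
  · exact h1
  · rw [hd' _ _ h1 (le_antisymm (hd _ _ h1) (hmax v hv))]
    exact .refl hT v

theorem leftRoot_unique {b u u' : V} (hu : R.IsLeftRoot b u) (hu' : R.IsLeftRoot b u') : u = u' :=
  (hu'.2 u hu.1).antisymm h.isTree (hu.2 u' hu'.1)

theorem not_isStarter_of_leftRoot {b u : V} (hu : R.IsLeftRoot b u) : ¬ R.IsStarter b := by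
  rcases hu.1 with hu | ⟨a, ha, -⟩
  · exact h.not_isStarter_of_isSibParent hu
  · exact h.not_isStarter_of_isSibParent ha

theorem not_anc_of_leftRoot {b u : V} (hu : R.IsLeftRoot b u) : ¬ R.anc b u := by
  intro hbu
  obtain ⟨a, hab⟩ := exists_sibParent (h.not_isStarter_of_leftRoot hu)
  obtain ⟨hne, ⟨c, hca, hcb⟩, -⟩ := id hab.1
  exact hne (hca.eq_of_common h.isTree hcb (h.anc_of_leftCand hab hu.1) hbu)

theorem leftRoot_not_anc {b u : V} (hu : R.IsLeftRoot b u) : ¬ R.anc u b := by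
  intro hub
  obtain ⟨a, hab⟩ := exists_sibParent (h.not_isStarter_of_leftRoot hu)
  obtain ⟨hne, ⟨c, hca, hcb⟩, -⟩ := id hab.1
  exact hne (hca.eq_of_anc h.isTree hcb ((h.anc_of_leftCand hab hu.1).trans h.isTree hub))

/-- If the left root were at or below `v`, the label preceding `b` there would also cross `v`, as
adjacency of subtrees passes to ancestors. It would still precede `b` at `v`, contradicting that `b`
is first there. -/
theorem leftRoot_anc_of_first {v b u a : V} (hv : R.First v b) (hab : R.IsSibParent a b)
    (hav : R.anc a v) (hane : a ≠ v) (hvb : R.SubAdj v b) (hu : R.IsLeftRoot b u) :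
    R.anc u v ∧ u ≠ v := by
  have hT := h.isTree
  obtain ⟨hne', ⟨c, hca, hcb⟩, -⟩ := id hab.1
  have key : ¬ R.anc v u := by
    intro hvu
    have hau : R.anc a u := hav.trans hT hvu
    have hua : a ≠ u := by
      rintro rfl
      exact hane (hav.antisymm hT hvu)
    have hZ := hu.1
    rcases hZ with hZ | ⟨a', ha', -, -, hub, hn⟩
    · exact hua (h.sibParent_unique hab hZ)
    · obtain ⟨b', hb', hbb, hB⟩ :=
        h.exists_first_before (h.crosses_of_isSibParent hab hau hua hub) hn
      have hnbv : ¬ R.anc b v := fun hbv => hne' (hca.eq_of_common hT hcb hav hbv)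
      rcases h.crosses_before_cases hca hcb hau hb'.1 hB with
        ⟨c', s, t, hcb', hs, ht, hst, hsc, hut, hcc, hccne, hside⟩ |
        ⟨hcb', t, ht, hat, hut, hside, hlt⟩
      · have hX : R.Crosses v b' := h.Crosses_iff.2 ⟨c', s, t, hcb', hs, ht, hst,
          hsc.trans hT (hca.2.trans hT hav), by
            rintro rfl
            exact hca.not_anc hT (hav.trans hT hsc), h.SubAdj_mono hvu hut, hside⟩
        rcases hv.2 b' hX with h1 | ⟨d, d', k1, k2, k3, k4⟩ | ⟨d, k1, k2, k3⟩
        · exact hbb h1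
        · obtain rfl := k1.unique hT hcb
          obtain rfl := k2.unique hT hcb'
          exact hccne (hcc.antisymm hT k3)
        · exact hccne (hcb'.unique hT (k1.unique hT hcb ▸ k2))
      · have hX : R.Crosses v b' := h.Crosses_iff.2 ⟨c, a, t, hcb', hca, ht, hat, hav, hane,
          h.SubAdj_mono hvu hut, hside⟩
        rcases hv.2 b' hX with h1 | ⟨d, d', k1, k2, k3, k4⟩ | ⟨d, k1, k2, k3⟩
        · exact hbb h1
        · exact k4 ((k1.unique hT hcb).trans (k2.unique hT hcb').symm)
        · rcases k3 with k3 | ⟨k3, k3'⟩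
          · exact hnbv k3
          · rcases hlt with hlt | ⟨-, hlt⟩
            · obtain rfl := hcb'.eq_of_common hT hca hlt hau
              exact k3 hav
            · exact lt_asymm hlt k3'
  obtain ⟨x, y, hx, hy, hxy⟩ := hvb
  have hux := h.leftCand_anc hab hu.1 (hav.trans hT hx) hy hxy
  rcases hux.total hT hx with h1 | h1
  · refine ⟨h1, ?_⟩
    rintro rfl
    exact key (.refl hT _)
  · exact absurd h1 key

/-- A parent strictly below the left root still has edges of the label below it. If `b` were not
first there, the parent would be a deeper candidate than the left root. -/
theorem owner_parent_left {v b q u : V} (hv : R.Owner v b) (hbv : ¬ R.anc b v)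
    (hu : R.IsLeftRoot b u) (hq : R.par q v) : R.Owner q b ∨ q = u := by
  have hT := h.isTree
  rcases owner_iff.1 hv with h0 | h0 | ⟨q', hq', -, -, h1⟩
  · exact absurd (h0.1 ▸ .refl hT _) hbv
  · obtain ⟨a, ha, ⟨k1, k2, k3⟩ | ⟨k1, k2, k3⟩⟩ := h0.1
    · obtain ⟨huv, hune⟩ := h.leftRoot_anc_of_first h0 ha k1 k2 k3 hu
      have huq := hq.anc_of_ne hT huv hune
      by_cases hqu : q = u
      · exact Or.inr hqu
      · left
        have haq := (h.anc_of_leftCand ha hu.1).trans hT huq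
        have hne : a ≠ q := by
          rintro rfl
          exact hqu ((h.anc_of_leftCand ha hu.1).antisymm hT huq)
        have hqb := h.SubAdj_mono hq.2 k3
        by_contra hn
        refine hqu ((hu.2 q (Or.inr ⟨a, ha, haq, hne, hqb, fun hf => hn ?_⟩)).antisymm hT huq)
        exact First.owner hf
    · exact absurd k1 hbv
  · exact Or.inl (hq.unique hT hq' ▸ h1)

theorem leftRoot_anc {v b u : V} (hv : R.Owner v b) (hbv : ¬ R.anc b v)
    (hu : R.IsLeftRoot b u) : R.anc u v := by
  have hT := h.isTree
  revert hv hbv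
  refine IsTree.topDown_induction (r := R.root) hT
    (p := fun v => R.Owner v b → ¬ R.anc b v → R.anc u v) ?_ ?_ v
  · exact fun hb => absurd hb (h.not_owner_root b)
  · intro q v hq ih hv hbv
    rcases h.owner_parent_left hv hbv hu hq with h1 | rfl
    · exact (ih h1 fun h => hbv (h.trans hT hq.2)).trans hT hq.2
    · exact hq.2

/-- Ownership would pass to the parent of `u` by `owner_parent_left`, although left vertices owned
by `b` lie below `u`. -/
theorem not_owner_leftRoot {b u : V} (hu : R.IsLeftRoot b u) : ¬ R.Owner u b := by
  intro ho
  have hT := h.isTree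
  have hur : u ≠ R.root := by
    rintro rfl
    exact h.not_owner_root b ho
  obtain ⟨q, hq⟩ := exists_isTreeParent hT hur
  have hbu := h.not_anc_of_leftRoot hu
  rcases h.owner_parent_left ho hbu hu hq with h1 | h1
  · exact hq.not_anc hT (h.leftRoot_anc h1 (fun h => hbu (h.trans hT hq.2)) hu)
  · exact hq.ne h1

theorem owner_parent {v b q u : V} (hv : R.Owner v b) (hne : v ≠ b) (hu : R.IsLeftRoot b u)
    (hq : R.par q v) : R.Owner q b ∨ q = u := by
  by_cases hbv : R.anc b v
  · exact Or.inl (h.owner_parent_right hv hbv hne hq)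
  · exact h.owner_parent_left hv hbv hu hq

/-- The ends of the edges of a label belong to its hammock. -/
theorem owner_of_adj {a b x y u : V} (hab : R.IsSibParent a b) (hx : R.anc a x) (hy : R.anc b y)
    (hxy : R.graph.Adj x y) (hu : R.IsLeftRoot b u) : (x = u ∨ R.Owner x b) ∧ R.Owner y b := by
  have hT := h.isTree
  constructor
  · by_cases hxu : x = u
    · exact Or.inl hxu
    · right
      have hux := h.leftCand_anc hab hu.1 hx hy hxy
      have hax : a ≠ x := by
        rintro rfl
        exact hxu ((h.anc_of_leftCand hab hu.1).antisymm hT hux)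
      have hxb : R.SubAdj x b := ⟨x, y, .refl hT x, hy, hxy⟩
      by_contra hn
      exact hxu ((hu.2 x (Or.inr ⟨a, hab, hx, hax, hxb, fun hf => hn (First.owner hf)⟩)).antisymm
        hT hux)
  · by_cases hyb : b = y
    · subst hyb
      exact owner_self (h.not_isStarter_of_isSibParent hab)
    · exact First.owner (h.first_of_anc
        ⟨a, hab, Or.inr ⟨hy, hyb, ⟨y, x, .refl hT y, hx, hxy.symm⟩⟩⟩ hy)

theorem isSibParent_of_base {b u : V} (hu : R.IsLeftRoot b u) (hb : ∀ i, ¬ R.Owner u i) :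
    R.IsSibParent u b := by
  rcases hu.1 with hu | ⟨a, ha, hau, hne, hub, -⟩
  · exact hu
  · obtain ⟨i, hi⟩ :=
      h.exists_first (h.out_of_crosses (h.crosses_of_isSibParent ha hau hne hub))
    exact absurd (First.owner hi) (hb i)

/-- An unowned vertex is a starter without outgoing edges, so it has the same owners as its parent.
Hence the base tree is closed upwards. -/
theorem base_par {v q : V} (hv : ∀ i, ¬ R.Owner v i) (hq : R.par q v) : ∀ i, ¬ R.Owner q i := by
  intro i hi
  by_cases hs : R.IsStarter v
  · by_cases ho : R.Out v
    · obtain ⟨j, hj⟩ := h.exists_first ho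
      exact hv j (First.owner hj)
    · exact hv i ((h.owner_of_par hs ho hq).2 hi)
  · exact hv v (owner_self hs)

/-- Priority depends on the vertex only through which labels lie above it. Since `b` branches
strictly above `c`, it lies above `u` only if it lies above `a`. -/
theorem before_transfer {a c b b' c₁ u : V} (hca : R.par c a) (hau : R.anc a u)
    (hb : R.par c₁ b) (hc : R.anc c₁ c) (hcne : c₁ ≠ c) (hB : R.Before u b b') :
    R.Before a b b' := by
  have hT := h.isTree
  rcases hB with hB | ⟨d, h1, h2, h3⟩
  · exact Or.inl hB
  · obtain rfl := h1.unique hT hb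
    refine Or.inr ⟨d, h1, h2, ?_⟩
    rcases h3 with h3 | ⟨h3, h4⟩
    · left
      rcases h3.total hT hau with h5 | h5
      · exact h5
      · by_cases hab : a = b
        · exact hab ▸ .refl hT _
        · exact absurd (hc.antisymm hT (hca.2.trans hT (h1.anc_of_ne hT h5 hab))) hcne
    · exact Or.inr ⟨fun h => h3 (h.trans hT hau), h4⟩

/-- The position of the least common ancestor of the roots of the hammock `b` relative to the
hammock `i` containing its left root. -/
theorem lca_mem {b u c i w : V} (hu : R.IsLeftRoot b u) (hcb : R.par c b) (hi : R.Owner u i)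
    (hw : R.IsLeftRoot i w) : (R.Owner c i ∨ c = w) ∨ R.par c i := by
  have hT := h.isTree
  obtain ⟨a, hab⟩ := exists_sibParent (h.not_isStarter_of_leftRoot hu)
  obtain ⟨hne', ⟨c', hca, hcb'⟩, -⟩ := id hab.1
  obtain rfl := hcb.unique hT hcb'
  have keya : R.Owner a i → (R.Owner c i ∨ c = w) ∨ R.par c i := by
    intro hai
    by_cases hia : a = i
    · exact Or.inr (hia ▸ hca)
    · exact Or.inl (h.owner_parent hai hia hw hca)
  rcases id hu.1 with hZ | ⟨a', ha', hau, hune, hub, hn⟩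
  · exact keya (h.sibParent_unique hab hZ ▸ hi)
  · obtain rfl := h.sibParent_unique hab ha'
    have hX := h.crosses_of_isSibParent hab hau hune hub
    obtain ⟨b', hb', hbb, hB⟩ := h.exists_first_before hX hn
    obtain rfl := h.owner_unique hi (First.owner hb')
    rcases h.crosses_before_cases hca hcb hau hb'.1 hB with
      ⟨c', s, t, hci, hs, ht, hst, hsc, hut, hcc, hccne, hside⟩ | ⟨hci, -⟩
    · refine keya (First.owner ⟨?_, fun b' hb'' => ?_⟩)
      · refine h.Crosses_iff.2 ⟨c', s, t, hci, hs, ht, hst, hsc.trans hT hca.2, ?_,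
          h.SubAdj_mono hau hut, hside⟩
        rintro rfl
        exact hca.not_anc hT hsc
      -- Any label crossing `a` has an edge leaving the subtree of `c`. By `anc_of_subAdj_outside`
      -- this edge starts below `u`, so the label also crosses `u`, and the winner at `u` wins at
      -- `a`.
      · obtain ⟨d, s', t', hd, hs', ht', hst', hsa, hsne, hat', hside'⟩ := h.Crosses_iff.1 hb''
        obtain ⟨x', y', hx', hy', hxy'⟩ := hat'
        have hsc' := hca.anc_of_ne hT hsa hsne
        have hcy' : ¬ R.anc c y' := fun hc =>
          hst' (hs'.eq_of_common hT ht' (hsc'.trans hT hc) hy')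
        obtain ⟨x, y, hx, hy, hxy⟩ := hut
        have hcy : ¬ R.anc c y := fun hc => hst (hs.eq_of_common hT ht (hsc.trans hT hc) hy)
        have hux' := h.anc_of_subAdj_outside hca hcb hne' hau hune hub hx hcy hxy hx' hcy' hxy'
        have hX' : R.Crosses u b' := h.Crosses_iff.2 ⟨d, s', t', hd, hs', ht', hst',
          hsa.trans hT hau, by
            rintro rfl
            exact hca.not_anc hT (hau.trans hT hsc'), ⟨x', y', hux', hy', hxy'⟩, hside'⟩
        exact (hb'.2 _ hX').imp_right (h.before_transfer hca hau hci hcc hccne)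
    · exact Or.inr hci

/-- The order in which hammocks are attached. -/
theorem exists_rank : ∃ rank : V → ℕ ×ₗ ℕ ×ₗ V, ∀ b u i, R.IsLeftRoot b u → R.Owner u i →
    rank i < rank b := by
  have hT := h.isTree
  obtain ⟨d, hd, hd'⟩ := AncestorOrEq.exists_depth hT R.root
  choose! f hf using fun b (hb : ¬ R.IsStarter b) => h.exists_par_of_not_isStarter hb
  have hlt : ∀ x y, R.anc x y → x ≠ y → d x < d y := fun x y hxy hne =>
    lt_of_le_of_ne (hd _ _ hxy) fun he => hne (hd' _ _ hxy he)
  -- Depth of the branching vertex, then depth in the sibling forest, then the label itself. The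
  -- last entry is needed when two sibling children of the same `a` compete for a vertex below `a`.
  refine ⟨fun b => toLex (d (f b), toLex ({x | ¬ R.Avoids x b}.ncard, b)), fun b u i hu hi => ?_⟩
  have hbs := h.not_isStarter_of_leftRoot hu
  have hcb := hf b hbs
  have hci := hf i (h.not_isStarter_of_owner hi)
  set c := f b with hc
  set c' := f i with hc'
  simp only [Prod.Lex.toLex_lt_toLex]
  obtain ⟨a, hab⟩ := exists_sibParent hbs
  obtain ⟨hne', ⟨c'', hca, hcb'⟩, -⟩ := id hab.1
  obtain rfl := hcb.unique hT hcb'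
  have hcard := h.ncard_avoids hab
  rcases id hu.1 with hZ | ⟨a', ha', hau, hune, hub, hn⟩
  · obtain rfl := h.sibParent_unique hab hZ
    rcases owner_iff.1 hi with h0 | h0 | ⟨q, hq, -, -, h1⟩
    · obtain rfl := h0.1
      exact Or.inr ⟨congrArg d (hci.unique hT hca), Or.inl (by omega)⟩
    · left
      obtain ⟨e, s, t, he, hs, ht, hst, hsa, hsne, -⟩ := h.Crosses_iff.1 h0.1
      rw [he.unique hT hci] at hs
      have hsc := hca.anc_of_ne hT hsa hsne
      refine hlt _ _ (hs.2.trans hT hsc) ?_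
      intro (hh : c' = c)
      rw [← hh] at hsc
      exact hs.not_anc hT hsc
    · left
      obtain rfl := hq.unique hT hca
      obtain ⟨k1, k2⟩ := h.owner_anc h1 hci
      exact hlt _ _ k1 k2
  · obtain rfl := h.sibParent_unique hab ha'
    obtain ⟨b', hb', hbb, hB⟩ :=
      h.exists_first_before (h.crosses_of_isSibParent hab hau hune hub) hn
    obtain rfl := h.owner_unique hi (First.owner hb')
    rcases h.crosses_before_cases hca hcb hau hb'.1 hB with
      ⟨e, s, t, he, -, -, -, -, -, hcc, hccne, -⟩ | ⟨he, t, ht, hat, -, hside, hlt'⟩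
    · obtain rfl := he.unique hT hci
      exact Or.inl (hlt _ _ hcc hccne)
    · refine Or.inr ⟨congrArg d (hci.unique hT he), ?_⟩
      rcases hside with ⟨rfl, hP⟩ | ⟨rfl, hP⟩
      · have := h.ncard_avoids hP
        refine Or.inr ⟨by omega, ?_⟩
        rcases hlt' with hlt' | ⟨-, hlt'⟩
        · exact absurd (hca.eq_of_common hT he hau hlt') hat
        · exact hlt'
      · exact Or.inl (by omega)

end Valid

end RootedGraph

/-! ### Forests of hammocks from successive attachment -/

section Attach

open Relation

variable {V ι : Type*} {G : SimpleGraph V}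

theorem famUnion_adj {H : ι → G.Subgraph} {s : Set ι} {x y : V} :
    (famUnion H s).Adj x y ↔ ∃ i ∈ s, (H i).Adj x y := by
  simp [famUnion]

theorem famUnion_verts {H : ι → G.Subgraph} {s : Set ι} {x : V} :
    x ∈ (famUnion H s).verts ↔ ∃ i ∈ s, x ∈ (H i).verts := by
  simp [famUnion]

theorem SimpleGraph.Subgraph.coe_reachable_iff {F : G.Subgraph} {x y : V} (hx : x ∈ F.verts)
    (hy : y ∈ F.verts) : F.coe.Reachable ⟨x, hx⟩ ⟨y, hy⟩ ↔ F.spanningCoe.Reachable x y := by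
  constructor
  · intro h
    exact h.map (⟨fun v => v, fun h => h⟩ : F.coe →g F.spanningCoe)
  · rintro ⟨p⟩
    induction p with
    | nil => exact .refl _
    | @cons a b c h p ih =>
      have hb : b ∈ F.verts := (show F.Adj a b from h).snd_mem
      have hab : F.coe.Adj ⟨a, hx⟩ ⟨b, hb⟩ := h
      exact hab.reachable.trans (ih hb hy)

/-- In a path that meets `z` at most at its end, along which `N` can only be entered and left
through `z`, either all other vertices or no vertices are in `N`. -/
theorem SimpleGraph.Walk.IsPath.all_or_none {F : SimpleGraph V} {N : Set V} {z x y : V}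
    (p : F.Walk x y) (hp : p.IsPath) (hz : z ∈ p.support → z = y) (hzN : z ∉ N)
    (h : ∀ a b, s(a, b) ∈ p.edges → a ∈ N → b ∈ N ∨ b = z) :
    (∀ v ∈ p.support, v ≠ z → v ∈ N) ∨ ∀ v ∈ p.support, v ∉ N := by
  induction p with
  | nil =>
    rename_i a
    by_cases ha : a ∈ N
    · left
      simpa using fun _ => ha
    · right
      simpa using ha
  | @cons a b y hab p ih =>
    rw [SimpleGraph.Walk.cons_isPath_iff] at hp
    have haz : a ≠ z := by
      rintro rfl
      have := hz (by simp)
      subst this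
      exact hp.2 p.end_mem_support
    have hbz : b = z → p.support = [b] := by
      rintro rfl
      have := hz (by simp)
      subst this
      exact SimpleGraph.Walk.nil_iff_support_eq.1 (SimpleGraph.Walk.isPath_iff_nil.1 hp.1)
    have h1 := h a b (by simp)
    have h2 := h b a (by simp [Sym2.eq_swap])
    by_cases hb : b = z
    · by_cases ha : a ∈ N
      · left
        simp [hbz hb, ha, hb]
      · right
        simp [hbz hb, ha, hb, hzN]
    · rcases ih hp.1 (fun h => hz (by simp [h])) (fun a b hab => h a b (by simp [hab])) with ih | ih
      · left
        have hbN := ih b p.start_mem_support hb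
        have := h2 hbN
        simp only [SimpleGraph.Walk.support_cons, List.mem_cons]
        rintro v (rfl | hv) hvz
        · tauto
        · exact ih v hv hvz
      · right
        have hbN := ih b p.start_mem_support
        simp only [SimpleGraph.Walk.support_cons, List.mem_cons]
        rintro v (rfl | hv)
        · tauto
        · exact ih v hv

theorem SimpleGraph.Walk.exists_first_hit {F : SimpleGraph V} {S : Set V} {x y : V}
    (p : F.Walk x y) (hy : y ∈ S) :
    ∃ y' ∈ S, ∃ q : F.Walk x y', q.IsPath ∧ ∀ v ∈ q.support, v ∈ S → v = y' := by
  classical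
  suffices ∃ y' ∈ S, ∃ q : F.Walk x y', ∀ v ∈ q.support, v ∈ S → v = y' by
    obtain ⟨y', hy', q, hq⟩ := this
    exact ⟨y', hy', q.bypass, q.bypass_isPath, fun v hv => hq v (q.support_bypass_subset_support hv)⟩
  induction p with
  | nil => exact ⟨_, hy, .nil, by simp⟩
  | @cons a b y hab p ih =>
    by_cases ha : a ∈ S
    · exact ⟨a, ha, .nil, by simp⟩
    · obtain ⟨y', hy', q, hq⟩ := ih hy
      refine ⟨y', hy', .cons hab q, ?_⟩
      simp only [SimpleGraph.Walk.support_cons, List.mem_cons]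
      rintro v (rfl | hv) hvS
      · exact absurd hvS ha
      · exact hq v hv hvS

variable {α : Type*} [LinearOrder α]

/-- The connected subgraphs `H i` have the disjoint sets `N i` of own vertices and one further
vertex `u i`, at which they are attached to a subgraph of smaller rank or to the outside. -/
structure IsAttached (H : ι → G.Subgraph) (N : ι → Set V) (u : ι → V) (roots : Set ι)
    (rank : ι → α) : Prop where
  verts : ∀ i, (H i).verts = insert (u i) (N i)
  not_mem : ∀ i, u i ∉ N i
  disj : ∀ i j x, x ∈ N i → x ∈ N j → i = j
  conn : ∀ i, (H i).Connected
  rank_lt : ∀ i j, u j ∈ N i → rank i < rank j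
  root_not_mem : ∀ k ∈ roots, ∀ i, u k ∉ N i
  root_exists : ∀ j, (∀ i, u j ∉ N i) → ∃ k ∈ roots, u k = u j
  root_unique : ∀ k ∈ roots, ∀ k' ∈ roots, u k = u k' → k = k'

namespace IsAttached

variable {H : ι → G.Subgraph} {N : ι → Set V} {u : ι → V} {roots : Set ι} {rank : ι → α}
  (h : IsAttached H N u roots rank)

include h

/-- Own sets are disjoint, so a common vertex is the attachment vertex of one of the two subgraphs.
Two common vertices would force each subgraph to be attached at an own vertex of the other, against
the rank. -/
theorem edge_unique {i j : ι} {x y : V} (hi : (H i).Adj x y) (hj : (H j).Adj x y) : i = j := by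
  have hxi := hi.fst_mem
  have hyi := hi.snd_mem
  have hxj := hj.fst_mem
  have hyj := hj.snd_mem
  have hne := hi.ne
  rw [h.verts] at hxi hyi hxj hyj
  have d1 := h.disj i j x
  have d2 := h.disj i j y
  have r1 := h.rank_lt i j
  have r2 := h.rank_lt j i
  by_contra hij
  rcases hxi with rfl | hxi <;> rcases hyi with rfl | hyi
  · exact hne rfl
  · rcases hyj with rfl | hyj
    · rcases hxj with hxj | hxj
      · exact hne hxj
      · exact lt_asymm (r1 hyi) (r2 hxj)
    · exact hij (d2 hyi hyj)
  · rcases hxj with rfl | hxj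
    · rcases hyj with hyj | hyj
      · exact hne hyj.symm
      · exact lt_asymm (r1 hxi) (r2 hyj)
    · exact hij (d1 hxi hxj)
  · rcases hxj with rfl | hxj
    · rcases hyj with hyj | hyj
      · exact hne hyj.symm
      · exact hij (d2 hyi hyj)
    · exact hij (d1 hxi hxj)

theorem edge_disjoint : Pairwise fun i j => Disjoint (H i).edgeSet (H j).edgeSet := by
  intro i j hij
  rw [Set.disjoint_left]
  intro e
  induction e with
  | _ x y => exact fun hi hj => hij (h.edge_unique hi hj)

theorem reachable_of_mem {i : ι} {s : Set ι} (hi : i ∈ s) {x y : V} (hx : x ∈ (H i).verts)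
    (hy : y ∈ (H i).verts) : (famUnion H s).spanningCoe.Reachable x y := by
  have h1 := ((h.conn i).preconnected.coe ⟨x, hx⟩ ⟨y, hy⟩)
  rw [SimpleGraph.Subgraph.coe_reachable_iff] at h1
  refine h1.mono ?_
  intro a b hab
  exact famUnion_adj.2 ⟨i, hi, hab⟩

theorem u_mem (i : ι) : u i ∈ (H i).verts := by
  rw [h.verts]
  exact Set.mem_insert _ _

theorem mem_of_mem {i : ι} {x : V} (hx : x ∈ N i) : x ∈ (H i).verts := by
  rw [h.verts]
  exact Set.mem_insert_of_mem _ hx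

/-- Take the subgraph of largest rank that meets the cycle in an edge. Nothing met by the cycle is
attached at its own vertices, so these can be left only through the single vertex `u j`, and the
whole cycle stays inside. -/
theorem cycle [Finite ι] (s : Set ι) (v : V) (c : (famUnion H s).spanningCoe.Walk v v)
    (hc : c.IsCycle) : ∃! i, i ∈ s ∧ ∃ e ∈ c.edges, e ∈ (H i).edgeSet := by
  classical
  have hedge : ∀ x y, s(x, y) ∈ c.edges → ∃ i ∈ s, (H i).Adj x y := by
    intro x y hxy
    exact famUnion_adj.1 (c.adj_of_mem_edges hxy)
  obtain ⟨j, ⟨hjs, e, he, hej⟩, hmax⟩ := Set.exists_max_image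
    {i | i ∈ s ∧ ∃ e ∈ c.edges, e ∈ (H i).edgeSet} rank (Set.toFinite _) (by
      cases c with
      | nil => simp at hc
      | @cons _ b _ hab p =>
        obtain ⟨i, hi, hadj⟩ := hedge v b (by simp)
        exact ⟨i, hi, s(v, b), by simp, hadj⟩)
  have hN : ∀ x y, s(x, y) ∈ c.edges → x ∈ N j → (H j).Adj x y := by
    intro x y hxy hx
    obtain ⟨i, hi, hadj⟩ := hedge x y hxy
    have hxi := hadj.fst_mem
    rw [h.verts] at hxi
    rcases hxi with rfl | hxi
    · exact absurd (h.rank_lt j i hx) (not_lt.2 (hmax i ⟨hi, _, hxy, hadj⟩))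
    · rwa [h.disj j i x hx hxi]
  have hstep : ∀ x y, s(x, y) ∈ c.edges → x ∈ N j → y ∈ N j ∨ y = u j := by
    intro x y hxy hx
    have := (hN x y hxy hx).snd_mem
    rw [h.verts] at this
    exact this.symm
  have hall : ∀ x y, s(x, y) ∈ c.edges → x ∈ N j ∨ y ∈ N j := by
    have key : ∀ (w : V) (c' : (famUnion H s).spanningCoe.Walk w w), c'.IsCycle →
        (∀ e, e ∈ c'.edges ↔ e ∈ c.edges) → (u j ∈ c'.support → u j = w) →
        ∀ x y, s(x, y) ∈ c.edges → x ∈ N j ∨ y ∈ N j := by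
      intro w c' hc' hedges hu x y hxy
      cases c' with
      | nil => simp at hc'
      | @cons _ b _ hab p =>
        rw [SimpleGraph.Walk.cons_isCycle_iff] at hc'
        have hsup : ∀ z t, s(z, t) ∈ c.edges → z ∈ p.support := by
          intro z t hzt
          rw [← hedges] at hzt
          have := (SimpleGraph.Walk.cons hab p).fst_mem_support_of_mem_edges hzt
          simp only [SimpleGraph.Walk.support_cons, List.mem_cons] at this
          rcases this with rfl | this
          · exact p.end_mem_support
          · exact this
        have hnj := h.not_mem j
        rcases SimpleGraph.Walk.IsPath.all_or_none p hc'.1 (z := u j) (fun h => hu (by simp [h]))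
          hnj (fun a b hab => hstep a b ((hedges _).1 (by simp [hab]))) with h1 | h1
        · have hne := (c.adj_of_mem_edges hxy).ne
          by_cases hxu : x = u j
          · refine Or.inr (h1 y (hsup y x (by rwa [Sym2.eq_swap])) ?_)
            rintro rfl
            exact hne hxu
          · exact Or.inl (h1 x (hsup x y hxy) hxu)
        · exfalso
          induction e with
          | _ a b =>
            have ha : (H j).Adj a b := hej
            have h2 := ha.fst_mem
            have h3 := ha.snd_mem
            rw [h.verts] at h2 h3
            rcases h2 with rfl | h2
            · rcases h3 with rfl | h3
              · exact ha.ne rfl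
              · exact h1 b (hsup b _ (by rwa [Sym2.eq_swap])) h3
            · exact h1 a (hsup a b he) h2
    -- Rotating the cycle to start at `u j` makes it a path closed by one edge, to which
    -- `all_or_none` applies.
    by_cases hu : u j ∈ c.support
    · refine key _ (c.rotate _ hu) (hc.rotate hu) (fun e => ?_) fun _ => rfl
      exact (c.rotate_edges _ hu).mem_iff
    · exact key v c hc (fun _ => Iff.rfl) fun h => absurd h hu
  have hj : ∀ e ∈ c.edges, e ∈ (H j).edgeSet := by
    intro e
    induction e with
    | _ x y =>
      intro hxy
      rcases hall x y hxy with hx | hy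
      · exact hN x y hxy hx
      · exact (hN y x (by rwa [Sym2.eq_swap]) hy).symm
  refine ⟨j, ⟨hjs, e, he, hej⟩, ?_⟩
  rintro i ⟨-, e', he', hei⟩
  have := hj e' he'
  induction e' with
  | _ x y => exact h.edge_unique hei this

/-- Passing from an own vertex to the attachment vertex of its subgraph lowers the rank and ends at
a vertex owned by nobody. That vertex identifies the connected component of the union. -/
theorem exists_base [Finite ι] : ∃ g : V → V, (∀ x, (∀ i, x ∉ N i) → g x = x) ∧
    (∀ i x, x ∈ N i → g x = g (u i)) ∧ ∀ x i, g x ∉ N i := by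
  have hex : ∀ x, ∃ z, ReflTransGen (fun x y => ∃ i, x ∈ N i ∧ y = u i) x z ∧ ∀ i, z ∉ N i := by
    have key : ∀ i, ∃ z, ReflTransGen (fun x y => ∃ i, x ∈ N i ∧ y = u i) (u i) z ∧
        ∀ i, z ∉ N i := by
      intro i
      induction i using (Finite.wellFounded_of_trans_of_irrefl
        (fun i j => rank i < rank j)).induction with
      | _ i ih =>
        by_cases hi : ∃ j, u i ∈ N j
        · obtain ⟨j, hj⟩ := hi
          obtain ⟨z, hz, hz'⟩ := ih j (h.rank_lt j i hj)
          exact ⟨z, .head ⟨j, hj, rfl⟩ hz, hz'⟩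
        · push Not at hi
          exact ⟨u i, .refl, hi⟩
    intro x
    by_cases hx : ∃ i, x ∈ N i
    · obtain ⟨i, hi⟩ := hx
      obtain ⟨z, hz, hz'⟩ := key i
      exact ⟨z, .head ⟨i, hi, rfl⟩ hz, hz'⟩
    · push Not at hx
      exact ⟨x, .refl, hx⟩
  have huniq : ∀ x z z', ReflTransGen (fun x y => ∃ i, x ∈ N i ∧ y = u i) x z → (∀ i, z ∉ N i) →
      ReflTransGen (fun x y => ∃ i, x ∈ N i ∧ y = u i) x z' → (∀ i, z' ∉ N i) → z = z' := by
    intro x z z' hz hzN hz' hzN'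
    induction hz using ReflTransGen.head_induction_on with
    | refl =>
      rcases ReflTransGen.cases_head hz' with h1 | ⟨w, ⟨i, hi, -⟩, -⟩
      · exact h1
      · exact absurd hi (hzN i)
    | head hab _ ih =>
      obtain ⟨i, hi, rfl⟩ := hab
      rcases ReflTransGen.cases_head hz' with rfl | ⟨w, ⟨j, hj, rfl⟩, hw⟩
      · exact absurd hi (hzN' i)
      · obtain rfl := h.disj i j _ hi hj
        exact ih hw
  choose g hg hgN using hex
  refine ⟨g, fun x hx => ?_, fun i x hx => ?_, hgN⟩
  · exact huniq x _ _ (hg x) (hgN x) .refl hx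
  · exact huniq x _ _ (hg x) (hgN x) (.head ⟨i, hx, rfl⟩ (hg (u i))) (hgN (u i))

/-- Components correspond to the values of `g`, and each such vertex carries exactly one root. The
second half identifies parents: `H j` hangs at an own vertex of its parent, or is attached at the
same unowned vertex as the root hammock. -/
theorem main [Finite ι] : IsRootedForestOfHammocks H roots ∧
    ∀ i j, IsParentHammock H roots i j →
      u j ∈ N i ∨ (i ∈ roots ∧ u i = u j ∧ i ≠ j ∧ ∀ l, u j ∉ N l) := by
  obtain ⟨g, hg1, hg2, hg3⟩ := h.exists_base
  have wf := Finite.wellFounded_of_trans_of_irrefl (fun i j : ι => rank i < rank j)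
  have hgv : ∀ i x, x ∈ (H i).verts → g x = g (u i) := by
    intro i x hx
    rw [h.verts] at hx
    rcases hx with rfl | hx
    · rfl
    · exact hg2 i x hx
  have hreach : ∀ x y, (famUnion H Set.univ).spanningCoe.Reachable x y → g x = g y := by
    rintro x y ⟨p⟩
    induction p with
    | nil => rfl
    | cons hab p ih =>
      obtain ⟨i, -, hi⟩ := famUnion_adj.1 hab
      rw [← ih, hgv i _ hi.fst_mem, hgv i _ hi.snd_mem]
  have hbase : ∀ i, (famUnion H {l | g (u l) = g (u i)}).spanningCoe.Reachable (u i) (g (u i)) := by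
    intro i
    induction i using wf.induction with
    | _ i ih =>
      by_cases hi : ∃ j, u i ∈ N j
      · obtain ⟨j, hj⟩ := hi
        have := hg2 j _ hj
        rw [this]
        refine (h.reachable_of_mem (i := j) (s := {l | g (u l) = g (u j)}) rfl (h.mem_of_mem hj) (h.u_mem j)).trans ?_
        exact ih j (h.rank_lt j i hj)
      · push Not at hi
        rw [hg1 _ hi]
  have hgmem : ∀ i, ∃ k ∈ roots, u k = g (u i) := by
    intro i
    induction i using wf.induction with
    | _ i ih =>
      by_cases hi : ∃ j, u i ∈ N j
      · obtain ⟨j, hj⟩ := hi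
        rw [hg2 j _ hj]
        exact ih j (h.rank_lt j i hj)
      · push Not at hi
        rw [hg1 _ hi]
        exact h.root_exists i hi
  have hmono : ∀ s : Set ι, (famUnion H s).spanningCoe ≤ (famUnion H Set.univ).spanningCoe := by
    intro s a b hab
    obtain ⟨i, -, hi⟩ := famUnion_adj.1 hab
    exact famUnion_adj.2 ⟨i, trivial, hi⟩
  have hmem : ∀ x₀ : (famUnion H Set.univ).verts,
      membersOf H ((famUnion H Set.univ).coe.connectedComponentMk x₀) = {i | g (u i) = g x₀} := by
    rintro ⟨x₀, hx₀⟩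
    ext i
    constructor
    · rintro ⟨⟨x, hx⟩, hxi, hxW⟩
      rw [SimpleGraph.ConnectedComponent.eq, SimpleGraph.Subgraph.coe_reachable_iff] at hxW
      have := hreach _ _ hxW
      change g (u i) = g x₀
      rw [← this, hgv i x hxi]
    · intro (hi : g (u i) = g x₀)
      obtain ⟨j, -, hj⟩ := famUnion_verts.1 hx₀
      refine ⟨⟨u i, famUnion_verts.2 ⟨i, trivial, h.u_mem i⟩⟩, h.u_mem i, ?_⟩
      rw [SimpleGraph.ConnectedComponent.eq, SimpleGraph.Subgraph.coe_reachable_iff]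
      have h1 := (hbase i).mono (hmono _)
      have h2 := (hbase j).mono (hmono _)
      have h3 := h.reachable_of_mem (Set.mem_univ j) hj (h.u_mem j)
      rw [hi] at h1
      rw [← hgv j _ hj] at h2
      exact h1.trans (h3.trans h2).symm
  refine ⟨⟨h.edge_disjoint, ?_, ?_⟩, ?_⟩
  · intro W
    induction W using SimpleGraph.ConnectedComponent.ind with
    | _ x₀ =>
      refine ⟨fun i _ j _ hij => h.edge_disjoint hij, h.cycle _, ?_⟩
      rw [hmem]
      obtain ⟨j, -, hj⟩ := famUnion_verts.1 x₀.2
      rw [SimpleGraph.Subgraph.connected_iff]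
      refine ⟨⟨?_⟩, u j, famUnion_verts.2 ⟨j, (hgv j _ hj).symm, h.u_mem j⟩⟩
      have key : ∀ x ∈ (famUnion H {i | g (u i) = g x₀}).verts,
          (famUnion H {i | g (u i) = g x₀}).spanningCoe.Reachable x (g x₀) := by
        intro x hx
        obtain ⟨i, hi, hxi⟩ := famUnion_verts.1 hx
        have h1 := h.reachable_of_mem hi hxi (h.u_mem i)
        have h2 := hbase i
        rw [show g (u i) = g x₀ from hi] at h2
        exact h1.trans h2
      rintro ⟨x, hx⟩ ⟨y, hy⟩
      rw [SimpleGraph.Subgraph.coe_reachable_iff]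
      exact (key x hx).trans (key y hy).symm
  · intro W
    induction W using SimpleGraph.ConnectedComponent.ind with
    | _ x₀ =>
      rw [hmem]
      obtain ⟨j, -, hj⟩ := famUnion_verts.1 x₀.2
      obtain ⟨k, hk, hku⟩ := hgmem j
      have hgk : ∀ k ∈ roots, g (u k) = u k := fun k hk => hg1 _ (h.root_not_mem k hk)
      have hgj := hgv j _ hj
      refine ⟨k, ⟨?_, hk⟩, ?_⟩
      · change g (u k) = g x₀
        rw [hgk k hk, hku, hgj]
      · rintro k' ⟨hk', hkr'⟩
        have hk' : g (u k') = g x₀ := hk'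
        refine h.root_unique k' hkr' k hk ?_
        rw [← hgk k' hkr', hk', hku, hgj]
  · rintro i j ⟨W, k, hk, hi, hj, hkW, hjk, hcase⟩
    induction W using SimpleGraph.ConnectedComponent.ind with
    | _ x₀ =>
    rw [hmem] at hi hj hkW
    have hkN := h.root_not_mem k hk
    have hgk : u k = g x₀ := (hg1 _ hkN).symm.trans hkW
    rcases hcase with ⟨⟨x, hxj, hxk⟩, rfl⟩ | ⟨hempty, hpath⟩
    · by_cases hjN : ∃ l, u j ∈ N l
      · left
        obtain ⟨l, hl⟩ := hjN
        rw [h.verts] at hxj hxk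
        rcases hxj with hxj | hxj <;> rcases hxk with hxk | hxk
        · rw [← hxj, hxk] at hl
          exact absurd hl (hkN l)
        · exact hxj ▸ hxk
        · exact absurd (hxk ▸ hxj) (hkN j)
        · exact absurd (h.disj _ _ _ hxj hxk) hjk
      · push Not at hjN
        exact Or.inr ⟨hk, hgk.trans (hj.symm.trans (hg1 _ hjN)), hjk.symm, hjN⟩
    · have hdis : ∀ x, x ∈ (H j).verts → x ∉ (H k).verts := fun x h1 h2 => by
        have : x ∈ (H j).verts ∩ (H k).verts := ⟨h1, h2⟩
        rw [hempty] at this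
        exact this
      have hjN : ∃ l, u j ∈ N l := by
        by_contra hjN
        push Not at hjN
        have : u j = u k := (hg1 _ hjN).symm.trans (Eq.trans hj hgk.symm)
        exact hdis (u j) (h.u_mem j) (this ▸ h.u_mem k)
      obtain ⟨i', hi'⟩ := hjN
      -- `IsParentHammock` speaks of all paths to the root hammock, so one suitable path suffices.
      -- It is built inside the subgraphs met when following attachments from `i'`, stopping before
      -- `k`; their ranks are at most `rank i'`.
      set S : Set ι := {l | ReflTransGen (fun a b => u a ∈ N b) i' l ∧ l ≠ k} with hS
      have hgl : ∀ l, ReflTransGen (fun a b => u a ∈ N b) i' l →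
          g (u l) = g x₀ ∧ rank l ≤ rank i' := by
        intro l hl
        induction hl with
        | refl => exact ⟨(hg2 _ _ hi').symm.trans hj, le_rfl⟩
        | tail _ hab ih => exact ⟨(hg2 _ _ hab).symm.trans ih.1, (h.rank_lt _ _ hab).le.trans ih.2⟩
      have hwalk : ∀ l, ReflTransGen (fun a b => u a ∈ N b) i' l → l ≠ k →
          ∃ y ∈ (H k).verts, (famUnion H S).spanningCoe.Reachable (u l) y := by
        intro l
        induction l using wf.induction with
        | _ l ih =>
          intro hl hlk
          by_cases hlN : ∃ m, u l ∈ N m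
          · obtain ⟨m, hm⟩ := hlN
            by_cases hmk : m = k
            · subst hmk
              exact ⟨u l, h.mem_of_mem hm, .refl _⟩
            · obtain ⟨y, hy, hp⟩ := ih m (h.rank_lt _ _ hm) (hl.tail hm) hmk
              refine ⟨y, hy, (h.reachable_of_mem (i := m) (s := S) ⟨hl.tail hm, hmk⟩ (h.mem_of_mem hm)
                (h.u_mem m)).trans hp⟩
          · push Not at hlN
            refine ⟨u k, h.u_mem k, ?_⟩
            rw [hgk, ← (hgl l hl).1, hg1 _ hlN]
      have hik : i' ≠ k := by
        rintro rfl
        exact hdis _ (h.u_mem j) (h.mem_of_mem hi')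
      have hi'S : i' ∈ S := ⟨.refl, hik⟩
      obtain ⟨y, hy, hp⟩ := hwalk i' .refl hik
      obtain ⟨p₀⟩ := (h.reachable_of_mem hi'S (h.mem_of_mem hi') (h.u_mem i')).trans hp
      obtain ⟨y', hy', p, hp, hfirst⟩ := p₀.exists_first_hit hy
      have hnil : ¬ p.Nil := by
        intro hn
        exact hdis _ (h.u_mem j) (hn.eq ▸ hy')
      have hadj := p.adj_snd hnil
      obtain ⟨l, hl, hadjl⟩ := famUnion_adj.1 hadj
      -- `u j` could otherwise only be the attachment vertex of `H l`; being owned by `i'`, this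
      -- would give `l` a larger rank than `i'`.
      have hli : l = i' := by
        have := hadjl.fst_mem
        rw [h.verts] at this
        rcases this with h1 | h1
        · rw [h1] at hi'
          exact absurd (h.rank_lt _ _ hi') (not_lt.2 (hgl l hl.1).2)
        · exact h.disj _ _ _ h1 hi'
      subst hli
      have hres := hpath (u j) y' (p.mapLe (hmono S)) (by simpa using hp) (h.u_mem j) hy' ?_ ?_
      · have hsnd : (p.mapLe (hmono S)).snd = p.snd := by
          simp [SimpleGraph.Walk.snd, SimpleGraph.Walk.mapLe]
        rw [hsnd] at hres
        rw [h.edge_unique (i := i) (j := l) hres hadjl]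
        exact Or.inl hi'
      -- The path stays in subgraphs of rank below `rank j`, which contain no own vertex of `H j`.
      · intro z hz hzj
        have hz : z ∈ p.support := by simpa using hz
        by_contra hne
        rw [h.verts] at hzj
        have hzj := hzj.resolve_left hne
        have hzS : ∃ m ∈ S, z ∈ (H m).verts := by
          obtain ⟨e, he, hze⟩ := (p.mem_support_iff_exists_mem_edges_of_not_nil hnil).1 hz
          have he' := p.edges_subset_edgeSet he
          obtain ⟨t, rfl⟩ := Sym2.mem_iff_exists.1 hze
          obtain ⟨m, hm, hadj'⟩ := famUnion_adj.1 he'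
          exact ⟨m, hm, hadj'.fst_mem⟩
        obtain ⟨m, hm, hzm⟩ := hzS
        have hrm := (hgl m hm.1).2.trans_lt (h.rank_lt _ _ hi')
        rw [h.verts] at hzm
        rcases hzm with rfl | hzm
        · exact lt_asymm hrm (h.rank_lt _ _ hzj)
        · exact hrm.ne (congrArg rank (h.disj _ _ _ hzm hzj))
      · intro z hz hzk
        exact hfirst z (by simpa using hz) hzk

end IsAttached

end Attach

/-! ### Shortest paths -/

section Shortest

variable {V : Type*} {G T : SimpleGraph V} {w : Sym2 V → ℕ} {r : V}

theorem walkWeight_append {u v x : V} (p : G.Walk u v) (q : G.Walk v x) :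
    walkWeight w (p.append q) = walkWeight w p + walkWeight w q := by
  simp [walkWeight]

theorem IsShortestPath.of_append_right {u v x : V} {p : G.Walk u v} {q : G.Walk v x}
    (h : IsShortestPath w (p.append q)) : IsShortestPath w q := by
  refine ⟨h.1.of_append_right, fun q' => ?_⟩
  have := h.2 (p.append q')
  rw [walkWeight_append, walkWeight_append] at this
  omega

theorem IsShortestPath.of_append_left {u v x : V} {p : G.Walk u v} {q : G.Walk v x}
    (h : IsShortestPath w (p.append q)) : IsShortestPath w p := by
  refine ⟨h.1.of_append_left, fun p' => ?_⟩
  have := h.2 (p'.append q)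
  rw [walkWeight_append, walkWeight_append] at this
  omega

theorem walkWeight_reverse {u v : V} (p : G.Walk u v) :
    walkWeight w p.reverse = walkWeight w p := by
  simp [walkWeight]

theorem IsShortestPath.reverse {u v : V} {p : G.Walk u v} (h : IsShortestPath w p) :
    IsShortestPath w p.reverse := by
  refine ⟨h.1.reverse, fun q => ?_⟩
  have := h.2 q.reverse
  rwa [walkWeight_reverse] at this ⊢

theorem IsBFSTree.exists_shortest (h : IsBFSTree G w r T) {u v : V} (huv : AncestorOrEq T r u v) :
    ∃ t : T.Walk u v, IsShortestPath w (t.mapLe h.le) ∧ ∀ z ∈ t.support, AncestorOrEq T r z v := by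
  classical
  obtain ⟨p, hp, hu⟩ := huv
  have hs := h.shortest v p hp
  have he := congrArg (SimpleGraph.Walk.mapLe h.le) (p.take_spec hu)
  rw [SimpleGraph.Walk.mapLe, SimpleGraph.Walk.map_append] at he
  rw [← he] at hs
  exact ⟨p.dropUntil u hu, hs.of_append_right,
    fun z hz => ⟨p, hp, p.support_dropUntil_subset_support hu hz⟩⟩

/-- A shortest path towards an ancestor of its starting point is a path of the tree. -/
theorem IsInstance.tree_path (h : IsInstance G w r T) {u v : V} (huv : AncestorOrEq T r u v)
    {p : G.Walk v u} (hp : IsShortestPath w p) :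
    (∀ e ∈ p.edges, e ∈ T.edgeSet) ∧ ∀ z ∈ p.support, AncestorOrEq T r z v := by
  obtain ⟨t, ht, ht'⟩ := h.bfs.exists_shortest huv
  obtain rfl := h.unique_shortest _ _ _ _ hp ht.reverse
  constructor
  · intro e he
    refine t.edges_subset_edgeSet ?_
    simpa using he
  · intro z hz
    exact ht' z (by simpa using hz)

/-- An edge to an ancestor is a shortest path, hence by uniqueness the tree path. Nonnegative
truncation of weights plays no role afterwards: from here on `Valid` carries the combinatorics
without `w`. -/
theorem IsInstance.valid (h : IsInstance G w r T) : RootedGraph.Valid ⟨G, T, r⟩ where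
  isTree := h.bfs.isTree
  le := h.bfs.le
  seriesParallel := h.seriesParallel
  cross := by
    intro x y hxy hn ha
    have := (h.tree_path ha (h.edge_shortest y x hxy.symm)).1 s(x, y) (by simp [Sym2.eq_swap])
    exact hn this

theorem SimpleGraph.Walk.exists_append_of_mem_edges {u v x y : V} (p : G.Walk u v)
    (h : s(x, y) ∈ p.edges) :
    (∃ (p₁ : G.Walk u x) (hxy : G.Adj x y) (p₂ : G.Walk y v), p = p₁.append (.cons hxy p₂)) ∨
    ∃ (p₁ : G.Walk u y) (hyx : G.Adj y x) (p₂ : G.Walk x v), p = p₁.append (.cons hyx p₂) := by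
  induction p with
  | nil => simp at h
  | @cons a b c hab p ih =>
    rw [SimpleGraph.Walk.edges_cons, List.mem_cons] at h
    rcases h with h | h
    · rcases Sym2.eq_iff.1 h with ⟨rfl, rfl⟩ | ⟨rfl, rfl⟩
      · exact Or.inl ⟨.nil, hab, p, rfl⟩
      · exact Or.inr ⟨.nil, hab, p, rfl⟩
    · rcases ih h with ⟨p₁, h', p₂, rfl⟩ | ⟨p₁, h', p₂, rfl⟩
      · exact Or.inl ⟨.cons hab p₁, h', p₂, rfl⟩
      · exact Or.inr ⟨.cons hab p₁, h', p₂, rfl⟩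

/-- Consider the step `ab` with which the path enters the subtree of `q`. From `b` on it is a
shortest path to an ancestor, hence climbs the tree through `z`; so `b` is below `z`, and `ab`
leaves the subtree of `q`. -/
theorem IsInstance.out_of_not_anc (h : IsInstance G w r T) {q z : V} (hq : IsTreeParent T r q z)
    (hzq : G.Adj z q) {u : V} (p : G.Walk u z) (hp : IsShortestPath w (p.append (.cons hzq .nil)))
    (hu : ¬ AncestorOrEq T r q u) : RootedGraph.Out ⟨G, T, r⟩ z := by
  induction p with
  | nil => exact absurd hq.2 hu
  | @cons a b z hab p ih =>
    have hp' : IsShortestPath w (p.append (.cons hzq .nil)) :=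
      IsShortestPath.of_append_right (p := .cons hab .nil) hp
    by_cases hb : AncestorOrEq T r q b
    · refine ⟨q, b, a, hq, ?_, hu, hab.symm⟩
      exact (h.tree_path hb hp').2 z (by simp)
    · exact ih hq hzq hp' hb

/-- On a shortest path starting with a cross edge, upward tree edges lie below a cross edge leaving
the subtree below their parent. -/
theorem IsInstance.out_of_up (h : IsInstance G w r T) {q z u v : V} (hq : IsTreeParent T r q z)
    {hzq : G.Adj z q} {p₁ : G.Walk u z} {p₂ : G.Walk q v}
    (hp : IsShortestPath w (p₁.append (.cons hzq p₂)))
    (hfirst : s(u, (p₁.append (.cons hzq p₂)).snd) ∉ T.edgeSet) :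
    RootedGraph.Out ⟨G, T, r⟩ z := by
  have hp' : IsShortestPath w (p₁.append (.cons hzq .nil)) := by
    refine IsShortestPath.of_append_left (q := p₂) ?_
    rwa [← SimpleGraph.Walk.append_assoc]
  refine h.out_of_not_anc hq hzq p₁ hp' fun ha => hfirst ?_
  have ht := (h.tree_path ha hp').1
  apply ht
  cases p₁ with
  | nil => simp
  | cons hab p => simp

/-- Upward edges are treated by `out_of_up` using the first cross edge; downward ones become upward
in the reversed path, where the last cross edge comes first. -/
theorem IsInstance.out_of_cross_path (h : IsInstance G w r T) {q z u v : V}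
    (hq : IsTreeParent T r q z) {p : G.Walk u v} (hp : IsShortestPath w p)
    (hfirst : s(u, p.snd) ∉ T.edgeSet) (hlast : s(p.penultimate, v) ∉ T.edgeSet)
    (he : s(q, z) ∈ p.edges) : RootedGraph.Out ⟨G, T, r⟩ z := by
  rcases p.exists_append_of_mem_edges he with ⟨p₁, h', p₂, rfl⟩ | ⟨p₁, h', p₂, rfl⟩
  · have hr : (p₁.append (.cons h' p₂)).reverse = p₂.reverse.append (.cons h'.symm p₁.reverse) := by
      simp [← SimpleGraph.Walk.append_assoc]
    have hp' := hp.reverse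
    rw [← SimpleGraph.Walk.snd_reverse, hr, Sym2.eq_swap] at hlast
    rw [hr] at hp'
    exact h.out_of_up hq hp' hlast
  · exact h.out_of_up hq hp hfirst

end Shortest

theorem ConnOn.induce_connected {V : Type*} {T : SimpleGraph V} {A : Set V} (h : ConnOn T.Adj A)
    (hne : A.Nonempty) : (T.induce A).Connected := by
  have : Nonempty A := hne.to_subtype
  refine ⟨?_⟩
  rintro ⟨u, hu⟩ ⟨v, hv⟩
  have hp := h u hu v hv
  induction hp with
  | refl => exact .refl _
  | tail _ hab ih =>
    refine (ih hab.2.1).trans (SimpleGraph.Adj.reachable ?_)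
    exact hab.1

/-! ### Existence of hammock decompositions -/

namespace RootedGraph

section Data

variable {V : Type*} [LT V] (R : RootedGraph V)

/-- The root hammocks. -/
def IsRootLabel (b : V) : Prop :=
  ∃ u, R.IsLeftRoot b u ∧ (∀ i, ¬ R.Owner u i) ∧ ∀ b', R.IsLeftRoot b' u → ¬ b' < b

/-- The vertices of the left tree of the hammock with right root `b`. -/
def InLeft (b v : V) : Prop := R.IsLeftRoot b v ∨ (R.Owner v b ∧ ¬ R.anc b v)

/-- The vertices of the right tree of the hammock with right root `b`. -/
def InRight (b v : V) : Prop := R.Owner v b ∧ R.anc b v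

open Classical in
/-- The left root of the hammock with right root `b`. -/
noncomputable def leftRoot (b : V) : V :=
  if h : ∃ u, R.IsLeftRoot b u then h.choose else R.root

open Classical in
/-- The decomposition whose hammocks have the right roots listed in `l`. -/
noncomputable def data [Fintype V] (l : List V) : HammockData V where
  num := l.length
  left i := Finset.univ.filter (R.InLeft (l.get i))
  right i := Finset.univ.filter (R.InRight (l.get i))
  leftRoot i := R.leftRoot (l.get i)
  rightRoot i := l.get i
  roots := Finset.univ.filter fun i => R.IsRootLabel (l.get i)
  base := Finset.univ.filter fun v => ∀ b, ¬ R.Owner v b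

end Data

variable {V : Type*} [LinearOrder V] [Fintype V] {R : RootedGraph V}

namespace Valid

variable (h : R.Valid)

include h

theorem isLeftRoot_leftRoot {b : V} (hb : ¬ R.IsStarter b) : R.IsLeftRoot b (R.leftRoot b) := by
  have := h.exists_isLeftRoot hb
  rw [leftRoot, dif_pos this]
  exact this.choose_spec

theorem isLeftRoot_iff {b u : V} (hb : ¬ R.IsStarter b) : R.IsLeftRoot b u ↔ u = R.leftRoot b := by
  constructor
  · exact fun hu => h.leftRoot_unique hu (h.isLeftRoot_leftRoot hb)
  · rintro rfl
    exact h.isLeftRoot_leftRoot hb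

theorem inLeft_or_inRight {b v : V} (hb : ¬ R.IsStarter b) :
    R.InLeft b v ∨ R.InRight b v ↔ v = R.leftRoot b ∨ R.Owner v b := by
  rw [InLeft, InRight, h.isLeftRoot_iff hb]
  tauto

/-- The edges of the graph inside a hammock. -/
theorem adj_inLeft {b x y : V} (hb : ¬ R.IsStarter b) (hx : R.InLeft b x) (hy : R.InLeft b y)
    (hxy : R.graph.Adj x y) : R.tree.Adj x y := by
  have hT := h.isTree
  by_contra hn
  have hu := h.isLeftRoot_leftRoot hb
  obtain ⟨c, a', b', ha, hb', hab, hax, hby⟩ := h.exists_branch_of_adj hxy hn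
  -- all vertices of the left tree strictly below the branching vertex are owned by `b`
  have hup : ∀ z v, R.InLeft b v → R.par c z → R.anc z v → (∃ v', R.InLeft b v' ∧ ¬ R.anc z v') →
      R.Owner z b ∧ ¬ R.anc b z := by
    rintro z v hv hcz hzv ⟨v', hv', hzv'⟩
    have hanc : ∀ v, R.InLeft b v → R.anc (R.leftRoot b) v := by
      rintro v (hv | hv)
      · rw [(h.isLeftRoot_iff hb).1 hv]
        exact .refl hT _
      · exact h.leftRoot_anc hv.1 hv.2 hu
    refine AncestorOrEq.induction (r := R.root) (a := z) (p := fun v => R.InLeft b v →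
      R.Owner z b ∧ ¬ R.anc b z) hT ?_ ?_ hzv hv
    · rintro (hz | hz)
      · rw [(h.isLeftRoot_iff hb).1 hz] at hzv'
        exact absurd (hanc v' hv') hzv'
      · exact hz
    · rintro q v hq hzq ih (hv | hv)
      · refine absurd ?_ hzv'
        rw [(h.isLeftRoot_iff hb).1 hv] at hq
        exact hzq.trans hT (hq.2.trans hT (hanc v' hv'))
      · apply ih
        rcases h.owner_parent_left hv.1 hv.2 hu hq with h1 | h1
        · exact Or.inr ⟨h1, fun h => hv.2 (h.trans hT hq.2)⟩
        · exact Or.inl (h1 ▸ hu)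
  have h1 := hup a' x hx ha hax ⟨y, hy, fun h1 => hab (ha.eq_of_common hT hb' h1 hby)⟩
  have h2 := hup b' y hy hb' hby ⟨x, hx, fun h1 => hab (ha.eq_of_common hT hb' hax h1)⟩
  -- One of the siblings `a'`, `b'` is the sibling child of the other, hence not a starter. Only it
  -- owns itself, so it would be `b`, which is not in the left tree.
  have key : ∀ z, ¬ R.IsStarter z → R.Owner z b → ¬ R.anc b z → False := by
    intro z hz h1 h2
    rw [h.owner_of_not_isStarter hz] at h1
    exact h2 (h1 ▸ .refl hT _)
  have hK : R.SibAdj a' b' := ⟨hab, ⟨c, ha, hb'⟩, x, y, hax, hby, hxy⟩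
  rcases sibParent_or hK with hp | hp
  · exact key b' (h.not_isStarter_of_isSibParent hp) h2.1 h2.2
  · exact key a' (h.not_isStarter_of_isSibParent hp) h1.1 h1.2

/-- A cross edge inside the right tree branches at or below `b`. One of the two branch vertices is a
non-starter owned by `b`, hence `b` itself, but it has a parent below or equal to `b`. -/
theorem adj_inRight {b x y : V} (hx : R.InRight b x) (hy : R.InRight b y)
    (hxy : R.graph.Adj x y) : R.tree.Adj x y := by
  have hT := h.isTree
  by_contra hn
  obtain ⟨c, a', b', ha, hb', hab, hax, hby⟩ := h.exists_branch_of_adj hxy hn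
  have hup : ∀ z v, R.InRight b v → R.anc z v → R.anc b z → R.Owner z b := by
    intro z v hv hzv hbz
    refine AncestorOrEq.induction (r := R.root) (a := z) (p := fun v => R.InRight b v →
      R.Owner z b) hT (fun h => h.1) ?_ hzv hv
    intro q v hq hzq ih hv
    have hbq := hbz.trans hT hzq
    refine ih ⟨h.owner_parent_right hv.1 hv.2 ?_ hq, hbq⟩
    rintro rfl
    exact hq.not_anc hT hbq
  have hbc : R.anc b c := by
    have := (isLca_of_branch hT ha hb' hab hax hby).2.2 b hx.2 hy.2
    exact this
  have key : ∀ z, ¬ R.IsStarter z → R.Owner z b → R.par c z → False := by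
    intro z hz h1 h2
    rw [h.owner_of_not_isStarter hz] at h1
    subst h1
    exact h2.not_anc hT hbc
  have hK : R.SibAdj a' b' := ⟨hab, ⟨c, ha, hb'⟩, x, y, hax, hby, hxy⟩
  rcases sibParent_or hK with hp | hp
  · exact key b' (h.not_isStarter_of_isSibParent hp) (hup b' y hy hby (hbc.trans hT hb'.2)) hb'
  · exact key a' (h.not_isStarter_of_isSibParent hp) (hup a' x hx hax (hbc.trans hT ha.2)) ha

theorem connOn_inLeft {b : V} (hb : ¬ R.IsStarter b) :
    ConnOn R.tree.Adj {v | R.InLeft b v} ∧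
      ∀ v, R.InLeft b v → R.anc (R.leftRoot b) v := by
  have hT := h.isTree
  have hu := h.isLeftRoot_leftRoot hb
  have hanc : ∀ v, R.InLeft b v → R.anc (R.leftRoot b) v := by
    rintro v (hv | hv)
    · rw [(h.isLeftRoot_iff hb).1 hv]
      exact .refl hT _
    · exact h.leftRoot_anc hv.1 hv.2 hu
  refine ⟨connOn_of_upward_closed (r := R.root) hT le_rfl (R.leftRoot b) hanc ?_, hanc⟩
  rintro v (hv | hv) hne q hq
  · exact absurd ((h.isLeftRoot_iff hb).1 hv) hne
  · rcases h.owner_parent_left hv.1 hv.2 hu hq with h1 | h1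
    · exact Or.inr ⟨h1, fun h => hv.2 (h.trans hT hq.2)⟩
    · exact Or.inl (h1 ▸ hu)

theorem connOn_inRight {b : V} : ConnOn R.tree.Adj {v | R.InRight b v} := by
  have hT := h.isTree
  refine connOn_of_upward_closed (r := R.root) hT le_rfl b (fun v hv => hv.2) ?_
  intro v hv hne q hq
  exact ⟨h.owner_parent_right hv.1 hv.2 hne hq, hq.anc_of_ne hT hv.2 (Ne.symm hne)⟩

variable {l : List V}

omit h in
theorem mem_left {i : Fin (R.data l).num} {v : V} :
    v ∈ (R.data l).left i ↔ R.InLeft (l.get i) v := by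
  classical
  exact Finset.mem_filter.trans (and_iff_right (Finset.mem_univ _))

omit h in
theorem mem_right {i : Fin (R.data l).num} {v : V} :
    v ∈ (R.data l).right i ↔ R.InRight (l.get i) v := by
  classical
  exact Finset.mem_filter.trans (and_iff_right (Finset.mem_univ _))

omit h in
theorem mem_roots {i : Fin (R.data l).num} :
    i ∈ (R.data l).roots ↔ R.IsRootLabel (l.get i) := by
  classical
  exact Finset.mem_filter.trans (and_iff_right (Finset.mem_univ _))

omit h in
theorem mem_base {v : V} : v ∈ (R.data l).base ↔ ∀ b, ¬ R.Owner v b := by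
  simp [data]

theorem hammock_verts (hmem : ∀ b, b ∈ l ↔ ¬ R.IsStarter b) (i : Fin (R.data l).num) :
    ((R.data l).hammock R.graph i).verts =
      insert (R.leftRoot (l.get i)) {v | R.Owner v (l.get i)} := by
  ext v
  have hb := (hmem (l.get i)).1 (List.get_mem _ _)
  have := h.inLeft_or_inRight (v := v) hb
  change v ∈ ((R.data l).left i : Set V) ∪ ((R.data l).right i : Set V) ↔ _
  rw [Set.mem_union, Finset.mem_coe, Finset.mem_coe, mem_left, mem_right, this]
  rfl

theorem isHammock (hmem : ∀ b, b ∈ l ↔ ¬ R.IsStarter b) (i : Fin (R.data l).num) :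
    IsHammock R.tree R.root ((R.data l).hammock R.graph i) ((R.data l).left i)
      ((R.data l).right i) ((R.data l).leftRoot i) ((R.data l).rightRoot i) := by
  have hT := h.isTree
  have hb := (hmem (l.get i)).1 (List.get_mem _ _)
  have hu := h.isLeftRoot_leftRoot hb
  have hl : ((R.data l).left i : Set V) = {v | R.InLeft (l.get i) v} := by
    ext v
    exact mem_left
  have hr : ((R.data l).right i : Set V) = {v | R.InRight (l.get i) v} := by
    ext v
    exact mem_right
  have hdisj : ∀ v, R.InLeft (l.get i) v → ¬ R.InRight (l.get i) v := by
    rintro v (hv | hv) hv'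
    · exact h.not_anc_of_leftRoot hv hv'.2
    · exact hv.2 hv'.2
  have hlu : R.InLeft (l.get i) (R.leftRoot (l.get i)) := Or.inl hu
  have hrb : R.InRight (l.get i) (l.get i) := ⟨owner_self hb, .refl hT _⟩
  refine ⟨rfl, ?_, ?_, ?_, ?_, ?_, ?_, ?_, ?_, ?_⟩
  · rw [hl, hr, Set.disjoint_left]
    exact hdisj
  · rw [hl]
    exact (h.connOn_inLeft hb).1.induce_connected ⟨_, hlu⟩
  · rw [hr]
    exact h.connOn_inRight.induce_connected ⟨_, hrb⟩
  · rw [hl]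
    exact fun x hx y hy hxy => h.adj_inLeft hb hx hy hxy
  · rw [hr]
    exact fun x hx y hy hxy => h.adj_inRight hx hy hxy
  · rw [hl, hr]
    obtain ⟨a, hab⟩ := exists_sibParent hb
    obtain ⟨hne, ⟨c, hca, hcb⟩, x, y, hx, hy, hxy⟩ := id hab.1
    have hnb : ¬ R.anc (l.get i) x := fun h' => hne (hca.eq_of_common hT hcb hx h')
    obtain ⟨h1, h2⟩ := h.owner_of_adj hab hx hy hxy hu
    refine ⟨x, ?_, y, ⟨h2, hy⟩, hxy, ?_⟩
    · rcases h1 with h1 | h1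
      · exact Or.inl (h1 ▸ hu)
      · exact Or.inr ⟨h1, hnb⟩
    · intro hn
      rcases isTreeParent_or_of_adj (r := R.root) hT hn with h' | h'
      · exact hne (hca.eq_of_common hT hcb (hx.trans hT h'.2) hy)
      · exact hnb (hy.trans hT h'.2)
  · rw [hl]
    exact ⟨hlu, (h.connOn_inLeft hb).2⟩
  · rw [hr]
    exact ⟨hrb, fun v hv => hv.2⟩
  · exact ⟨h.leftRoot_not_anc hu, h.not_anc_of_leftRoot hu⟩

/-- The own vertices are those owned by the label, and the attachment vertex is the left root.
Several hammocks may share an unowned left root; `IsRootLabel` selects the smallest of their labels.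
-/
theorem isAttached (hmem : ∀ b, b ∈ l ↔ ¬ R.IsStarter b) (hnd : l.Nodup) :
    ∃ rank : Fin (R.data l).num → ℕ ×ₗ ℕ ×ₗ V,
    IsAttached ((R.data l).hammock R.graph) (fun i => {v | R.Owner v (l.get i)})
      (fun i => R.leftRoot (l.get i)) ((R.data l).roots : Set (Fin (R.data l).num)) rank := by
  have hT := h.isTree
  obtain ⟨rank, hrank⟩ := h.exists_rank
  have hb : ∀ i : Fin (R.data l).num, ¬ R.IsStarter (l.get i) :=
    fun i => (hmem (l.get i)).1 (List.get_mem _ _)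
  have hu := fun i => h.isLeftRoot_leftRoot (hb i)
  have hinj := List.nodup_iff_injective_get.1 hnd
  have hidx : ∀ b, ¬ R.IsStarter b → ∃ i : Fin (R.data l).num, l.get i = b := fun b hb =>
    List.mem_iff_get.1 ((hmem b).2 hb)
  refine ⟨fun i => rank (l.get i), h.hammock_verts hmem, fun i => h.not_owner_leftRoot (hu i),
    fun i j x hi hj => hinj (h.owner_unique hi hj), fun i => ?_,
    fun i j hij => hrank _ _ _ (hu j) hij, ?_, ?_, ?_⟩
  · have hH := h.isHammock hmem i
    obtain ⟨x, hx, y, hy, hxy, -⟩ := hH.cross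
    have hl : ((R.data l).left i : Set V) = {v | R.InLeft (l.get i) v} := by
      ext v
      exact mem_left
    have hr : ((R.data l).right i : Set V) = {v | R.InRight (l.get i) v} := by
      ext v
      exact mem_right
    rw [SimpleGraph.Subgraph.connected_iff]
    refine ⟨ConnOn.subgraph_preconnected (ConnOn.induce ?_), ⟨x, Or.inl hx⟩⟩
    have hc : ConnOn R.graph.Adj (⋃ j : Fin 2,
        ![((R.data l).left i : Set V), ((R.data l).right i : Set V)] j) := by
      refine ConnOn.iUnion (fun j => ?_) fun j k hjk => ?_
      · fin_cases j
        · exact hl ▸ (h.connOn_inLeft (hb i)).1.mono fun _ _ h' => h.le h'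
        · exact hr ▸ h.connOn_inRight.mono fun _ _ h' => h.le h'
      · fin_cases j <;> fin_cases k
        · exact absurd rfl hjk
        · exact ⟨x, hx, y, hy, hxy⟩
        · exact ⟨y, hy, x, hx, hxy.symm⟩
        · exact absurd rfl hjk
    convert hc using 1
    ext v
    simp
  · intro k hk i
    obtain ⟨u, hku, hbase, -⟩ := mem_roots.1 hk
    rw [← (h.isLeftRoot_iff (hb k)).1 hku]
    exact hbase _
  · intro j hj
    have hbase : ∀ b, ¬ R.Owner (R.leftRoot (l.get j)) b := by
      intro b ho
      obtain ⟨i, rfl⟩ := hidx b (h.not_isStarter_of_owner ho)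
      exact hj i ho
    obtain ⟨b, hbu, hmin⟩ := Set.exists_min_image {b | R.IsLeftRoot b (R.leftRoot (l.get j))} id
      (Set.toFinite _) ⟨_, hu j⟩
    obtain ⟨k, rfl⟩ := hidx b (h.not_isStarter_of_leftRoot hbu)
    refine ⟨k, mem_roots.2 ⟨_, hbu, hbase, fun b' hb' => not_lt.2 (hmin b' hb')⟩, ?_⟩
    exact ((h.isLeftRoot_iff (hb k)).1 hbu).symm
  · intro k hk k' hk' he
    obtain ⟨u, hku, -, hmin⟩ := mem_roots.1 hk
    obtain ⟨u', hku', -, hmin'⟩ := mem_roots.1 hk'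
    have h1 := (h.isLeftRoot_iff (hb k)).1 hku
    have h2 := (h.isLeftRoot_iff (hb k')).1 hku'
    have : u = u' := h1.trans (Eq.trans he h2.symm)
    subst this
    exact hinj (le_antisymm (not_lt.1 (hmin _ hku')) (not_lt.1 (hmin' _ hku)))

end Valid

/-- The canonical decomposition is a hammock decomposition. -/
theorem isHammockDecomposition_data {G T : SimpleGraph V} {w : Sym2 V → ℕ} {r : V}
    (hI : IsInstance G w r T) {l : List V}
    (hmem : ∀ b, b ∈ l ↔ ¬ (RootedGraph.mk G T r).IsStarter b) (hnd : l.Nodup) :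
    ((RootedGraph.mk G T r).data l).IsHammockDecomposition G w r T := by
  set R : RootedGraph V := ⟨G, T, r⟩ with hR
  have h : R.Valid := hI.valid
  have hT : T.IsTree := h.isTree
  obtain ⟨rank, hatt⟩ := h.isAttached hmem hnd
  obtain ⟨hforest, hparent⟩ := hatt.main
  have hb : ∀ i : Fin (R.data l).num, ¬ R.IsStarter (l.get i) :=
    fun i => (hmem (l.get i)).1 (List.get_mem _ _)
  have hu := fun i => h.isLeftRoot_leftRoot (hb i)
  have hidx : ∀ b, ¬ R.IsStarter b → ∃ i : Fin (R.data l).num, l.get i = b := fun b hb =>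
    List.mem_iff_get.1 ((hmem b).2 hb)
  have hedge : ∀ i x y, ((R.data l).hammock G i).Adj x y ↔
      (x = R.leftRoot (l.get i) ∨ R.Owner x (l.get i)) ∧
      (y = R.leftRoot (l.get i) ∨ R.Owner y (l.get i)) ∧ G.Adj x y := by
    intro i x y
    have hv := h.hammock_verts hmem i
    have : ∀ z, z ∈ ((R.data l).hammock G i).verts ↔
        z = R.leftRoot (l.get i) ∨ R.Owner z (l.get i) := by
      intro z
      rw [show ((R.data l).hammock G i).verts = _ from hv]
      rfl
    rw [← this, ← this]
    rfl
  have hH : ∀ x y, s(x, y) ∈ (R.data l).hammockEdges G ↔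
      ∃ i, ((R.data l).hammock G i).Adj x y := by
    intro x y
    rw [HammockData.hammockEdges, SimpleGraph.Subgraph.mem_edgeSet, famUnion_adj]
    simp
  -- tree edges of hammocks
  have htree : ∀ q v, R.par q v → ∀ i, ((R.data l).hammock G i).Adj q v →
      R.Owner v (l.get i) ∧ v ≠ l.get i := by
    intro q v hq i hadj
    obtain ⟨h1, h2, -⟩ := (hedge i q v).1 hadj
    obtain ⟨c, hc⟩ := h.exists_par_of_not_isStarter (hb i)
    obtain ⟨a, hab⟩ := Valid.exists_sibParent (hb i)
    obtain ⟨hne, ⟨c', hca, hcb⟩, -⟩ := id hab.1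
    obtain rfl := hc.unique hT hcb
    have hau := h.anc_of_leftCand hab (hu i).1
    -- All hammock vertices lie strictly below `c`. So the parent edge of the right root is not
    -- inside, and the parent of the left root is not a hammock vertex either.
    have hcu : R.anc c (R.leftRoot (l.get i)) ∧ c ≠ R.leftRoot (l.get i) := by
      refine ⟨hca.2.trans hT hau, ?_⟩
      intro he
      exact hca.not_anc hT (he ▸ hau)
    have hcq : R.anc c q ∧ c ≠ q := by
      rcases h1 with rfl | h1
      · exact hcu
      · exact h.owner_anc h1 hc
    have hvb : v ≠ l.get i := by
      rintro rfl
      exact hcq.2 (hc.unique hT hq)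
    refine ⟨h2.resolve_left ?_, hvb⟩
    rintro rfl
    rcases h1 with h1 | h1
    · exact hq.ne h1
    · by_cases hbq : R.anc (l.get i) q
      · exact h.not_anc_of_leftRoot (hu i) (hbq.trans hT hq.2)
      · exact hq.not_anc hT (h.leftRoot_anc h1 hbq (hu i))
  have hin : ∀ q v, R.par q v → ∀ b, R.Owner v b → v ≠ b →
      s(q, v) ∈ (R.data l).hammockEdges G := by
    intro q v hq b ho hne
    obtain ⟨i, rfl⟩ := hidx b (h.not_isStarter_of_owner ho)
    refine (hH q v).2 ⟨i, (hedge i q v).2 ⟨?_, Or.inr ho, h.le hq.1⟩⟩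
    exact (h.owner_parent ho hne (hu i) hq).symm
  have hcross : ∀ x y, G.Adj x y → ¬ T.Adj x y → s(x, y) ∈ (R.data l).hammockEdges G := by
    intro x y hxy hn
    obtain ⟨c, a, b, ha, hb', hab, hax, hby⟩ := h.exists_branch_of_adj hxy hn
    have hK : R.SibAdj a b := ⟨hab, ⟨c, ha, hb'⟩, x, y, hax, hby, hxy⟩
    rcases Valid.sibParent_or hK with hp | hp
    · obtain ⟨i, rfl⟩ := hidx b (h.not_isStarter_of_isSibParent hp)
      obtain ⟨h1, h2⟩ := h.owner_of_adj hp hax hby hxy (hu i)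
      exact (hH x y).2 ⟨i, (hedge i x y).2 ⟨h1, Or.inr h2, hxy⟩⟩
    · obtain ⟨i, rfl⟩ := hidx a (h.not_isStarter_of_isSibParent hp)
      obtain ⟨h1, h2⟩ := h.owner_of_adj hp hby hax hxy.symm (hu i)
      exact (hH x y).2 ⟨i, (hedge i x y).2 ⟨Or.inr h2, h1, hxy⟩⟩
  -- every tree edge, oriented
  have horient : ∀ e ∈ T.edgeSet, ∃ q v, R.par q v ∧ e = s(q, v) := by
    intro e
    induction e with
    | _ x y =>
      intro hxy
      rcases isTreeParent_or_of_adj (r := r) hT hxy with h' | h'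
      · exact ⟨x, y, h', rfl⟩
      · exact ⟨y, x, h', Sym2.eq_swap⟩
  have hbase : ∀ q v, R.par q v → (s(q, v) ∈ (R.data l).baseEdges T ↔ ∀ b, ¬ R.Owner v b) := by
    intro q v hq
    constructor
    · intro he
      exact Valid.mem_base.1 (he.2 v (by simp))
    · intro hv
      refine ⟨hq.1, fun x hx => Valid.mem_base.2 ?_⟩
      rcases Sym2.mem_iff.1 hx with rfl | rfl
      · exact h.base_par hv hq
      · exact hv
  have hpe : ∀ q v, R.par q v → (s(q, v) ∈ (R.data l).parentEdges r T ↔ ¬ R.IsStarter v) := by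
    intro q v hq
    constructor
    · rintro ⟨i, c, hc, he⟩
      rcases Sym2.eq_iff.1 he with ⟨rfl, rfl⟩ | ⟨rfl, rfl⟩
      · exact hb i
      · exact absurd hc.2 (hq.not_anc hT)
    · intro hv
      obtain ⟨i, rfl⟩ := hidx v hv
      exact ⟨i, q, hq, rfl⟩
  have hhe : ∀ q v, R.par q v → (s(q, v) ∈ (R.data l).hammockEdges G →
      ∃ b, R.Owner v b ∧ v ≠ b) := by
    intro q v hq he
    obtain ⟨i, hi⟩ := (hH q v).1 he
    exact ⟨_, htree q v hq i hi⟩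
  refine ⟨Valid.mem_base.2 h.not_owner_root, ?_, h.isHammock hmem, hforest, ?_, ?_, ?_, ?_, ?_, ?_⟩
  · have hc : ConnOn T.Adj ((R.data l).base : Set V) := by
      refine connOn_of_upward_closed (r := r) hT le_rfl r (fun x _ => .root hT x) ?_
      intro x hx _ q hq
      exact Valid.mem_base.2 (h.base_par (Valid.mem_base.1 hx) hq)
    exact hc.induce_connected ⟨r, Valid.mem_base.2 h.not_owner_root⟩
  · have hlca : ∀ i : Fin (R.data l).num, ∃ c a, R.IsSibParent a (l.get i) ∧ R.par c a ∧
        R.par c (l.get i) ∧ IsLca T r c (R.leftRoot (l.get i)) (l.get i) := by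
      intro i
      obtain ⟨a, hab⟩ := Valid.exists_sibParent (hb i)
      obtain ⟨hne, ⟨c, hca, hcb⟩, -⟩ := id hab.1
      exact ⟨c, a, hab, hca, hcb, isLca_of_branch hT hca hcb hne
        (h.anc_of_leftCand hab (hu i).1) (.refl hT _)⟩
    have hverts : ∀ i v, v ∈ ((R.data l).hammock G i).verts ↔
        v = R.leftRoot (l.get i) ∨ R.Owner v (l.get i) := by
      intro i z
      rw [show ((R.data l).hammock G i).verts = _ from h.hammock_verts hmem i]
      rfl
    have hinj := List.nodup_iff_injective_get.1 hnd
    refine ⟨?_, ?_, ?_, ?_⟩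
    · intro i j hij
      have hp := hparent i j hij
      have hij' : i ≠ j := by
        rintro rfl
        rcases hp with hp | hp
        · exact h.not_owner_leftRoot (hu i) hp
        · exact hp.2.2.1 rfl
      ext v
      rw [Set.mem_inter_iff, hverts, hverts, Set.mem_singleton_iff]
      change _ ↔ v = R.leftRoot (l.get j)
      constructor
      · rintro ⟨hi, hj | hj⟩
        · exact hj
        · exfalso
          rcases hi with rfl | hi
          · rcases hp with hp | ⟨-, hp, -⟩
            · exact lt_asymm (hatt.rank_lt i j hp) (hatt.rank_lt j i hj)
            · have hp : R.leftRoot (l.get i) = R.leftRoot (l.get j) := hp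
              rw [hp] at hj
              exact h.not_owner_leftRoot (hu j) hj
          · exact hij' (hinj (h.owner_unique hi hj))
      · rintro rfl
        refine ⟨?_, Or.inl rfl⟩
        rcases hp with hp | ⟨-, hp, -⟩
        · exact Or.inr hp
        · exact Or.inl hp.symm
    · intro i j hij
      obtain ⟨c, a, hab, hca, hcb, hl⟩ := hlca j
      refine ⟨c, hl, hcb, ?_⟩
      rw [hverts]
      rcases hparent i j hij with hp | ⟨-, hp, -, hbase⟩
      · rcases h.lca_mem (hu j) hcb hp (hu i) with (h1 | h1) | h1
        · exact Or.inl (Or.inr h1)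
        · exact Or.inl (Or.inl h1)
        · obtain ⟨c', a', -, -, hcb', hl'⟩ := hlca i
          obtain rfl := h1.unique hT hcb'
          exact Or.inr hl'
      -- Two hammocks attached at the same base vertex: both left roots are then the sibling parents
      -- themselves, so both branch at the parent of that vertex.
      · right
        have hbase' : ∀ b, ¬ R.Owner (R.leftRoot (l.get j)) b := by
          intro b ho
          obtain ⟨k, rfl⟩ := hidx b (h.not_isStarter_of_owner ho)
          exact hbase k ho
        have h1 := h.isSibParent_of_base (hu j) hbase'
        have hp : R.leftRoot (l.get i) = R.leftRoot (l.get j) := hp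
        have h2 := h.isSibParent_of_base (hu i) (hp ▸ hbase')
        obtain ⟨c', a', ha', hca', hcb', hl'⟩ := hlca i
        have hc1 : R.par c (R.leftRoot (l.get j)) := h.sibParent_unique hab h1 ▸ hca
        have hc2 : R.par c' (R.leftRoot (l.get i)) := h.sibParent_unique ha' h2 ▸ hca'
        rw [hp] at hc2
        obtain rfl := hc1.unique hT hc2
        exact hl'
    · intro k hk
      obtain ⟨u, hku, hbase, -⟩ := Valid.mem_roots.1 hk
      rw [(h.isLeftRoot_iff (hb k)).1 hku] at hbase
      exact Valid.mem_base.2 hbase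
    · intro k hk
      obtain ⟨u, hku, hbase, -⟩ := Valid.mem_roots.1 hk
      rw [(h.isLeftRoot_iff (hb k)).1 hku] at hbase
      obtain ⟨c, a, hab, hca, hcb, hl⟩ := hlca k
      have h1 := h.isSibParent_of_base (hu k) hbase
      have hc1 : R.par c (R.leftRoot (l.get k)) := h.sibParent_unique hab h1 ▸ hca
      exact ⟨c, hl, hc1, hcb, Valid.mem_base.2 (h.base_par hbase hc1)⟩
  · ext e
    constructor
    · intro he
      by_cases heT : e ∈ T.edgeSet
      · obtain ⟨q, v, hq, rfl⟩ := horient e heT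
        by_cases hv : ∃ b, R.Owner v b
        · obtain ⟨b, hvb⟩ := hv
          by_cases hne : v = b
          · subst hne
            exact Or.inr ((hpe q v hq).2 (h.not_isStarter_of_owner hvb))
          · exact Or.inl (Or.inr (hin q v hq b hvb hne))
        · push Not at hv
          exact Or.inl (Or.inl ((hbase q v hq).2 hv))
      · induction e with
        | _ x y => exact Or.inl (Or.inr (hcross x y he heT))
    · rintro ((he | he) | he)
      · exact SimpleGraph.edgeSet_mono h.le he.1
      · exact SimpleGraph.Subgraph.edgeSet_subset _ he
      · obtain ⟨i, c, hc, rfl⟩ := he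
        exact h.le hc.1
  · rw [Set.disjoint_left]
    intro e he he'
    obtain ⟨q, v, hq, rfl⟩ := horient e he.1
    obtain ⟨b, hb', -⟩ := hhe q v hq he'
    exact (hbase q v hq).1 he b hb'
  · rw [Set.disjoint_left]
    intro e he he'
    obtain ⟨q, v, hq, rfl⟩ := horient e he.1
    exact (hbase q v hq).1 he v (Valid.owner_self ((hpe q v hq).1 he'))
  · rw [Set.disjoint_left]
    rintro e he ⟨i, c, hc, rfl⟩
    obtain ⟨b, hb', hne⟩ := hhe _ _ hc he
    exact hne ((h.owner_of_not_isStarter (hb i)).1 hb')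
  · intro u v p hp hnil hfirst hlast e he
    by_cases heT : e ∈ T.edgeSet
    · obtain ⟨q, z, hq, rfl⟩ := horient e heT
      -- An `Out` vertex is a starter, so it differs from the label owning it, and its parent edge
      -- lies in the hammock instead of in E_p.
      have hout := hI.out_of_cross_path hq hp hfirst hlast he
      obtain ⟨b, hf⟩ := h.exists_first hout
      refine hin q z hq b (Valid.First.owner hf) ?_
      rintro rfl
      exact h.not_isStarter_of_crosses hf.1 (Or.inl hout)
    · have heG := p.edges_subset_edgeSet he
      induction e with
      | _ x y => exact hcross x y heG heT

end RootedGraph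

/-- Every instance has a hammock decomposition. -/
theorem IsInstance.exists_isHammockDecomposition {V : Type*} [Finite V] {G : SimpleGraph V}
    {w : Sym2 V → ℕ} {r : V} {T : SimpleGraph V} (hI : IsInstance G w r T) :
    ∃ D : HammockData V, D.IsHammockDecomposition G w r T := by
  classical
  have := Fintype.ofFinite V
  -- The order only breaks ties, so an arbitrary one will do.
  let _ : LinearOrder V := LinearOrder.lift' (Fintype.equivFin V) (Fintype.equivFin V).injective
  refine ⟨_, RootedGraph.isHammockDecomposition_data hI
    (l := (Finset.univ.filter fun b => ¬ (RootedGraph.mk G T r).IsStarter b).toList) ?_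
    (Finset.nodup_toList _)⟩
  intro b
  simp

/-! ### Reasoning about programs -/

namespace RAMProgram

/-- Started in `s`, the program halts within `B` steps in a state satisfying `Q`. -/
def Runs (P : RAMProgram) (s : RAMState) (B : ℕ) (Q : RAMState → Prop) : Prop :=
  ∃ s' t, P.Exec s s' t ∧ t ≤ B ∧ Q s'

namespace Runs

variable {P P' : RAMProgram} {s : RAMState} {B B' : ℕ} {Q Q' : RAMState → Prop}

theorem mono (h : P.Runs s B Q) (hB : B ≤ B') (hQ : ∀ s, Q s → Q' s) : P.Runs s B' Q' := by
  obtain ⟨s', t, h1, h2, h3⟩ := h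
  exact ⟨s', t, h1, h2.trans hB, hQ _ h3⟩

theorem seq (h : P.Runs s B fun s' => P'.Runs s' B' Q) : (RAMProgram.seq P P').Runs s (B + B') Q := by
  obtain ⟨s', t, h1, h2, s'', t', h3, h4, h5⟩ := h
  exact ⟨s'', t + t', .seq h1 h3, add_le_add h2 h4, h5⟩

theorem const {x c : ℕ} (h : Q (s.setReg x c)) : (RAMProgram.const x c).Runs s 1 Q :=
  ⟨_, 1, .const x c s, le_rfl, h⟩

theorem add {x y z : ℕ} (h : Q (s.setReg x (s.reg y + s.reg z))) :
    (RAMProgram.add x y z).Runs s 1 Q := ⟨_, 1, .add x y z s, le_rfl, h⟩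

theorem sub {x y z : ℕ} (h : Q (s.setReg x (s.reg y - s.reg z))) :
    (RAMProgram.sub x y z).Runs s 1 Q := ⟨_, 1, .sub x y z s, le_rfl, h⟩

theorem load {x y : ℕ} (h : Q (s.setReg x (s.mem (s.reg y)))) :
    (RAMProgram.load x y).Runs s 1 Q := ⟨_, 1, .load x y s, le_rfl, h⟩

theorem store {x y : ℕ} (h : Q (s.setMem (s.reg x) (s.reg y))) :
    (RAMProgram.store x y).Runs s 1 Q := ⟨_, 1, .store x y s, le_rfl, h⟩

theorem ite {x y : ℕ} (h₁ : s.reg x < s.reg y → P.Runs s B Q)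
    (h₂ : ¬ s.reg x < s.reg y → P'.Runs s B Q) : (RAMProgram.ite x y P P').Runs s (B + 1) Q := by
  by_cases h : s.reg x < s.reg y
  · obtain ⟨s', t, k1, k2, k3⟩ := h₁ h
    exact ⟨s', t + 1, .ite_true h k1, by omega, k3⟩
  · obtain ⟨s', t, k1, k2, k3⟩ := h₂ h
    exact ⟨s', t + 1, .ite_false h k1, by omega, k3⟩

/-- Loops with an invariant indexed by a bound for the number of remaining rounds. -/
theorem loop {x y : ℕ} (I : ℕ → RAMState → Prop)
    (h : ∀ k s, I k s → (s.reg x < s.reg y ∧ P.Runs s B fun s' => ∃ j < k, I j s') ∨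
      (¬ s.reg x < s.reg y ∧ Q s)) {k : ℕ} (hI : I k s) :
    (RAMProgram.loop x y P).Runs s (k * (B + 1) + 1) Q := by
  induction k using Nat.strong_induction_on generalizing s with
  | _ k ih =>
    rcases h k s hI with ⟨hlt, s₁, t₁, h1, h2, j, hj, h3⟩ | ⟨hlt, hQ⟩
    · obtain ⟨s₂, t₂, k1, k2, k3⟩ := ih j hj h3
      refine ⟨s₂, t₁ + t₂ + 1, .loop_true hlt h1 k1, ?_, k3⟩
      have : (j + 1) * (B + 1) ≤ k * (B + 1) := Nat.mul_le_mul_right _ hj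
      rw [Nat.add_mul] at this
      omega
    · exact ⟨s, 1, .loop_false hlt, by omega, hQ⟩

end Runs

/-- `for x := 0, …, n - 1`, where the registers `1` and `2` hold `n` and `1`. -/
def forLoop (x : ℕ) (P : RAMProgram) : RAMProgram :=
  .seq (.const x 0) (.loop x 1 (.seq P (.add x x 2)))

end RAMProgram

theorem RAMState.setReg_reg_self (s : RAMState) (x v : ℕ) : (s.setReg x v).reg x = v := by
  simp [RAMState.setReg]

theorem RAMState.setReg_reg_of_ne (s : RAMState) {x y : ℕ} (v : ℕ) (h : y ≠ x) :
    (s.setReg x v).reg y = s.reg y := by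
  simp [RAMState.setReg, h]

theorem RAMState.setReg_mem (s : RAMState) (x v : ℕ) : (s.setReg x v).mem = s.mem := rfl

theorem RAMState.setMem_reg (s : RAMState) (a v : ℕ) : (s.setMem a v).reg = s.reg := rfl

theorem RAMState.setMem_mem (s : RAMState) (a v b : ℕ) :
    (s.setMem a v).mem b = if b = a then v else s.mem b := by
  simp [RAMState.setMem, Function.update_apply]

/-- The counter is tracked separately: `hI` makes the invariant insensitive to register `x`, and the
body must return the counter unchanged. -/
theorem RAMProgram.Runs.forLoop {P : RAMProgram} {s : RAMState} {B n x : ℕ}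
    {Q : RAMState → Prop} (I : ℕ → RAMState → Prop)
    (hN : ∀ k s, I k s → s.reg 1 = n ∧ s.reg 2 = 1)
    (hI : ∀ k s v, I k s → I k (s.setReg x v))
    (body : ∀ k < n, ∀ s, I k s → s.reg x = k → P.Runs s B fun s' => I (k + 1) s' ∧ s'.reg x = k)
    (h0 : I 0 s) (hQ : ∀ s, I n s → Q s) :
    (RAMProgram.forLoop x P).Runs s (n * (B + 2) + 2) Q := by
  have key : (RAMProgram.forLoop x P).Runs s (1 + (n * (B + 1 + 1) + 1)) Q := by
    refine .seq (.const (.loop (fun k s => ∃ i, i + k = n ∧ I i s ∧ s.reg x = i) ?_ ?_))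
    · rintro k s ⟨i, hik, hIs, hxi⟩
      obtain ⟨hn, h1⟩ := hN _ _ hIs
      by_cases hin : i < n
      · left
        refine ⟨by omega, .seq ((body i hin s hIs hxi).mono le_rfl ?_)⟩
        rintro s' ⟨h2, h3⟩
        obtain ⟨hn', h1'⟩ := hN _ _ h2
        refine .add ⟨k - 1, by omega, i + 1, by omega, hI _ _ _ h2, ?_⟩
        rw [RAMState.setReg_reg_self, h3, h1']
      · right
        refine ⟨by omega, hQ _ ?_⟩
        rwa [show i = n by omega] at hIs
    · exact ⟨0, by simp, hI _ _ _ h0, RAMState.setReg_reg_self _ _ _⟩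
  exact key.mono (by ring_nf; omega) fun _ h => h

/-! ### Tables -/

/-- The address of the entry `(i, j)` of the table `t`. -/
def tableAddr (n t i j : ℕ) : ℕ := 2 + t * (n * n) + i * n + j

theorem mul_add_inj {n a a' j j' : ℕ} (hj : j < n) (hj' : j' < n) (h : a * n + j = a' * n + j') :
    a = a' ∧ j = j' := by
  have h1 : (a * n + j) / n = a := by
    rw [mul_comm, Nat.mul_add_div (by omega), Nat.div_eq_of_lt hj, add_zero]
  have h2 : (a' * n + j') / n = a' := by
    rw [mul_comm, Nat.mul_add_div (by omega), Nat.div_eq_of_lt hj', add_zero]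
  have : a = a' := by rw [← h1, h, h2]
  subst this
  exact ⟨rfl, by omega⟩

theorem tableAddr_inj {n t t' : ℕ} {i j i' j' : Fin n}
    (h : tableAddr n t i j = tableAddr n t' i' j') : t = t' ∧ i = i' ∧ j = j' := by
  unfold tableAddr at h
  have h1 : (t * n + i) * n + j = (t' * n + i') * n + j' := by
    have e1 : (t * n + i) * n + j = t * (n * n) + i * n + j := by ring
    have e2 : (t' * n + i') * n + j' = t' * (n * n) + i' * n + j' := by ring
    omega
  obtain ⟨h2, h3⟩ := mul_add_inj j.2 j'.2 h1
  obtain ⟨h4, h5⟩ := mul_add_inj i.2 i'.2 h2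
  exact ⟨h4, Fin.ext h5, Fin.ext h3⟩

theorem tableAddr_lt {n t K : ℕ} (h : t < K) (i j : Fin n) :
    tableAddr n t i j < 2 + K * (n * n) := by
  unfold tableAddr
  have h1 : (t + 1) * (n * n) ≤ K * (n * n) := Nat.mul_le_mul_right _ h
  have h2 : (i + 1) * n ≤ n * n := Nat.mul_le_mul_right _ i.2
  have h3 := j.2
  rw [Nat.add_mul] at h1 h2
  omega

/-- The registers `5`, `6`, `7` are used for intermediate results. -/
def IsTemp (x : ℕ) : Prop := x = 5 ∨ x = 6 ∨ x = 7

/-- The states agree except for the intermediate results and the registers from `m` on. -/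
def RegAgree (m : ℕ) (s s' : RAMState) : Prop := ∀ x < m, ¬ IsTemp x → s'.reg x = s.reg x

theorem RegAgree.refl (m : ℕ) (s : RAMState) : RegAgree m s s := fun _ _ _ => rfl

theorem RegAgree.trans {m : ℕ} {s s' s'' : RAMState} (h : RegAgree m s s') (h' : RegAgree m s' s'') :
    RegAgree m s s'' := fun x hx hx' => (h' x hx hx').trans (h x hx hx')

theorem RegAgree.mono {m m' : ℕ} {s s' : RAMState} (h : RegAgree m s s') (hm : m' ≤ m) :
    RegAgree m' s s' := fun x hx => h x (hx.trans_le hm)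

theorem RegAgree.setReg_temp {m x v : ℕ} {s s' : RAMState} (h : RegAgree m s s') (hx : IsTemp x) :
    RegAgree m s (s'.setReg x v) := fun y hy hy' => by
  have hne : y ≠ x := by
    rintro rfl
    exact hy' hx
  rw [RAMState.setReg_reg_of_ne _ _ hne, h y hy hy']

theorem RegAgree.setReg_ge {m x v : ℕ} {s s' : RAMState} (h : RegAgree m s s') (hx : m ≤ x) :
    RegAgree m s (s'.setReg x v) := fun y hy hy' => by
  rw [RAMState.setReg_reg_of_ne _ _ (by omega), h y hy hy']

/-- The state holds the tables `tabs t`, `t < K`, and the values of the variables `x < d`. -/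
structure Good {n : ℕ} (K : ℕ) (tabs : ℕ → Fin n → Fin n → Prop) (d : ℕ) (env : ℕ → Fin n)
    (s : RAMState) : Prop where
  size : s.reg 1 = n
  one : s.reg 2 = 1
  zero : s.reg 3 = 0
  sq : s.reg 4 = n * n
  vars : ∀ x < d, s.reg (20 + x) = env x
  tables : ∀ t < K, ∀ i j : Fin n, s.mem (tableAddr n t i j) ≠ 0 ↔ tabs t i j

theorem not_isTemp_of_le {x : ℕ} (h : 8 ≤ x) : ¬ IsTemp x := by
  unfold IsTemp
  omega

theorem not_isTemp_of_lt {x : ℕ} (h : x < 5) : ¬ IsTemp x := by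
  unfold IsTemp
  omega

section

variable {n K d : ℕ} {tabs : ℕ → Fin n → Fin n → Prop} {env : ℕ → Fin n} {s s' : RAMState}

theorem Good.of_agree (h : Good K tabs d env s) (hr : RegAgree (20 + d) s s')
    (hm : ∀ t < K, ∀ i j : Fin n, s'.mem (tableAddr n t i j) = s.mem (tableAddr n t i j)) :
    Good K tabs d env s' where
  size := by rw [hr 1 (by omega) (not_isTemp_of_lt (by omega)), h.size]
  one := by rw [hr 2 (by omega) (not_isTemp_of_lt (by omega)), h.one]
  zero := by rw [hr 3 (by omega) (not_isTemp_of_lt (by omega)), h.zero]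
  sq := by rw [hr 4 (by omega) (not_isTemp_of_lt (by omega)), h.sq]
  vars x hx := by rw [hr (20 + x) (by omega) (not_isTemp_of_le (by omega)), h.vars x hx]
  tables t ht i j := by rw [hm t ht i j, h.tables t ht i j]

theorem Good.of_mem_eq (h : Good K tabs d env s) (hr : RegAgree (20 + d) s s')
    (hm : s'.mem = s.mem) : Good K tabs d env s' := h.of_agree hr fun t _ i j => by rw [hm]

theorem Good.push (h : Good K tabs d env s) {v : Fin n} (hv : s.reg (20 + d) = v) :
    Good K tabs (d + 1) (Function.update env d v) s where
  size := h.size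
  one := h.one
  zero := h.zero
  sq := h.sq
  vars x hx := by
    by_cases hxd : x = d
    · subst hxd
      simpa using hv
    · rw [Function.update_of_ne hxd]
      exact h.vars x (by omega)
  tables := h.tables

end

open RAMProgram

/-- Add `t` times the content of register `4` to register `6`. -/
def addTables : ℕ → RAMProgram
  | 0 => .const 7 0
  | t + 1 => .seq (addTables t) (.add 6 6 4)

/-- Compute the address of an entry of the table `t` in register `6`, for the indices in the
registers `x` and `y`. -/
def addrCode (t x y : ℕ) : RAMProgram :=
  .seq (.const 6 2) (.seq (addTables t) (.seq (.const 7 0)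
    (.seq (.loop 7 x (.seq (.add 6 6 1) (.add 7 7 2))) (.add 6 6 y))))

theorem addTables_runs {s : RAMState} {Q : RAMState → Prop} (t : ℕ)
    (hQ : ∀ s', (∀ x, x ≠ 6 → x ≠ 7 → s'.reg x = s.reg x) → s'.mem = s.mem →
      s'.reg 6 = s.reg 6 + t * s.reg 4 → Q s') : (addTables t).Runs s (t + 1) Q := by
  induction t generalizing Q with
  | zero =>
    refine .const (hQ _ (fun x _ h7 => ?_) rfl ?_)
    · exact RAMState.setReg_reg_of_ne _ _ h7
    · rw [RAMState.setReg_reg_of_ne _ _ (by omega)]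
      simp
  | succ t ih =>
    refine .seq (ih fun s' h1 h2 h3 => .add (hQ _ (fun x h6 h7 => ?_) h2 ?_))
    · rw [RAMState.setReg_reg_of_ne _ _ h6, h1 x h6 h7]
    · rw [RAMState.setReg_reg_self, h3, h1 4 (by omega) (by omega)]
      ring

/-- Multiplication is not an instruction. The row offset is obtained by adding `n` as often as the
row index says, which explains the bound `3 * n`. -/
theorem addrCode_runs {n t x y : ℕ} {s : RAMState} {Q : RAMState → Prop} (hx : 8 ≤ x) (hy : 8 ≤ y)
    (h1 : s.reg 1 = n) (h2 : s.reg 2 = 1) (h4 : s.reg 4 = n * n) (hxn : s.reg x < n)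
    (hQ : ∀ s', (∀ z, z ≠ 6 → z ≠ 7 → s'.reg z = s.reg z) → s'.mem = s.mem →
      s'.reg 6 = tableAddr n t (s.reg x) (s.reg y) → Q s') :
    (addrCode t x y).Runs s (3 * n + t + 6) Q := by
  have key : (addrCode t x y).Runs s (1 + ((t + 1) + (1 + ((s.reg x * ((1 + 1) + 1) + 1) + 1)))) Q := by
    refine .seq (.const (.seq (addTables_runs t fun s₁ k1 k2 k3 => .seq (.const ?_))))
    have k1' : ∀ z, z ≠ 6 → z ≠ 7 → s₁.reg z = s.reg z := fun z hz hz' => by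
      rw [k1 z hz hz', RAMState.setReg_reg_of_ne _ _ hz]
    have k3' : s₁.reg 6 = 2 + t * (n * n) := by
      rw [k3, RAMState.setReg_reg_self, RAMState.setReg_reg_of_ne _ _ (by omega), h4]
    refine .seq (.loop (fun k s' => ∃ i, i + k = s.reg x ∧ s'.reg 7 = i ∧
      s'.reg 6 = 2 + t * (n * n) + i * n ∧ (∀ z, z ≠ 6 → z ≠ 7 → s'.reg z = s.reg z) ∧
      s'.mem = s.mem) ?_ ?_)
    · rintro k s' ⟨i, hik, h7, h6, hr, hm⟩
      have hx' := hr x (by omega) (by omega)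
      by_cases hi : i < s.reg x
      · refine Or.inl ⟨by omega, .seq (.add (.add ⟨k - 1, by omega, i + 1, by omega, ?_, ?_, ?_, hm⟩))⟩
        · rw [RAMState.setReg_reg_self, RAMState.setReg_reg_of_ne _ _ (by omega),
            RAMState.setReg_reg_of_ne _ _ (by omega), h7, hr 2 (by omega) (by omega), h2]
        · rw [RAMState.setReg_reg_of_ne _ _ (by omega), RAMState.setReg_reg_self, h6,
            hr 1 (by omega) (by omega), h1]
          ring
        · intro z hz hz'
          rw [RAMState.setReg_reg_of_ne _ _ hz', RAMState.setReg_reg_of_ne _ _ hz, hr z hz hz']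
      · refine Or.inr ⟨by omega, .add (hQ _ ?_ hm ?_)⟩
        · intro z hz hz'
          rw [RAMState.setReg_reg_of_ne _ _ hz, hr z hz hz']
        · rw [RAMState.setReg_reg_self, h6, hr y (by omega) (by omega), show i = s.reg x by omega]
          rfl
    · refine ⟨0, by simp, RAMState.setReg_reg_self _ _ _, ?_, ?_, k2⟩
      · rw [RAMState.setReg_reg_of_ne _ _ (by omega), k3']
        simp
      · intro z hz hz'
        rw [RAMState.setReg_reg_of_ne _ _ hz', k1' z hz hz']
  exact key.mono (by omega) fun _ h => h

/-! ### First-order formulas over tables -/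

/-- First-order formulas; the quantifier at depth `d` binds the variable `d`. -/
inductive Fml
  | eq (x y : ℕ)
  | lt (x y : ℕ)
  | tab (t x y : ℕ)
  | neg (φ : Fml)
  | and (φ ψ : Fml)
  | ex (φ : Fml)

namespace Fml

def Holds {n : ℕ} (tabs : ℕ → Fin n → Fin n → Prop) : Fml → ℕ → (ℕ → Fin n) → Prop
  | eq x y, _, env => env x = env y
  | lt x y, _, env => env x < env y
  | tab t x y, _, env => tabs t (env x) (env y)
  | neg φ, d, env => ¬ φ.Holds tabs d env
  | and φ ψ, d, env => φ.Holds tabs d env ∧ ψ.Holds tabs d env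
  | ex φ, d, env => ∃ v, φ.Holds tabs (d + 1) (Function.update env d v)

/-- All variables are below the depth and all tables below `K`. -/
def Wf (K : ℕ) : Fml → ℕ → Prop
  | eq x y, d => x < d ∧ y < d
  | lt x y, d => x < d ∧ y < d
  | tab t x y, d => t < K ∧ x < d ∧ y < d
  | neg φ, d => φ.Wf K d
  | and φ ψ, d => φ.Wf K d ∧ ψ.Wf K d
  | ex φ, d => φ.Wf K (d + 1)

instance decidableWf (K : ℕ) : ∀ (φ : Fml) (d : ℕ), Decidable (φ.Wf K d)
  | eq x y, d => inferInstanceAs (Decidable (x < d ∧ y < d))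
  | lt x y, d => inferInstanceAs (Decidable (x < d ∧ y < d))
  | tab t x y, d => inferInstanceAs (Decidable (t < K ∧ x < d ∧ y < d))
  | neg φ, d => decidableWf K φ d
  | and φ ψ, d =>
    letI := decidableWf K φ d
    letI := decidableWf K ψ d
    inferInstanceAs (Decidable (φ.Wf K d ∧ ψ.Wf K d))
  | ex φ, d => decidableWf K φ (d + 1)

/-- A program evaluating the formula into register `5`. -/
def code : Fml → ℕ → RAMProgram
  | eq x y, _ => .ite (20 + x) (20 + y) (.const 5 0)
      (.ite (20 + y) (20 + x) (.const 5 0) (.const 5 1))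
  | lt x y, _ => .ite (20 + x) (20 + y) (.const 5 1) (.const 5 0)
  | tab t x y, _ => .seq (addrCode t (20 + x) (20 + y))
      (.seq (.load 5 6) (.ite 3 5 (.const 5 1) (.const 5 0)))
  | neg φ, d => .seq (φ.code d) (.sub 5 2 5)
  | and φ ψ, d => .seq (φ.code d) (.ite 3 5 (ψ.code d) (.const 5 0))
  -- Once a witness is found, the counter is set to `n + 0` from registers `1` and `3`. This ends
  -- the loop with the truth value 1 still in register `5`.
  | ex φ, d => .seq (.const (20 + d) 0) (.seq (.const 5 0) (.loop (20 + d) 1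
      (.seq (φ.code (d + 1)) (.ite 3 5 (.add (20 + d) 1 3) (.add (20 + d) (20 + d) 2)))))

/-- A bound for the running time. -/
noncomputable def time : Fml → Polynomial ℕ
  | eq _ _ => 3
  | lt _ _ => 2
  | tab t _ _ => 3 * Polynomial.X + (t : Polynomial ℕ) + 9
  | neg φ => φ.time + 1
  | and φ ψ => φ.time + ψ.time + 2
  | ex φ => Polynomial.X * (φ.time + 3) + 3

/-- Register `5` holds the truth value of `p`. -/
def IsTruth (s : RAMState) (p : Prop) : Prop := (p ∧ s.reg 5 = 1) ∨ (¬ p ∧ s.reg 5 = 0)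

theorem code_runs {n K : ℕ} {tabs : ℕ → Fin n → Fin n → Prop} (φ : Fml) {d : ℕ} (hφ : φ.Wf K d)
    {env : ℕ → Fin n} {s : RAMState} (h : Good K tabs d env s) {Q : RAMState → Prop}
    (hQ : ∀ s', RegAgree (20 + d) s s' → s'.mem = s.mem → IsTruth s' (φ.Holds tabs d env) → Q s') :
    (φ.code d).Runs s (φ.time.eval n) Q := by
  have t5 : IsTemp 5 := Or.inl rfl
  induction φ generalizing d env s Q with
  | eq x y =>
    have hx := h.vars x hφ.1
    have hy := h.vars y hφ.2
    have hB : ((Fml.eq x y).time).eval n = 1 + 1 + 1 := by simp [time]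
    rw [hB]
    refine .ite (fun hlt => ?_) fun hlt => .ite (fun hlt' => ?_) fun hlt' => ?_
    · refine Runs.mono (.const (hQ _ ((RegAgree.refl _ _).setReg_temp t5) rfl (Or.inr ⟨?_, ?_⟩)))
        (Nat.le_add_left 1 1) fun _ h => h
      · intro (he : env x = env y)
        rw [hx, hy, he] at hlt
        exact lt_irrefl _ hlt
      · exact RAMState.setReg_reg_self _ _ _
    · refine .const (hQ _ ((RegAgree.refl _ _).setReg_temp t5) rfl (Or.inr ⟨?_, ?_⟩))
      · intro (he : env x = env y)
        rw [hx, hy, he] at hlt'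
        exact lt_irrefl _ hlt'
      · exact RAMState.setReg_reg_self _ _ _
    · refine .const (hQ _ ((RegAgree.refl _ _).setReg_temp t5) rfl (Or.inl ⟨?_, ?_⟩))
      · change env x = env y
        apply Fin.ext
        omega
      · exact RAMState.setReg_reg_self _ _ _
  | lt x y =>
    have hx := h.vars x hφ.1
    have hy := h.vars y hφ.2
    have hB : ((Fml.lt x y).time).eval n = 1 + 1 := by simp [time]
    rw [hB]
    refine .ite (fun hlt => ?_) fun hlt => ?_
    · refine .const (hQ _ ((RegAgree.refl _ _).setReg_temp t5) rfl (Or.inl ⟨?_, ?_⟩))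
      · change env x < env y
        rw [Fin.lt_def]
        omega
      · exact RAMState.setReg_reg_self _ _ _
    · refine .const (hQ _ ((RegAgree.refl _ _).setReg_temp t5) rfl (Or.inr ⟨?_, ?_⟩))
      · intro (he : env x < env y)
        rw [Fin.lt_def] at he
        omega
      · exact RAMState.setReg_reg_self _ _ _
  | tab t x y =>
    obtain ⟨ht, hxd, hyd⟩ := hφ
    have hx := h.vars x hxd
    have hy := h.vars y hyd
    have hB : ((Fml.tab t x y).time).eval n = (3 * n + t + 6) + (1 + (1 + 1)) := by
      simp [time]
    rw [hB]
    refine .seq (addrCode_runs (by omega) (by omega) h.size h.one h.sq (by rw [hx]; exact (env x).2)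
      fun s₁ k1 k2 k3 => .seq (.load ?_))
    rw [hx, hy] at k3
    have hv := h.tables t ht (env x) (env y)
    rw [k3, k2]
    have hr : RegAgree (20 + d) s (s₁.setReg 5 (s.mem (tableAddr n t (env x) (env y)))) :=
      RegAgree.setReg_temp (fun z _ hz => k1 z (fun e => hz (e ▸ Or.inr (Or.inl rfl)))
        fun e => hz (e ▸ Or.inr (Or.inr rfl))) t5
    have h0 : (s₁.setReg 5 (s.mem (tableAddr n t (env x) (env y)))).reg 3 = 0 := by
      rw [hr 3 (by omega) (not_isTemp_of_lt (by omega)), h.zero]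
    have h5 := RAMState.setReg_reg_self s₁ 5 (s.mem (tableAddr n t (env x) (env y)))
    refine .ite (fun hlt => ?_) fun hlt => ?_
    · refine .const (hQ _ (hr.setReg_temp t5) k2 (Or.inl ⟨?_, RAMState.setReg_reg_self _ _ _⟩))
      refine hv.1 ?_
      omega
    · refine .const (hQ _ (hr.setReg_temp t5) k2 (Or.inr ⟨?_, RAMState.setReg_reg_self _ _ _⟩))
      intro he
      have := hv.2 he
      omega
  | neg φ ih =>
    have hB : ((Fml.neg φ).time).eval n = φ.time.eval n + 1 := by simp [time]
    rw [hB]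
    refine .seq (ih hφ h fun s₁ k1 k2 k3 => .sub (hQ _ (k1.setReg_temp t5) k2 ?_))
    have h1 : s₁.reg 2 = 1 := (h.of_mem_eq k1 k2).one
    rcases k3 with ⟨k3, k4⟩ | ⟨k3, k4⟩
    · refine Or.inr ⟨not_not.2 k3, ?_⟩
      rw [RAMState.setReg_reg_self, h1, k4]
    · refine Or.inl ⟨k3, ?_⟩
      rw [RAMState.setReg_reg_self, h1, k4]
  | and φ ψ ihφ ihψ =>
    have hB : ((Fml.and φ ψ).time).eval n = φ.time.eval n + ((ψ.time.eval n + 1) + 1) := by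
      simp [time]
      ring
    rw [hB]
    refine .seq (ihφ hφ.1 h fun s₁ k1 k2 k3 => ?_)
    have h1 := h.of_mem_eq k1 k2
    refine .ite (fun hlt => ?_) fun hlt => ?_
    · refine Runs.mono (ihψ hφ.2 h1 fun s₂ m1 m2 m3 => hQ _ (k1.trans m1) (m2.trans k2) ?_)
        (Nat.le_succ _) fun _ h => h
      rcases k3 with ⟨k3, k4⟩ | ⟨k3, k4⟩
      · rcases m3 with ⟨m3, m4⟩ | ⟨m3, m4⟩
        · exact Or.inl ⟨⟨k3, m3⟩, m4⟩
        · exact Or.inr ⟨fun h => m3 h.2, m4⟩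
      · omega
    · refine Runs.mono (.const (hQ _ (k1.setReg_temp t5) k2 (Or.inr ⟨?_,
        RAMState.setReg_reg_self _ _ _⟩))) (Nat.le_add_left _ _) fun _ h => h
      rcases k3 with ⟨k3, k4⟩ | ⟨k3, k4⟩
      · have := h1.zero
        omega
      · exact fun h => k3 h.1
  | ex φ ih =>
    have hB : ((Fml.ex φ).time).eval n = 1 + (1 + (n * ((φ.time.eval n + (1 + 1)) + 1) + 1)) := by
      simp [time]
      ring
    rw [hB]
    refine .seq (.const (.seq (.const (.loop (fun k s' => ∃ i, i + k = n ∧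
      RegAgree (20 + d) s s' ∧ s'.mem = s.mem ∧ s'.reg (20 + d) = i ∧
      ((s'.reg 5 = 0 ∧ ∀ v : Fin n, v < i → ¬ φ.Holds tabs (d + 1) (Function.update env d v)) ∨
       (i = n ∧ s'.reg 5 = 1 ∧ ∃ v, φ.Holds tabs (d + 1) (Function.update env d v)))) ?_ ?_))))
    · rintro k s' ⟨i, hik, hr, hm, hreg, hor⟩
      have hg := h.of_mem_eq hr hm
      by_cases hi : i < n
      · left
        refine ⟨by rw [hreg, hg.size]; exact hi, .seq ?_⟩
        refine ih (env := Function.update env d ⟨i, hi⟩) hφ (hg.push (v := ⟨i, hi⟩) hreg)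
          fun s₁ k1 k2 k3 => ?_
        have hr₁ : RegAgree (20 + d) s s₁ := hr.trans (k1.mono (by omega))
        have hg₁ := h.of_mem_eq hr₁ (k2.trans hm)
        have hreg₁ : s₁.reg (20 + d) = i := by
          rw [k1 (20 + d) (by omega) (not_isTemp_of_le (by omega)), hreg]
        rcases hor with ⟨h5, hnone⟩ | ⟨hin, -⟩
        · refine .ite (fun hlt => ?_) fun hlt => ?_
          · rcases k3 with ⟨k3, k4⟩ | ⟨k3, k4⟩
            · refine .add ⟨0, by omega, n, by omega, hr₁.setReg_ge le_rfl, k2.trans hm, ?_,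
                Or.inr ⟨rfl, ?_, _, k3⟩⟩
              · rw [RAMState.setReg_reg_self, hg₁.size, hg₁.zero, add_zero]
              · rw [RAMState.setReg_reg_of_ne _ _ (by omega), k4]
            · omega
          · rcases k3 with ⟨k3, k4⟩ | ⟨k3, k4⟩
            · have := hg₁.zero
              omega
            · refine .add ⟨k - 1, by omega, i + 1, by omega, hr₁.setReg_ge le_rfl, k2.trans hm, ?_,
                Or.inl ⟨?_, ?_⟩⟩
              · rw [RAMState.setReg_reg_self, hreg₁, hg₁.one]
              · rw [RAMState.setReg_reg_of_ne _ _ (by omega), k4]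
              · intro v hv
                by_cases hvi : (v : ℕ) = i
                · have : v = ⟨i, hi⟩ := Fin.ext hvi
                  rw [this]
                  exact k3
                · exact hnone v (by omega)
        · omega
      · right
        refine ⟨by rw [hreg, hg.size]; exact hi, hQ _ hr hm ?_⟩
        rcases hor with ⟨h5, hnone⟩ | ⟨-, h5, hex⟩
        · refine Or.inr ⟨?_, h5⟩
          rintro ⟨v, hv⟩
          exact hnone v (by omega) hv
        · exact Or.inl ⟨hex, h5⟩
    · refine ⟨0, by simp, ((RegAgree.refl _ _).setReg_ge le_rfl).setReg_temp t5, rfl, ?_,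
        Or.inl ⟨RAMState.setReg_reg_self _ _ _, fun v hv => by omega⟩⟩
      rw [RAMState.setReg_reg_of_ne _ _ (by omega), RAMState.setReg_reg_self]

end Fml

/-! ### Filling tables -/

/-- The states agree outside the table `t` and the working registers. -/
def AgreeOutside (n t : ℕ) (s s' : RAMState) : Prop :=
  RegAgree 21 s s' ∧ ∀ a, (∀ i j : Fin n, a ≠ tableAddr n t i j) → s'.mem a = s.mem a

theorem AgreeOutside.refl (n t : ℕ) (s : RAMState) : AgreeOutside n t s s :=
  ⟨RegAgree.refl _ _, fun _ _ => rfl⟩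

/-- Fill the table `t` with the values which `P` computes in register `5` for the indices in the
registers `21` and `22`. -/
def fillCode (t : ℕ) (P : RAMProgram) : RAMProgram :=
  forLoop 21 (forLoop 22 (.seq P (.seq (addrCode t 21 22) (.store 6 5))))

/-- `P` is run on states in which table `t` is already partly overwritten, so it must compute `f`
without relying on that table. -/
theorem fillCode_runs {n t B : ℕ} {P : RAMProgram} {s : RAMState} (f : Fin n → Fin n → ℕ)
    (h1 : s.reg 1 = n) (h2 : s.reg 2 = 1) (h4 : s.reg 4 = n * n)
    (hP : ∀ s' (i j : Fin n), AgreeOutside n t s s' → s'.reg 21 = i → s'.reg 22 = j →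
      P.Runs s' B fun s'' => RegAgree 23 s' s'' ∧ s''.mem = s'.mem ∧ s''.reg 5 = f i j)
    {Q : RAMState → Prop} (hQ : ∀ s', AgreeOutside n t s s' →
      (∀ i j : Fin n, s'.mem (tableAddr n t i j) = f i j) → Q s') :
    (fillCode t P).Runs s (n * (n * (B + (3 * n + t + 6 + 1) + 2) + 2 + 2) + 2) Q := by
  have hreg : ∀ s', AgreeOutside n t s s' → s'.reg 1 = n ∧ s'.reg 2 = 1 ∧ s'.reg 4 = n * n :=
    fun s' h => ⟨by rw [h.1 1 (by omega) (not_isTemp_of_lt (by omega)), h1],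
      by rw [h.1 2 (by omega) (not_isTemp_of_lt (by omega)), h2],
      by rw [h.1 4 (by omega) (not_isTemp_of_lt (by omega)), h4]⟩
  refine .forLoop (fun k s' => AgreeOutside n t s s' ∧
    ∀ i j : Fin n, (i : ℕ) < k → s'.mem (tableAddr n t i j) = f i j) ?_ ?_ ?_ ?_ ?_
  · exact fun k s' h => ⟨(hreg s' h.1).1, (hreg s' h.1).2.1⟩
  · exact fun k s' v h => ⟨⟨h.1.1.setReg_ge le_rfl, h.1.2⟩, h.2⟩
  · intro k hk s₁ hs₁ h21
    refine .forLoop (fun l s' => AgreeOutside n t s s' ∧ s'.reg 21 = k ∧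
      (∀ i j : Fin n, (i : ℕ) < k → s'.mem (tableAddr n t i j) = f i j) ∧
      ∀ j : Fin n, (j : ℕ) < l → s'.mem (tableAddr n t k j) = f ⟨k, hk⟩ j) ?_ ?_ ?_ ?_ ?_
    · exact fun k s' h => ⟨(hreg s' h.1).1, (hreg s' h.1).2.1⟩
    · refine fun k s' v h => ⟨⟨h.1.1.setReg_ge (by omega), h.1.2⟩, ?_, h.2.2⟩
      rw [RAMState.setReg_reg_of_ne _ _ (by omega), h.2.1]
    · rintro l hl s₂ ⟨ha, hk', hrows, hrow⟩ h22
      refine .seq ((hP s₂ ⟨k, hk⟩ ⟨l, hl⟩ ha hk' h22).mono le_rfl ?_)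
      rintro s₃ ⟨m1, m2, m3⟩
      have ha₃ : AgreeOutside n t s s₃ := ⟨ha.1.trans (m1.mono (by omega)), by rw [m2]; exact ha.2⟩
      have k21 : s₃.reg 21 = k := by rw [m1 21 (by omega) (not_isTemp_of_le (by omega)), hk']
      have k22 : s₃.reg 22 = l := by rw [m1 22 (by omega) (not_isTemp_of_le (by omega)), h22]
      obtain ⟨r1, r2, r4⟩ := hreg s₃ ha₃
      refine .seq (addrCode_runs (by omega) (by omega) r1 r2 r4 (by omega) fun s₄ q1 q2 q3 =>
        .store ?_)
      rw [k21, k22] at q3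
      rw [q3, q1 5 (by omega) (by omega), m3]
      have hq : RegAgree 23 s₃ s₄ := fun z _ hz => q1 z (fun e => hz (e ▸ Or.inr (Or.inl rfl)))
        fun e => hz (e ▸ Or.inr (Or.inr rfl))
      refine ⟨⟨⟨ha₃.1.trans (hq.mono (by omega)), ?_⟩, ?_, ?_, ?_⟩, ?_⟩
      · intro a hne
        rw [RAMState.setMem_mem, if_neg (hne ⟨k, hk⟩ ⟨l, hl⟩), q2]
        exact ha₃.2 a hne
      · rw [RAMState.setMem_reg, q1 21 (by omega) (by omega), k21]
      · intro i j hi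
        rw [RAMState.setMem_mem, if_neg, q2, m2, hrows i j hi]
        intro he
        have := (tableAddr_inj (i' := ⟨k, hk⟩) (j' := ⟨l, hl⟩) he).2.1
        rw [this] at hi
        exact lt_irrefl _ hi
      · intro j hj
        rw [RAMState.setMem_mem]
        split_ifs with he
        · have := (tableAddr_inj (i := ⟨k, hk⟩) (i' := ⟨k, hk⟩) (j' := ⟨l, hl⟩) he).2.2
          rw [this]
        · rw [q2, m2, hrow j]
          have : (j : ℕ) ≠ l := by
            intro h
            rw [h] at he
            exact he rfl
          omega
      · rw [RAMState.setMem_reg, q1 22 (by omega) (by omega), k22]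
    · exact ⟨hs₁.1, h21, hs₁.2, fun j hj => by omega⟩
    · rintro s₂ ⟨ha, hk', hrows, hrow⟩
      refine ⟨⟨ha, fun i j hi => ?_⟩, hk'⟩
      by_cases hik : (i : ℕ) = k
      · have : i = ⟨k, hk⟩ := Fin.ext hik
        rw [this]
        exact hrow j j.2
      · exact hrows i j (by omega)
  · exact ⟨.refl _ _ _, fun i j hi => by omega⟩
  · exact fun s' h => hQ s' h.1 fun i j => h.2 i j i.2

/-- Replace the table `t` by the relation defined by `φ` in the variables `1` and `2`. The table
`K` is used for intermediate storage. -/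
def setCode (K t : ℕ) (φ : Fml) : RAMProgram :=
  -- The formula may read the old table `t`, as the rounds of a reachability computation do. Hence
  -- the new values go to table `K` first and are copied afterwards.
  .seq (fillCode K (φ.code 3)) (fillCode t (.seq (addrCode K 21 22) (.load 5 6)))

/-- The relation defined by `φ` in the variables `1` and `2`. -/
def Fml.rel {n : ℕ} (φ : Fml) (tabs : ℕ → Fin n → Fin n → Prop) (env : ℕ → Fin n)
    (i j : Fin n) : Prop :=
  φ.Holds tabs 3 (Function.update (Function.update env 1 i) 2 j)

/-- A bound for the running time. -/
noncomputable def setTime (K t : ℕ) (φ : Fml) : Polynomial ℕ :=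
  (.X * (.X * (φ.time + (3 * .X + (K : Polynomial ℕ) + 6 + 1) + 2) + 2 + 2) + 2) +
  (.X * (.X * ((3 * .X + (K : Polynomial ℕ) + 6 + 1) + (3 * .X + (t : Polynomial ℕ) + 6 + 1) + 2)
    + 2 + 2) + 2)

theorem setCode_runs {n K t : ℕ} {tabs : ℕ → Fin n → Fin n → Prop} {φ : Fml} (ht : t < K)
    (hφ : φ.Wf K 3) {env : ℕ → Fin n} {s : RAMState} (h : Good K tabs 1 env s)
    {Q : RAMState → Prop} (hQ : ∀ s', RegAgree 21 s s' →
      Good K (Function.update tabs t (φ.rel tabs env)) 1 env s' → Q s') :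
    (setCode K t φ).Runs s ((setTime K t φ).eval n) Q := by
  classical
  have hB : (setTime K t φ).eval n =
      (n * (n * (φ.time.eval n + (3 * n + K + 6 + 1) + 2) + 2 + 2) + 2) +
      (n * (n * ((3 * n + K + 6 + 1) + (3 * n + t + 6 + 1) + 2) + 2 + 2) + 2) := by
    simp [setTime]
  rw [hB]
  refine .seq (fillCode_runs (fun i j => if φ.rel tabs env i j then 1 else 0) h.size h.one h.sq ?_
    fun s₁ ha₁ hf₁ => ?_)
  · intro s' i j ha hi hj
    have hg : Good K tabs 1 env s' := h.of_agree ha.1 fun t' ht' i' j' =>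
      ha.2 _ fun i'' j'' he => by
        have := (tableAddr_inj he).1
        omega
    refine φ.code_runs hφ ((hg.push (v := i) hi).push (v := j) hj) fun s'' k1 k2 k3 => ⟨k1, k2, ?_⟩
    rcases k3 with ⟨k3, k4⟩ | ⟨k3, k4⟩
    · rw [k4, if_pos]
      exact k3
    · rw [k4, if_neg]
      exact k3
  · have hg₁ : Good K tabs 1 env s₁ := h.of_agree ha₁.1 fun t' ht' i' j' =>
      ha₁.2 _ fun i'' j'' he => by
        have := (tableAddr_inj he).1
        omega
    refine fillCode_runs (fun i j => if φ.rel tabs env i j then 1 else 0) hg₁.size hg₁.one hg₁.sq ?_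
      fun s₂ ha₂ hf₂ => hQ s₂ (ha₁.1.trans ha₂.1) ?_
    · intro s' i j ha hi hj
      have r1 : s'.reg 1 = n := by rw [ha.1 1 (by omega) (not_isTemp_of_lt (by omega)), hg₁.size]
      have r2 : s'.reg 2 = 1 := by rw [ha.1 2 (by omega) (not_isTemp_of_lt (by omega)), hg₁.one]
      have r4 : s'.reg 4 = n * n := by rw [ha.1 4 (by omega) (not_isTemp_of_lt (by omega)), hg₁.sq]
      refine .seq (addrCode_runs (by omega) (by omega) r1 r2 r4 (by rw [hi]; exact i.2)
        fun s₃ q1 q2 q3 => .load ?_)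
      rw [hi, hj] at q3
      refine ⟨RegAgree.setReg_temp (fun z _ hz => q1 z (fun e => hz (e ▸ Or.inr (Or.inl rfl)))
        fun e => hz (e ▸ Or.inr (Or.inr rfl))) (Or.inl rfl), q2, ?_⟩
      rw [RAMState.setReg_reg_self, q3, q2, ha.2, hf₁]
      intro i' j' he
      have := (tableAddr_inj he).1
      omega
    · have hg : ∀ t' < K, t' ≠ t → ∀ i j : Fin n,
          s₂.mem (tableAddr n t' i j) = s₁.mem (tableAddr n t' i j) := fun t' _ hne i j =>
        ha₂.2 _ fun i' j' he => hne (tableAddr_inj he).1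
      have hr := ha₂.1
      refine ⟨?_, ?_, ?_, ?_, ?_, ?_⟩
      · rw [hr 1 (by omega) (not_isTemp_of_lt (by omega)), hg₁.size]
      · rw [hr 2 (by omega) (not_isTemp_of_lt (by omega)), hg₁.one]
      · rw [hr 3 (by omega) (not_isTemp_of_lt (by omega)), hg₁.zero]
      · rw [hr 4 (by omega) (not_isTemp_of_lt (by omega)), hg₁.sq]
      · intro x hx
        rw [hr (20 + x) (by omega) (not_isTemp_of_le (by omega)), hg₁.vars x hx]
      · intro t' ht' i j
        by_cases htt : t' = t
        · subst htt
          rw [hf₂, Function.update_self]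
          split_ifs with hh <;> simp [hh]
        · rw [hg t' ht' htt, Function.update_of_ne htt, hg₁.tables t' ht']

/-! ### Programs defining tables one after the other -/

theorem Fml.Wf.mono {K K' : ℕ} (hK : K ≤ K') {φ : Fml} {d : ℕ} (h : φ.Wf K d) : φ.Wf K' d := by
  induction φ generalizing d with
  | eq | lt => exact h
  | tab => exact ⟨h.1.trans_le hK, h.2⟩
  | neg φ ih => exact ih h
  | and φ ψ ih₁ ih₂ => exact ⟨ih₁ h.1, ih₂ h.2⟩
  | ex φ ih => exact ih h

theorem Fml.holds_congr {n K : ℕ} {tabs tabs' : ℕ → Fin n → Fin n → Prop}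
    (ht : ∀ t < K, tabs' t = tabs t) {φ : Fml} {d : ℕ} (h : φ.Wf K d) (env : ℕ → Fin n) :
    φ.Holds tabs' d env ↔ φ.Holds tabs d env := by
  induction φ generalizing d env with
  | eq | lt => exact Iff.rfl
  | tab t x y =>
    change tabs' t _ _ ↔ tabs t _ _
    rw [ht t h.1]
  | neg φ ih => exact not_congr (ih h env)
  | and φ ψ ih₁ ih₂ => exact and_congr (ih₁ h.1 env) (ih₂ h.2 env)
  | ex φ ih => exact exists_congr fun v => ih h _

/-- Disjunction. -/
abbrev Fml.or (φ ψ : Fml) : Fml := .neg (.and (.neg φ) (.neg ψ))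

/-! ### Reachability by a bounded number of rounds. -/

section Closure

open Relation

variable {α : Type*} (start : α → Prop) (step : α → α → Prop)

/-- The elements reached from `start` by fewer than `k` steps. -/
def reachBefore : ℕ → α → Prop
  | 0, _ => False
  | k + 1, y => start y ∨ ∃ x, reachBefore k x ∧ step x y

variable {start step}

theorem reachBefore_succ {k : ℕ} {y : α} (h : reachBefore start step k y) :
    reachBefore start step (k + 1) y := by
  induction k generalizing y with
  | zero => exact h.elim
  | succ k ih =>
    rcases h with h | ⟨x, hx, hxy⟩
    · exact Or.inl h
    · exact Or.inr ⟨x, ih hx, hxy⟩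

/-- The sets of elements reached form an increasing chain that is constant from the first repetition
on; cardinality forces a repetition within `card α` rounds. -/
theorem reachBefore_card [Fintype α] {k : ℕ} (hk : Fintype.card α ≤ k) (y : α) :
    reachBefore start step k y ↔ ∃ x, start x ∧ ReflTransGen step x y := by
  classical
  have hmono : ∀ k, {y | reachBefore start step k y} ⊆ {y | reachBefore start step (k + 1) y} :=
    fun k y => reachBefore_succ
  have hstab : ∀ m, {y | reachBefore start step m y}.ncard =
      {y | reachBefore start step (m + 1) y}.ncard →
      {y | reachBefore start step m y} = {y | reachBefore start step (m + 1) y} :=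
    fun m h => Set.eq_of_subset_of_ncard_le (hmono m) h.ge
  have hnext : ∀ m, {y | reachBefore start step m y} = {y | reachBefore start step (m + 1) y} →
      {y | reachBefore start step (m + 1) y} = {y | reachBefore start step (m + 2) y} := by
    intro m h
    ext y
    have : ∀ x, reachBefore start step m x ↔ reachBefore start step (m + 1) x :=
      fun x => Set.ext_iff.1 h x
    change (start y ∨ ∃ x, reachBefore start step m x ∧ step x y) ↔
      (start y ∨ ∃ x, reachBefore start step (m + 1) x ∧ step x y)
    simp only [this]
  have hcard : ∀ m, {y | reachBefore start step m y}.ncard ≤ Fintype.card α := fun m => by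
    rw [← Nat.card_eq_fintype_card]
    exact Set.ncard_le_card _
  have hm : Monotone fun m => {y | reachBefore start step m y}.ncard :=
    monotone_nat_of_le_succ fun m => Set.ncard_le_ncard (hmono m)
  have hst : ∀ m, {y | reachBefore start step m y}.ncard =
      {y | reachBefore start step (m + 1) y}.ncard →
      {y | reachBefore start step (m + 1) y}.ncard =
      {y | reachBefore start step (m + 2) y}.ncard := fun m h => by rw [hnext m (hstab m h)]
  have e1 := Nat.stabilises_of_monotone hm hcard hst hk
  have e2 := Nat.stabilises_of_monotone hm hcard hst (hk.trans (Nat.le_succ k))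
  have hfix := hstab k (e1.trans e2.symm)
  constructor
  · clear hfix e1 e2 hk
    intro h
    induction k generalizing y with
    | zero => exact h.elim
    | succ k ih =>
      rcases h with h | ⟨x, hx, hxy⟩
      · exact ⟨y, h, .refl⟩
      · obtain ⟨z, hz, hzx⟩ := ih _ hx
        exact ⟨z, hz, hzx.tail hxy⟩
  · rintro ⟨x, hx, hxy⟩
    have hin : ∀ z, reachBefore start step (k + 1) z → reachBefore start step k z :=
      fun z hz => (Set.ext_iff.1 hfix z).2 hz
    induction hxy with
    | refl => exact hin _ (Or.inl hx)
    | tail _ hab ih => exact hin _ (Or.inr ⟨_, ih, hab⟩)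

end Closure

/-- The definition of a table: by a formula in the variables `1` and `2`, or as the set of pairs
`(i, j)` such that `j` is reached from a point satisfying the first formula by steps from the
variable `3` to the variable `2`, described by the second one. -/
inductive TableDef
  | set (φ : Fml)
  | reach (σ τ : Fml)

namespace TableDef

def Wf (K : ℕ) : TableDef → Prop
  | set φ => φ.Wf K 3
  | reach σ τ => σ.Wf K 3 ∧ τ.Wf K 4

instance decidableWf (K : ℕ) : ∀ o : TableDef, Decidable (o.Wf K)
  | set φ => φ.decidableWf K 3
  | reach σ τ =>
    letI := σ.decidableWf K 3
    letI := τ.decidableWf K 4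
    inferInstanceAs (Decidable (σ.Wf K 3 ∧ τ.Wf K 4))

/-- The relation described by the second formula of `reach`. -/
def stepRel {n : ℕ} (tabs : ℕ → Fin n → Fin n → Prop) (env : ℕ → Fin n) (τ : Fml) (i x y : Fin n) :
    Prop :=
  τ.Holds tabs 4 (Function.update (Function.update (Function.update env 1 i) 2 y) 3 x)

def rel {n : ℕ} (tabs : ℕ → Fin n → Fin n → Prop) (env : ℕ → Fin n) : TableDef →
    Fin n → Fin n → Prop
  | set φ => φ.rel tabs env
  | reach σ τ => fun i j =>
      ∃ x, σ.rel tabs env i x ∧ Relation.ReflTransGen (stepRel tabs env τ i) x j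

theorem rel_congr {n K : ℕ} {tabs tabs' : ℕ → Fin n → Fin n → Prop}
    (ht : ∀ t < K, tabs' t = tabs t) {o : TableDef} (h : o.Wf K) (env : ℕ → Fin n) :
    o.rel tabs' env = o.rel tabs env := by
  cases o with
  | set φ =>
    funext i j
    exact propext (Fml.holds_congr ht h _)
  | reach σ τ =>
    have h2 : stepRel tabs' env τ = stepRel tabs env τ := by
      funext i x y
      exact propext (Fml.holds_congr ht h.2 _)
    funext i j
    simp only [rel, h2]
    exact propext (exists_congr fun x => and_congr_left fun _ => Fml.holds_congr ht h.1 _)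

/-- One round of the computation of the table `t` defined by `reach σ τ`. -/
def roundFml (t : ℕ) (σ τ : Fml) : Fml := σ.or (.ex (.and (.tab t 1 3) τ))

/-- A program filling the table `t`; the table `K` is used for intermediate storage. -/
def code (K t : ℕ) : TableDef → RAMProgram
  | set φ => setCode K t φ
  -- The false formula empties the table, and each of the `n` rounds performs one step of
  -- `reachBefore` in all rows simultaneously.
  | reach σ τ => .seq (setCode K t (.neg (.eq 0 0))) (forLoop 10 (setCode K t (roundFml t σ τ)))

noncomputable def time (K t : ℕ) : TableDef → Polynomial ℕ
  | set φ => setTime K t φ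
  | reach σ τ => setTime K t (.neg (.eq 0 0)) + (.X * (setTime K t (roundFml t σ τ) + 2) + 2)

theorem code_runs {n K t : ℕ} {tabs : ℕ → Fin n → Fin n → Prop} {o : TableDef} (ht : t < K)
    (ho : o.Wf t) {env : ℕ → Fin n} {s : RAMState} (h : Good K tabs 1 env s)
    {Q : RAMState → Prop}
    (hQ : ∀ s', Good K (Function.update tabs t (o.rel tabs env)) 1 env s' → Q s') :
    (o.code K t).Runs s ((o.time K t).eval n) Q := by
  cases o with
  | set φ => exact setCode_runs ht (ho.mono ht.le) h fun s' _ h' => hQ s' h'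
  | reach σ τ =>
    have hB : ((reach σ τ).time K t).eval n = (setTime K t (.neg (.eq 0 0))).eval n +
        (n * ((setTime K t (roundFml t σ τ)).eval n + 2) + 2) := by
      simp [time]
    rw [hB]
    have hwf : (roundFml t σ τ).Wf K 3 :=
      ⟨ho.1.mono ht.le, ⟨ht, by omega, by omega⟩, ho.2.mono ht.le⟩
    refine .seq (setCode_runs (φ := .neg (.eq 0 0)) ht ⟨by omega, by omega⟩ h fun s₁ _ h₁ => ?_)
    refine .forLoop (fun k s' => Good K (Function.update tabs t fun i j =>
      reachBefore (σ.rel tabs env i) (stepRel tabs env τ i) k j) 1 env s') ?_ ?_ ?_ ?_ ?_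
    · exact fun k s' hs => ⟨hs.size, hs.one⟩
    · intro k s' v hs
      refine ⟨?_, ?_, ?_, ?_, ?_, hs.tables⟩
      · rw [RAMState.setReg_reg_of_ne _ _ (by omega), hs.size]
      · rw [RAMState.setReg_reg_of_ne _ _ (by omega), hs.one]
      · rw [RAMState.setReg_reg_of_ne _ _ (by omega), hs.zero]
      · rw [RAMState.setReg_reg_of_ne _ _ (by omega), hs.sq]
      · intro x hx
        rw [RAMState.setReg_reg_of_ne _ _ (by omega), hs.vars x hx]
    · intro k hk s' hs h10
      refine setCode_runs ht hwf hs fun s'' hr hs'' => ⟨?_, ?_⟩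
      · rw [Function.update_idem] at hs''
        convert hs'' using 2
        funext i j
        have htabs : ∀ t' < t, (Function.update tabs t fun i j =>
            reachBefore (σ.rel tabs env i) (stepRel tabs env τ i) k j) t' = tabs t' :=
          fun t' ht' => Function.update_of_ne ht'.ne _ _
        have e1 := Fml.holds_congr htabs ho.1
          (Function.update (Function.update env 1 i) 2 j)
        have e2 := fun x => Fml.holds_congr htabs ho.2
          (Function.update (Function.update (Function.update env 1 i) 2 j) 3 x)
        apply propext
        simp only [Fml.rel, roundFml, Fml.or, Fml.Holds, e1, e2, reachBefore, Function.update_self]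
        rw [not_and_or, not_not, not_not]
        simp [stepRel, Function.update_of_ne]
      · rw [hr 10 (by omega) (not_isTemp_of_le (by omega)), h10]
    · convert h₁ using 2
      funext i j
      simp [Fml.rel, Fml.Holds, reachBefore]
    · intro s' hs
      apply hQ
      convert hs using 2
      funext i j
      exact propext (reachBefore_card (by simp) j).symm

/-- A program filling the tables `t`, `t + 1`, …. -/
def listCode (K : ℕ) : ℕ → List TableDef → RAMProgram
  | _, [] => .const 7 0
  | t, o :: os => .seq (o.code K t) (listCode K (t + 1) os)

noncomputable def listTime (K : ℕ) : ℕ → List TableDef → Polynomial ℕ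
  | _, [] => 1
  | t, o :: os => o.time K t + listTime K (t + 1) os

/-- Every definition uses only the preceding tables. -/
def ListWf : ℕ → List TableDef → Prop
  | _, [] => True
  | t, o :: os => o.Wf t ∧ ListWf (t + 1) os

instance decidableListWf : ∀ (t : ℕ) (os : List TableDef), Decidable (ListWf t os)
  | _, [] => .isTrue trivial
  | t, o :: os =>
    letI := decidableListWf (t + 1) os
    inferInstanceAs (Decidable (o.Wf t ∧ ListWf (t + 1) os))

/-- The tables `t`, `t + 1`, … are given by the definitions in the list. -/
def Defines {n : ℕ} (tabs : ℕ → Fin n → Fin n → Prop) (env : ℕ → Fin n) : ℕ → List TableDef → Prop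
  | _, [] => True
  | t, o :: os => tabs t = o.rel tabs env ∧ Defines tabs env (t + 1) os

/-- Each definition reads only earlier tables, and later programs leave those unchanged. By
`rel_congr` it therefore still holds for the final tables. -/
theorem listCode_runs {n K t : ℕ} {tabs : ℕ → Fin n → Fin n → Prop} {os : List TableDef}
    (ht : t + os.length ≤ K) (ho : ListWf t os) {env : ℕ → Fin n} {s : RAMState}
    (h : Good K tabs 1 env s) {Q : RAMState → Prop}
    (hQ : ∀ s' tabs', (∀ t' < t, tabs' t' = tabs t') → Defines tabs' env t os →
      Good K tabs' 1 env s' → Q s') :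
    (listCode K t os).Runs s ((listTime K t os).eval n) Q := by
  induction os generalizing t tabs s with
  | nil =>
    have hB : (listTime K t []).eval n = 1 := by simp [listTime]
    rw [hB]
    refine .const (hQ _ tabs (fun _ _ => rfl) trivial (h.of_mem_eq ?_ rfl))
    exact (RegAgree.refl _ _).setReg_temp (Or.inr (Or.inr rfl))
  | cons o os ih =>
    have hB : (listTime K t (o :: os)).eval n = (o.time K t).eval n +
        (listTime K (t + 1) os).eval n := by simp [listTime]
    rw [hB]
    rw [List.length_cons] at ht
    refine .seq (code_runs (by omega) ho.1 h fun s₁ h₁ => ih (by omega) ho.2 h₁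
      fun s' tabs' h2 h3 h4 => hQ s' tabs' (fun t' ht' => ?_) ⟨?_, h3⟩ h4)
    · rw [h2 t' (by omega), Function.update_of_ne ht'.ne]
    · have hlow : ∀ t' < t, tabs' t' = tabs t' := fun t' ht' => by
        rw [h2 t' (by omega), Function.update_of_ne ht'.ne]
      rw [h2 t (by omega), Function.update_self, rel_congr hlow ho.1]

end TableDef

/-! ### Writing the output -/

/-- Descriptions of output words. -/
inductive Emitter
  | bit (φ : Fml)
  | var (x : ℕ)
  | seq (e e' : Emitter)
  | each (e : Emitter)
  | guard (φ : Fml) (e : Emitter)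

namespace Emitter

def Wf (K : ℕ) : Emitter → ℕ → Prop
  | bit φ, d => φ.Wf K d
  | var x, d => x < d
  | seq e e', d => e.Wf K d ∧ e'.Wf K d
  | each e, d => e.Wf K (d + 1)
  | guard φ e, d => φ.Wf K d ∧ e.Wf K d

instance decidableWf (K : ℕ) : ∀ (e : Emitter) (d : ℕ), Decidable (e.Wf K d)
  | bit φ, d => φ.decidableWf K d
  | var x, d => inferInstanceAs (Decidable (x < d))
  | seq e e', d =>
    letI := decidableWf K e d
    letI := decidableWf K e' d
    inferInstanceAs (Decidable (e.Wf K d ∧ e'.Wf K d))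
  | each e, d => decidableWf K e (d + 1)
  | guard φ e, d =>
    letI := φ.decidableWf K d
    letI := decidableWf K e d
    inferInstanceAs (Decidable (φ.Wf K d ∧ e.Wf K d))

open Classical in
/-- The word described by an emitter. -/
noncomputable def out {n : ℕ} (tabs : ℕ → Fin n → Fin n → Prop) :
    Emitter → ℕ → (ℕ → Fin n) → List ℕ
  | bit φ, d, env => [if φ.Holds tabs d env then 1 else 0]
  | var x, _, env => [(env x : ℕ)]
  | seq e e', d, env => e.out tabs d env ++ e'.out tabs d env
  | each e, d, env => (List.finRange n).flatMap fun v => e.out tabs (d + 1) (Function.update env d v)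
  | guard φ e, d, env => if φ.Holds tabs d env then e.out tabs d env else []

/-- A program writing the word to the address in register `8`. -/
def code : Emitter → ℕ → RAMProgram
  | bit φ, d => .seq (φ.code d) (.seq (.store 8 5) (.add 8 8 2))
  | var x, _ => .seq (.store 8 (20 + x)) (.add 8 8 2)
  | seq e e', d => .seq (e.code d) (e'.code d)
  | each e, d => forLoop (20 + d) (e.code (d + 1))
  | guard φ e, d => .seq (φ.code d) (.ite 3 5 (e.code d) (.const 7 0))

noncomputable def time : Emitter → Polynomial ℕ
  | bit φ => φ.time + 2
  | var _ => 2
  | seq e e' => e.time + e'.time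
  | each e => .X * (e.time + 2) + 2
  | guard φ e => φ.time + (e.time + 1 + 1)

end Emitter

/-- The state `s'` arises from `s` by writing the word `l` to the address in register `8`. -/
structure Emits (d : ℕ) (s : RAMState) (l : List ℕ) (s' : RAMState) : Prop where
  reg : ∀ x < 20 + d, ¬ IsTemp x → x ≠ 8 → s'.reg x = s.reg x
  pointer : s'.reg 8 = s.reg 8 + l.length
  below : ∀ a < s.reg 8, s'.mem a = s.mem a
  word : ∀ a < l.length, s'.mem (s.reg 8 + a) = l.getD a 0

namespace Emits

variable {d : ℕ} {s s' s'' : RAMState} {l l' : List ℕ}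

theorem of_agree (hr : RegAgree (20 + d) s s') (hm : s'.mem = s.mem) : Emits d s [] s' where
  reg x hx hx' _ := hr x hx hx'
  pointer := by rw [hr 8 (by omega) (not_isTemp_of_le le_rfl), List.length_nil, add_zero]
  below a _ := by rw [hm]
  word a ha := by simp at ha

theorem trans (h : Emits d s l s') (h' : Emits d s' l' s'') : Emits d s (l ++ l') s'' where
  reg x hx hx' h8 := (h'.reg x hx hx' h8).trans (h.reg x hx hx' h8)
  pointer := by
    rw [h'.pointer, h.pointer, List.length_append]
    omega
  below a ha := by
    rw [h'.below a (by rw [h.pointer]; omega), h.below a ha]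
  word a ha := by
    rw [List.length_append] at ha
    by_cases hal : a < l.length
    · rw [h'.below _ (by rw [h.pointer]; omega), h.word a hal, List.getD_append _ _ _ _ hal]
    · have := h'.word (a - l.length) (by omega)
      rw [h.pointer, show s.reg 8 + l.length + (a - l.length) = s.reg 8 + a by omega] at this
      rw [this, List.getD_append_right _ _ _ _ (by omega)]

theorem setReg {x v : ℕ} (h : Emits d s l s') (hx : 20 + d ≤ x) : Emits d s l (s'.setReg x v) where
  reg y hy hy' h8 := by rw [RAMState.setReg_reg_of_ne _ _ (by omega), h.reg y hy hy' h8]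
  pointer := by rw [RAMState.setReg_reg_of_ne _ _ (by omega), h.pointer]
  below := h.below
  word := h.word

theorem mono {d' : ℕ} (h : Emits d s l s') (hd : d' ≤ d) : Emits d' s l s' where
  reg x hx := h.reg x (by omega)
  pointer := h.pointer
  below := h.below
  word := h.word

theorem push (h1 : s.reg 2 = 1) (v : ℕ) :
    Emits d s [v] ((s.setMem (s.reg 8) v).setReg 8 (s.reg 8 + s.reg 2)) where
  reg x _ _ h8 := RAMState.setReg_reg_of_ne _ _ h8
  pointer := by rw [RAMState.setReg_reg_self, h1, List.length_singleton]
  below a ha := by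
    rw [RAMState.setReg_mem, RAMState.setMem_mem, if_neg ha.ne]
  word a ha := by
    have : a = 0 := by simpa using ha
    subst this
    rw [RAMState.setReg_mem, RAMState.setMem_mem]
    simp

/-- Output is written behind the `K` tables, so formulas can still be evaluated while printing. -/
theorem good {n K : ℕ} {tabs : ℕ → Fin n → Fin n → Prop} {env : ℕ → Fin n} (h : Emits d s l s')
    (hp : 2 + K * (n * n) ≤ s.reg 8) (hg : Good K tabs d env s) : Good K tabs d env s' where
  size := by rw [h.reg 1 (by omega) (not_isTemp_of_lt (by omega)) (by omega), hg.size]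
  one := by rw [h.reg 2 (by omega) (not_isTemp_of_lt (by omega)) (by omega), hg.one]
  zero := by rw [h.reg 3 (by omega) (not_isTemp_of_lt (by omega)) (by omega), hg.zero]
  sq := by rw [h.reg 4 (by omega) (not_isTemp_of_lt (by omega)) (by omega), hg.sq]
  vars x hx := by
    rw [h.reg (20 + x) (by omega) (not_isTemp_of_le (by omega)) (by omega), hg.vars x hx]
  tables t ht i j := by
    rw [h.below _ ((tableAddr_lt ht i j).trans_le hp), hg.tables t ht]

end Emits

theorem Emitter.code_runs {n K : ℕ} {tabs : ℕ → Fin n → Fin n → Prop} {e : Emitter} {d : ℕ}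
    {env : ℕ → Fin n} {s : RAMState} (he : e.Wf K d) (h : Good K tabs d env s)
    (hp : 2 + K * (n * n) ≤ s.reg 8) {Q : RAMState → Prop}
    (hQ : ∀ s', Emits d s (e.out tabs d env) s' → Q s') :
    (e.code d).Runs s (e.time.eval n) Q := by
  classical
  induction e generalizing d env s Q with
  | bit φ =>
    have hB : (bit φ).time.eval n = φ.time.eval n + (1 + 1) := by simp [time]
    rw [hB]
    refine .seq (φ.code_runs he h fun s₁ k1 k2 k3 => .seq (.store (.add (hQ _ ?_))))
    have e1 := Emits.of_agree k1 k2
    have h1 := (h.of_mem_eq k1 k2).one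
    have h5 : s₁.reg 5 = if φ.Holds tabs d env then 1 else 0 := by
      rcases k3 with ⟨k3, k4⟩ | ⟨k3, k4⟩
      · rw [k4, if_pos k3]
      · rw [k4, if_neg k3]
    rw [h5]
    exact e1.trans (.push h1 _)
  | var x =>
    have hB : (var x).time.eval n = 1 + 1 := by simp [time]
    rw [hB]
    refine .seq (.store (.add (hQ _ ?_)))
    rw [h.vars x he]
    exact .push h.one _
  | seq e e' ih ih' =>
    have hB : (seq e e').time.eval n = e.time.eval n + e'.time.eval n := by simp [time]
    rw [hB]
    refine .seq (ih he.1 h hp fun s₁ h₁ => ih' he.2 (h₁.good hp h) ?_ fun s₂ h₂ =>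
      hQ _ (h₁.trans h₂))
    rw [h₁.pointer]
    omega
  | each e ih =>
    have hB : (each e).time.eval n = n * (e.time.eval n + 2) + 2 := by simp [time]
    rw [hB]
    refine .forLoop (fun k s' => Emits d s (((List.finRange n).take k).flatMap fun v =>
      e.out tabs (d + 1) (Function.update env d v)) s') ?_ ?_ ?_ ?_ ?_
    · exact fun k s' hs => ⟨(hs.good hp h).size, (hs.good hp h).one⟩
    · exact fun k s' v hs => hs.setReg le_rfl
    · intro k hk s' hs hreg
      have hg := (hs.good hp h).push (v := ⟨k, hk⟩) hreg
      refine ih he hg (by rw [hs.pointer]; omega) fun s'' hs'' => ⟨?_, ?_⟩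
      · have e1 : (List.finRange n).take (k + 1) = (List.finRange n).take k ++ [⟨k, hk⟩] := by
          rw [List.take_add_one, List.getElem?_eq_getElem (by simpa using hk)]
          simp
        rw [e1, List.flatMap_append]
        refine hs.trans ?_
        simpa using hs''.mono (Nat.le_succ d)
      · rw [hs''.reg (20 + d) (by omega) (not_isTemp_of_le (by omega)) (by omega), hreg]
    · simpa using Emits.of_agree (d := d) (RegAgree.refl _ s) rfl
    · intro s' hs
      apply hQ
      rwa [List.take_of_length_le (by simp)] at hs
  | guard φ e ih =>
    have hB : (guard φ e).time.eval n = φ.time.eval n + (e.time.eval n + 1 + 1) := by simp [time]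
    rw [hB]
    refine .seq (φ.code_runs he.1 h fun s₁ k1 k2 k3 => ?_)
    have e1 := Emits.of_agree k1 k2
    have hg := h.of_mem_eq k1 k2
    have h3 := hg.zero
    refine .ite (fun hlt => ?_) fun hlt => ?_
    · rcases k3 with ⟨k3, k4⟩ | ⟨k3, k4⟩
      · refine Runs.mono (ih he.2 hg (by rw [e1.pointer]; simpa using hp) fun s₂ h₂ => hQ _ ?_)
          (Nat.le_succ _) fun _ h => h
        simp only [out, if_pos k3]
        exact e1.trans h₂
      · omega
    · rcases k3 with ⟨k3, k4⟩ | ⟨k3, k4⟩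
      · omega
      · refine Runs.mono (.const (hQ _ ?_)) (Nat.le_add_left _ _) fun _ h => h
        simp only [out, if_neg k3]
        exact .of_agree (k1.setReg_temp (Or.inr (Or.inr rfl))) k2

/-- Write the length of the word described by `e`, followed by the word described by `e'`, behind
the tables. -/
def outputCode (K : ℕ) (e e' : Emitter) : RAMProgram :=
  -- The word of `e` is written only to be counted: its length is the final pointer minus the start
  -- minus 1, and the word of `e'` then starts at the same place, one cell after the count.
  .seq (.const 6 2) (.seq (addTables K) (.seq (.add 0 6 3) (.seq (.add 8 0 2) (.seq (e.code 1)
    (.seq (.sub 5 8 0) (.seq (.sub 5 5 2) (.seq (.store 0 5) (.seq (.add 8 0 2) (e'.code 1)))))))))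

noncomputable def outputTime (K : ℕ) (e e' : Emitter) : Polynomial ℕ :=
  1 + ((K : Polynomial ℕ) + 1 + (1 + (1 + (e.time + (1 + (1 + (1 + (1 + e'.time))))))))

theorem outputCode_runs {n K : ℕ} {tabs : ℕ → Fin n → Fin n → Prop} {e e' : Emitter}
    {env : ℕ → Fin n} {s : RAMState} (he : e.Wf K 1) (he' : e'.Wf K 1) (h : Good K tabs 1 env s) :
    (outputCode K e e').Runs s ((outputTime K e e').eval n) fun s' =>
      s'.Outputs ((e.out tabs 1 env).length :: e'.out tabs 1 env) := by
  have hB : (outputTime K e e').eval n = 1 + (K + 1 + (1 + (1 + (e.time.eval n +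
      (1 + (1 + (1 + (1 + e'.time.eval n)))))))) := by simp [outputTime]
  rw [hB]
  refine .seq (.const (.seq (addTables_runs K fun s₁ k1 k2 k3 => .seq (.add (.seq (.add ?_))))))
  have r1 : ∀ x, x ≠ 6 → x ≠ 7 → s₁.reg x = s.reg x := fun x h6 h7 => by
    rw [k1 x h6 h7, RAMState.setReg_reg_of_ne _ _ h6]
  have k6 : s₁.reg 6 + s₁.reg 3 = 2 + K * (n * n) := by
    rw [k3, r1 3 (by omega) (by omega), h.zero, RAMState.setReg_reg_self,
      RAMState.setReg_reg_of_ne _ _ (by omega), h.sq, add_zero]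
  rw [k6]
  set p := 2 + K * (n * n) with hp
  have h21 : (s₁.setReg 0 p).reg 0 + (s₁.setReg 0 p).reg 2 = p + 1 := by
    rw [RAMState.setReg_reg_self, RAMState.setReg_reg_of_ne _ _ (by omega),
      r1 2 (by omega) (by omega), h.one]
  rw [h21]
  set s₂ := (s₁.setReg 0 p).setReg 8 (p + 1) with hs₂
  have r2 : ∀ x, x ≠ 6 → x ≠ 7 → x ≠ 0 → x ≠ 8 → s₂.reg x = s.reg x := fun x h6 h7 h0 h8 => by
    rw [hs₂, RAMState.setReg_reg_of_ne _ _ h8, RAMState.setReg_reg_of_ne _ _ h0, r1 x h6 h7]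
  have r20 : s₂.reg 0 = p := by
    rw [hs₂, RAMState.setReg_reg_of_ne _ _ (by omega), RAMState.setReg_reg_self]
  have r28 : s₂.reg 8 = p + 1 := RAMState.setReg_reg_self _ _ _
  have g2 : Good K tabs 1 env s₂ := by
    refine ⟨?_, ?_, ?_, ?_, ?_, ?_⟩
    · rw [r2 1 (by omega) (by omega) (by omega) (by omega), h.size]
    · rw [r2 2 (by omega) (by omega) (by omega) (by omega), h.one]
    · rw [r2 3 (by omega) (by omega) (by omega) (by omega), h.zero]
    · rw [r2 4 (by omega) (by omega) (by omega) (by omega), h.sq]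
    · intro x hx
      rw [r2 _ (by omega) (by omega) (by omega) (by omega), h.vars x hx]
    · intro t ht i j
      rw [← h.tables t ht i j, show s₂.mem = s.mem from k2]
  refine .seq (e.code_runs he g2 (by omega) fun s₃ h₃ => ?_)
  have g3 := h₃.good (by omega) g2
  have r30 : s₃.reg 0 = p := by
    rw [h₃.reg 0 (by omega) (not_isTemp_of_lt (by omega)) (by omega), r20]
  have r38 := h₃.pointer
  rw [r28] at r38
  refine .seq (.sub (.seq (.sub (.seq (.store ?_)))))
  have e5 : ((s₃.setReg 5 (s₃.reg 8 - s₃.reg 0)).reg 5 - (s₃.setReg 5 (s₃.reg 8 - s₃.reg 0)).reg 2) =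
      (e.out tabs 1 env).length := by
    rw [RAMState.setReg_reg_self, RAMState.setReg_reg_of_ne _ _ (by omega), g3.one, r30, r38]
    omega
  rw [e5]
  set m := (e.out tabs 1 env).length with hm
  set s₄ := (s₃.setReg 5 (s₃.reg 8 - s₃.reg 0)).setReg 5 m with hs₄
  have r4 : ∀ x, x ≠ 5 → s₄.reg x = s₃.reg x := fun x hx => by
    rw [hs₄, RAMState.setReg_reg_of_ne _ _ hx, RAMState.setReg_reg_of_ne _ _ hx]
  have r40 : s₄.reg 0 = p := by rw [r4 0 (by omega), r30]
  have r45 : s₄.reg 5 = m := RAMState.setReg_reg_self _ _ _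
  rw [r40, r45]
  refine .seq (.add ?_)
  rw [RAMState.setMem_reg, r40, r4 2 (by omega), g3.one]
  set s₅ := (s₄.setMem p m).setReg 8 (p + 1) with hs₅
  have r5 : ∀ x, x ≠ 5 → x ≠ 8 → s₅.reg x = s₃.reg x := fun x hx hx' => by
    rw [hs₅, RAMState.setReg_reg_of_ne _ _ hx', RAMState.setMem_reg, r4 x hx]
  have r58 : s₅.reg 8 = p + 1 := RAMState.setReg_reg_self _ _ _
  have m5 : ∀ a, a ≠ p → s₅.mem a = s₃.mem a := fun a ha => by
    rw [hs₅, RAMState.setReg_mem, RAMState.setMem_mem, if_neg ha]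
    rfl
  have m5p : s₅.mem p = m := by
    rw [hs₅, RAMState.setReg_mem, RAMState.setMem_mem, if_pos rfl]
  have g5 : Good K tabs 1 env s₅ := by
    refine ⟨?_, ?_, ?_, ?_, ?_, ?_⟩
    · rw [r5 1 (by omega) (by omega), g3.size]
    · rw [r5 2 (by omega) (by omega), g3.one]
    · rw [r5 3 (by omega) (by omega), g3.zero]
    · rw [r5 4 (by omega) (by omega), g3.sq]
    · intro x hx
      rw [r5 _ (by omega) (by omega), g3.vars x hx]
    · intro t ht i j
      rw [m5 _ (tableAddr_lt ht i j).ne, g3.tables t ht]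
  refine e'.code_runs he' g5 (by omega) fun s₆ h₆ a ha => ?_
  have r60 : s₆.reg 0 = p := by
    rw [h₆.reg 0 (by omega) (not_isTemp_of_lt (by omega)) (by omega), r5 0 (by omega) (by omega),
      r30]
  rw [r60]
  cases a with
  | zero =>
    rw [add_zero, h₆.below p (by omega), m5p]
    rfl
  | succ a =>
    have := h₆.word a (by simpa using ha)
    rw [r58, show p + 1 + a = p + (a + 1) by omega] at this
    rw [this]
    rfl

/-! ### Reading the input -/

theorem getD_flatMap_of_length {α : Type*} {n : ℕ} (L : List α) (g : α → List ℕ)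
    (hg : ∀ a, (g a).length = n) (i j : ℕ) (hi : i < L.length) (hj : j < n) :
    (L.flatMap g).getD (i * n + j) 0 = (g L[i]).getD j 0 := by
  induction L generalizing i with
  | nil => simp at hi
  | cons a L ih =>
    rw [List.flatMap_cons]
    cases i with
    | zero =>
      rw [zero_mul, zero_add, List.getD_append _ _ _ _ (by rw [hg]; exact hj)]
      rfl
    | succ i =>
      rw [List.getD_append_right _ _ _ _ (by rw [hg, Nat.add_mul]; omega), hg,
        show (i + 1) * n + j - n = i * n + j by rw [Nat.add_mul]; omega,
        ih i (by simpa using hi)]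
      rfl

theorem getD_matrix {n : ℕ} (f : Fin n → Fin n → ℕ) (i j : Fin n) :
    ((List.finRange n).flatMap fun u => (List.finRange n).map (f u)).getD (i * n + j) 0 = f i j := by
  rw [getD_flatMap_of_length (n := n) _ _ (by simp) i j (by simp) j.2]
  rw [List.getD_eq_getElem _ _ (by simp)]
  simp

theorem length_matrix {n : ℕ} (f : Fin n → Fin n → ℕ) :
    ((List.finRange n).flatMap fun u => (List.finRange n).map (f u)).length = n * n := by
  simp [List.length_flatMap]

section Input

variable {n : ℕ} (G : SimpleGraph (Fin n)) (w : Sym2 (Fin n) → ℕ) (r : Fin n)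
  (T : SimpleGraph (Fin n))

open Classical in
theorem encodeInput_graph (i j : Fin n) : (encodeInput G w r T).getD (tableAddr n 0 i j) 0 =
    if G.Adj i j then w s(i, j) else 0 := by
  have h : (i : ℕ) * n + j < n * n := by
    have := tableAddr_lt (show 0 < 1 by omega) i j
    unfold tableAddr at this
    omega
  unfold encodeInput
  rw [List.getD_append _ _ _ _ (by
      rw [List.length_append, length_matrix]
      simp only [List.length_cons, List.length_nil, tableAddr]
      omega),
    List.getD_append_right _ _ _ _ (by simp only [List.length_cons, List.length_nil, tableAddr]; omega)]
  rw [show tableAddr n 0 i j - [n, (r : ℕ)].length = i * n + j by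
    simp only [List.length_cons, List.length_nil, tableAddr]
    omega]
  exact getD_matrix _ i j

open Classical in
theorem encodeInput_tree (i j : Fin n) : (encodeInput G w r T).getD (tableAddr n 1 i j) 0 =
    if T.Adj i j then 1 else 0 := by
  unfold encodeInput
  rw [List.getD_append_right _ _ _ _ (by
      rw [List.length_append, length_matrix]
      simp only [List.length_cons, List.length_nil, tableAddr]
      omega)]
  rw [List.length_append, length_matrix, show tableAddr n 1 i j - ([n, (r : ℕ)].length + n * n) =
    i * n + j by
      simp only [List.length_cons, List.length_nil, tableAddr]
      omega]
  exact getD_matrix _ i j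

/-- Read the number of vertices and the root, and compute the size of a table. -/
def readCode : RAMProgram :=
  .seq (.const 2 1) (.seq (.load 1 3) (.seq (.load 20 2) (forLoop 10 (.add 4 4 1))))

/-- Positive weights make a zero entry mean a non-edge, so the weight matrix serves directly as the
adjacency table; the values of the weights are never used. -/
theorem readCode_runs (hw : ∀ e ∈ G.edgeSet, 1 ≤ w e) (K : ℕ) {Q : RAMState → Prop}
    (hQ : ∀ s tabs, tabs 0 = G.Adj → tabs 1 = T.Adj → Good K tabs 1 (fun _ => r) s → Q s) :
    readCode.Runs (RAMState.init (encodeInput G w r T)) (3 * n + 5) Q := by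
  classical
  have key : readCode.Runs (RAMState.init (encodeInput G w r T))
      (1 + (1 + (1 + (n * (1 + 2) + 2)))) Q := by
    refine .seq (.const (.seq (.load (.seq (.load ?_)))))
    set s₁ := (RAMState.init (encodeInput G w r T)).setReg 2 1 with hs₁
    -- Register `3` is initially 0 and register `2` has just been set to 1, so the two loads read
    -- the cells of `n` and of the root.
    have e1 : s₁.mem (s₁.reg 3) = n := by simp [hs₁, RAMState.setReg, RAMState.init, encodeInput]
    rw [e1]
    have e2 : (s₁.setReg 1 n).mem ((s₁.setReg 1 n).reg 2) = r := by
      simp [hs₁, RAMState.setReg, RAMState.init, encodeInput]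
    rw [e2]
    set m := (RAMState.init (encodeInput G w r T)).mem with hm
    refine .forLoop (fun k s => s.mem = m ∧ s.reg 1 = n ∧ s.reg 2 = 1 ∧ s.reg 3 = 0 ∧
      s.reg 20 = r ∧ s.reg 4 = k * n) ?_ ?_ ?_ ?_ ?_
    · exact fun k s h => ⟨h.2.1, h.2.2.1⟩
    · rintro k s v ⟨h0, h1, h2, h3, h20, h4⟩
      refine ⟨h0, ?_, ?_, ?_, ?_, ?_⟩ <;> rwa [RAMState.setReg_reg_of_ne _ _ (by omega)]
    · rintro k hk s ⟨h0, h1, h2, h3, h20, h4⟩ h10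
      refine .add ⟨⟨h0, ?_, ?_, ?_, ?_, ?_⟩, ?_⟩
      iterate 4 rwa [RAMState.setReg_reg_of_ne _ _ (by omega)]
      · rw [RAMState.setReg_reg_self, h4, h1]
        ring
      · rwa [RAMState.setReg_reg_of_ne _ _ (by omega)]
    · refine ⟨rfl, ?_, ?_, ?_, ?_, ?_⟩ <;> simp [hs₁, RAMState.setReg, RAMState.init]
    · rintro s ⟨h0, h1, h2, h3, h20, h4⟩
      refine hQ s (fun t i j => s.mem (tableAddr n t i j) ≠ 0) ?_ ?_
        ⟨h1, h2, h3, h4, ?_, fun _ _ _ _ => Iff.rfl⟩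
      · funext i j
        rw [h0]
        change ((encodeInput G w r T).getD (tableAddr n 0 i j) 0 ≠ 0) = _
        rw [encodeInput_graph]
        split_ifs with h
        · have := hw s(i, j) h
          simp only [h, eq_iff_iff, iff_true]
          omega
        · simp [h]
      · funext i j
        rw [h0]
        change ((encodeInput G w r T).getD (tableAddr n 1 i j) 0 ≠ 0) = _
        rw [encodeInput_tree]
        split_ifs with h <;> simp [h]
      · intro x hx
        obtain rfl : x = 0 := by omega
        exact h20
  exact key.mono (by omega) fun _ h => h

end Input

/-- Programs computing a word from the input by means of table definitions. -/
theorem exists_program (os : List TableDef) (e e' : Emitter) (hos : TableDef.ListWf 2 os)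
    (he : e.Wf (2 + os.length) 1) (he' : e'.Wf (2 + os.length) 1) :
    ∃ (P : RAMProgram) (p : Polynomial ℕ), ∀ (n : ℕ) (G : SimpleGraph (Fin n))
      (w : Sym2 (Fin n) → ℕ) (r : Fin n) (T : SimpleGraph (Fin n)),
      (∀ e ∈ G.edgeSet, 1 ≤ w e) → ∃ (tabs : ℕ → Fin n → Fin n → Prop) (s : RAMState) (t : ℕ),
        tabs 0 = G.Adj ∧ tabs 1 = T.Adj ∧ TableDef.Defines tabs (fun _ => r) 2 os ∧
        P.Exec (RAMState.init (encodeInput G w r T)) s t ∧ t ≤ p.eval n ∧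
        s.Outputs ((e.out tabs 1 fun _ => r).length :: e'.out tabs 1 fun _ => r) := by
  set K := 2 + os.length with hK
  refine ⟨.seq readCode (.seq (TableDef.listCode K 2 os) (outputCode K e e')),
    3 * .X + 5 + (TableDef.listTime K 2 os + outputTime K e e'), fun n G w r T hw => ?_⟩
  have key : (RAMProgram.seq readCode (.seq (TableDef.listCode K 2 os) (outputCode K e e'))).Runs
      (RAMState.init (encodeInput G w r T))
      (3 * n + 5 + ((TableDef.listTime K 2 os).eval n + (outputTime K e e').eval n))
      fun s => ∃ tabs : ℕ → Fin n → Fin n → Prop,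
        tabs 0 = G.Adj ∧ tabs 1 = T.Adj ∧ TableDef.Defines tabs (fun _ => r) 2 os ∧
        s.Outputs ((e.out tabs 1 fun _ => r).length :: e'.out tabs 1 fun _ => r) := by
    refine .seq (readCode_runs G w r T hw K fun s₁ tabs h0 h1 hg => .seq ?_)
    refine TableDef.listCode_runs le_rfl hos hg fun s₂ tabs' h2 h3 h4 => ?_
    exact (outputCode_runs he he' h4).mono le_rfl fun s hs =>
      ⟨tabs', by rw [h2 0 (by omega), h0], by rw [h2 1 (by omega), h1], h3, hs⟩
  obtain ⟨s, t, h1, h2, tabs, h3, h4, h5, h6⟩ := key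
  exact ⟨tabs, s, t, h3, h4, h5, h1, by simpa using h2, h6⟩

/-! ### The tables of the canonical decomposition -/

namespace HammockTables

open Fml Relation

/-- Universal quantification over the elements satisfying `φ`. -/
abbrev allOf (φ ψ : Fml) : Fml := .neg (.ex (.and φ (.neg ψ)))

/-- A vertex is a starter (in the variable `x`). -/
abbrev starter (x : ℕ) : Fml := .tab 9 x x

/-- The tables `0` and `1` are the adjacency relations of the graph and the tree; a unary predicate
is stored on the diagonal. -/
def tables : List TableDef := [
  -- 2: reachable from the root in the tree without meeting `1`
  .reach (.and (.eq 2 0) (.neg (.eq 0 1))) (.and (.tab 1 3 2) (.neg (.eq 2 1))),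
  -- 3: `anc`
  .set (.neg (.tab 2 1 2)),
  -- 4: `par`
  .set (.and (.tab 1 1 2) (.tab 3 1 2)),
  -- 5: `SubAdj`
  .set (.ex (.ex (.and (.tab 3 1 3) (.and (.tab 3 2 4) (.tab 0 3 4))))),
  -- 6: `SibAdj`
  .set (.and (.neg (.eq 1 2)) (.and (.ex (.and (.tab 4 3 1) (.tab 4 3 2))) (.tab 5 1 2))),
  -- 7: `Out`
  .set (.ex (.ex (.ex (.and (.tab 4 3 1) (.and (.tab 3 1 4) (.and (.neg (.tab 3 3 5))
    (.tab 0 4 5))))))),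
  -- 8: chains of adjacent siblings
  .reach (.eq 1 2) (.tab 6 3 2),
  -- 9: `IsStarter`
  .set (.or (.tab 7 1 1) (.and (allOf (.tab 8 1 3) (.neg (.tab 7 3 3)))
    (allOf (.tab 8 1 3) (.neg (.lt 3 1))))),
  -- 10: `Avoids`
  .reach (.and (starter 2) (.neg (.eq 2 1)))
    (.and (.tab 6 3 2) (.and (.neg (.eq 3 1)) (.neg (.eq 2 1)))),
  -- 11: `IsSibParent`
  .set (.and (.tab 6 1 2) (.tab 10 2 1)),
  -- 12: `Crosses`
  .set (.ex (.and (.tab 11 3 2) (.or (.and (.tab 3 3 1) (.and (.neg (.eq 3 1)) (.tab 5 1 2)))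
    (.and (.tab 3 2 1) (.and (.neg (.eq 2 1)) (.tab 5 1 3)))))),
  -- 13: `First`
  .set (.and (.tab 12 1 2) (allOf (.tab 12 1 3) (.or (.eq 3 2) (.or
    (.ex (.ex (.and (.tab 4 4 2) (.and (.tab 4 5 3) (.and (.tab 3 4 5) (.neg (.eq 4 5)))))))
    (.ex (.and (.tab 4 4 2) (.and (.tab 4 4 3) (.or (.tab 3 2 1) (.and (.neg (.tab 3 3 1))
      (.lt 2 3)))))))))),
  -- 14: `Owner` with exchanged arguments
  .reach (.or (.and (.eq 2 1) (.neg (starter 1))) (.tab 13 2 1))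
    (.and (.tab 4 3 2) (.and (starter 2) (.neg (.tab 7 2 2)))),
  -- 15: `LeftCand`
  .set (.or (.tab 11 2 1) (.ex (.and (.tab 11 3 1) (.and (.tab 3 3 2) (.and (.neg (.eq 3 2))
    (.and (.tab 5 2 1) (.neg (.tab 13 2 1)))))))),
  -- 16: `IsLeftRoot`
  .set (.and (.tab 15 1 2) (allOf (.tab 15 1 3) (.tab 3 3 2))),
  -- 17: the vertices of the base tree
  .set (.neg (.ex (.tab 14 3 1))),
  -- 18: `IsRootLabel`
  .set (.ex (.and (.tab 16 1 3) (.and (.tab 17 3 3) (allOf (.tab 16 4 3) (.neg (.lt 4 1)))))),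
  -- 19: `InLeft`
  .set (.or (.tab 16 1 2) (.and (.tab 14 1 2) (.neg (.tab 3 1 2)))),
  -- 20: `InRight`
  .set (.and (.tab 14 1 2) (.tab 3 1 2))]

/-- One entry for every hammock. -/
def countWord : Emitter := .each (.guard (.neg (starter 1)) (.var 1))

/-- The output word without the number of hammocks. -/
def mainWord : Emitter :=
  .seq (.each (.bit (.tab 17 1 1))) (.each (.guard (.neg (starter 1)) (.seq (.bit (.tab 18 1 1))
    (.seq (.each (.guard (.tab 16 1 2) (.var 2))) (.seq (.var 1)
      (.seq (.each (.bit (.tab 19 1 2))) (.each (.bit (.tab 20 1 2)))))))))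

/-- The tables hold the relations defining the canonical decomposition. -/
structure Correct {n : ℕ} (R : RootedGraph (Fin n)) (tabs : ℕ → Fin n → Fin n → Prop) : Prop where
  isStarter : ∀ v, tabs 9 v v ↔ R.IsStarter v
  isLeftRoot : ∀ b u, tabs 16 b u ↔ R.IsLeftRoot b u
  base : ∀ v, tabs 17 v v ↔ ∀ b, ¬ R.Owner v b
  isRootLabel : ∀ b, tabs 18 b b ↔ R.IsRootLabel b
  inLeft : ∀ b v, tabs 19 b v ↔ R.InLeft b v
  inRight : ∀ b v, tabs 20 b v ↔ R.InRight b v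

/-- Ancestry enters through `ancestorOrEq_iff_not_reach`, as the complement of a reachability table.
Every other relation is its defining formula read off from preceding tables. -/
theorem correct_of_defines {n : ℕ} {R : RootedGraph (Fin n)} (hT : R.tree.IsTree)
    {tabs : ℕ → Fin n → Fin n → Prop} (h0 : tabs 0 = R.graph.Adj) (h1 : tabs 1 = R.tree.Adj)
    (h : TableDef.Defines tabs (fun _ => R.root) 2 tables) : Correct R tabs := by
  simp only [tables, TableDef.Defines, Nat.reduceAdd, and_true] at h
  obtain ⟨h2, h3, h4, h5, h6, h7, h8, h9, h10, h11, h12, h13, h14, h15, h16, h17, h18, h19, h20⟩ := h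
  have t3 : ∀ u v, tabs 3 u v ↔ R.anc u v := by
    intro u v
    rw [h3]
    have : ∀ i, TableDef.stepRel tabs (fun _ => R.root) (.and (.tab 1 3 2) (.neg (.eq 2 1))) i =
        fun x y => R.tree.Adj x y ∧ y ≠ i := by
      intro i
      funext x y
      simp [TableDef.stepRel, Fml.Holds, h1]
    rw [RootedGraph.anc, ancestorOrEq_iff_not_reach hT]
    simp [TableDef.rel, Fml.rel, Fml.Holds, h2, this]
  have t4 : ∀ u v, tabs 4 u v ↔ R.par u v := by
    intro u v
    rw [h4]
    simp [TableDef.rel, Fml.rel, Fml.Holds, t3, h1, IsTreeParent]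
  have t5 : ∀ u v, tabs 5 u v ↔ R.SubAdj u v := by
    intro u v
    rw [h5]
    simp [TableDef.rel, Fml.rel, Fml.Holds, t3, h0, RootedGraph.SubAdj]
  have t6 : ∀ u v, tabs 6 u v ↔ R.SibAdj u v := by
    intro u v
    rw [h6]
    simp [TableDef.rel, Fml.rel, Fml.Holds, t4, t5, RootedGraph.SibAdj]
  have t7 : ∀ u v, tabs 7 u v ↔ R.Out u := by
    intro u v
    rw [h7]
    simp [TableDef.rel, Fml.rel, Fml.Holds, t3, t4, h0, RootedGraph.Out]
  have t8 : ∀ u v, tabs 8 u v ↔ ReflTransGen R.SibAdj u v := by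
    intro u v
    rw [h8]
    have : ∀ i, TableDef.stepRel tabs (fun _ => R.root) (.tab 6 3 2) i = R.SibAdj := by
      intro i
      funext x y
      simp [TableDef.stepRel, Fml.Holds, t6]
    simp [TableDef.rel, Fml.rel, Fml.Holds, this]
  have t9 : ∀ u v, tabs 9 u v ↔ R.IsStarter u := by
    intro u v
    rw [h9]
    simp only [TableDef.rel, Fml.rel, Fml.Holds, t7, t8,
      RootedGraph.IsStarter]
    simp [or_iff_not_imp_left]
  have t10 : ∀ u v, tabs 10 u v ↔ R.Avoids u v := by
    intro u v
    rw [h10]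
    have : ∀ i, TableDef.stepRel tabs (fun _ => R.root)
        (.and (.tab 6 3 2) (.and (.neg (.eq 3 1)) (.neg (.eq 2 1)))) i =
        fun x y => R.SibAdj x y ∧ x ≠ i ∧ y ≠ i := by
      intro i
      funext x y
      simp [TableDef.stepRel, Fml.Holds, t6]
    simp [TableDef.rel, Fml.rel, Fml.Holds, this, t9, RootedGraph.Avoids]
  have t11 : ∀ u v, tabs 11 u v ↔ R.IsSibParent u v := by
    intro u v
    rw [h11]
    simp [TableDef.rel, Fml.rel, Fml.Holds, t6, t10, RootedGraph.IsSibParent]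
  have t12 : ∀ u v, tabs 12 u v ↔ R.Crosses u v := by
    intro u v
    rw [h12]
    simp [TableDef.rel, Fml.rel, Fml.Holds, t3, t5, t11,
      RootedGraph.Crosses, or_iff_not_imp_left]
  have t13 : ∀ u v, tabs 13 u v ↔ R.First u v := by
    intro u v
    rw [h13]
    simp [TableDef.rel, Fml.rel, Fml.Holds, t3, t4, t12,
      RootedGraph.First, RootedGraph.Before, or_iff_not_imp_left]
  have t14 : ∀ u v, tabs 14 u v ↔ R.Owner v u := by
    intro u v
    rw [h14]
    have : ∀ i, TableDef.stepRel tabs (fun _ => R.root)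
        (.and (.tab 4 3 2) (.and (starter 2) (.neg (.tab 7 2 2)))) i =
        fun x y => R.par x y ∧ R.IsStarter y ∧ ¬ R.Out y := by
      intro i
      funext x y
      simp [TableDef.stepRel, Fml.Holds, t4, t7, t9]
    simp [TableDef.rel, Fml.rel, Fml.Holds, this, t9, t13,
      RootedGraph.Owner, or_iff_not_imp_left]
  have t15 : ∀ u v, tabs 15 u v ↔ R.LeftCand u v := by
    intro u v
    rw [h15]
    simp [TableDef.rel, Fml.rel, Fml.Holds, t3, t5, t11, t13,
      RootedGraph.LeftCand, or_iff_not_imp_left]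
  have t16 : ∀ u v, tabs 16 u v ↔ R.IsLeftRoot u v := by
    intro u v
    rw [h16]
    simp [TableDef.rel, Fml.rel, Fml.Holds, t3, t15, RootedGraph.IsLeftRoot]
  have t17 : ∀ u v, tabs 17 u v ↔ ∀ b, ¬ R.Owner u b := by
    intro u v
    rw [h17]
    simp [TableDef.rel, Fml.rel, Fml.Holds, t14]
  refine ⟨fun v => t9 v v, t16, fun v => t17 v v, fun b => ?_, fun b v => ?_, fun b v => ?_⟩
  · rw [h18]
    simp [TableDef.rel, Fml.rel, Fml.Holds, t16, t17,
      RootedGraph.IsRootLabel]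
  · rw [h19]
    simp [TableDef.rel, Fml.rel, Fml.Holds, t3, t14, t16,
      RootedGraph.InLeft, or_iff_not_imp_left]
  · rw [h20]
    simp [TableDef.rel, Fml.rel, Fml.Holds, t3, t14, RootedGraph.InRight]

theorem flatMap_ite_nil {α β : Type*} (L : List α) (p : α → Prop) [DecidablePred p]
    (f : α → List β) : (L.flatMap fun v => if p v then f v else []) =
      (L.filter p).flatMap f := by
  induction L with
  | nil => rfl
  | cons a L ih =>
    rw [List.flatMap_cons, ih, List.filter_cons]
    split_ifs with h <;> simp_all

theorem flatMap_finRange_get {α β : Type*} (l : List α) (f : α → List β) :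
    ((List.finRange l.length).flatMap fun i => f (l.get i)) = l.flatMap f := by
  conv_rhs => rw [← List.map_get_finRange l]
  rw [List.flatMap_map]

open Classical in
/-- The right roots of the hammocks. -/
noncomputable def labels {n : ℕ} (R : RootedGraph (Fin n)) : List (Fin n) :=
  (List.finRange n).filter fun b => ¬ R.IsStarter b

/-- Guarded loops over all vertices run through the labels in increasing order, which is the order
of `labels`. The left root is printed by a loop over all vertices, exactly one of which passes the
guard. -/
theorem encode_data {n : ℕ} {R : RootedGraph (Fin n)} (h : R.Valid)
    {tabs : ℕ → Fin n → Fin n → Prop} (ht : Correct R tabs) (env : ℕ → Fin n) :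
    (countWord.out tabs 1 env).length :: mainWord.out tabs 1 env = (R.data (labels R)).encode := by
  classical
  have hfil : ((List.finRange n).filter fun v => decide (¬ tabs 9 v v)) = labels R := by
    simp only [labels, ht.isStarter]
  have hcount : (countWord.out tabs 1 env).length = (labels R).length := by
    simp only [countWord, Emitter.out, Fml.Holds, Function.update_self]
    rw [flatMap_ite_nil, hfil]
    simp
  have hset : ∀ (S : Finset (Fin n)) (p : Fin n → Prop) [DecidablePred p], (∀ v, v ∈ S ↔ p v) →
      encodeSet S = (List.finRange n).flatMap fun v => [if p v then 1 else 0] := by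
    intro S p _ hp
    rw [encodeSet, List.map_eq_flatMap]
    simp [hp]
  rw [hcount]
  unfold HammockData.encode
  rw [List.cons_append]
  congr 1
  simp only [mainWord, Emitter.out, Fml.Holds, Function.update_self]
  rw [flatMap_ite_nil, hfil]
  congr 1
  · rw [hset _ (fun v => tabs 17 v v) fun v => RootedGraph.Valid.mem_base.trans (ht.base v).symm]
  · rw [← flatMap_finRange_get (labels R)]
    refine List.flatMap_congr fun i _ => ?_
    set b := (labels R).get i with hb
    have hbs : ¬ R.IsStarter b := by
      have : b ∈ labels R := List.get_mem _ _
      simpa [labels] using this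
    rw [hset _ (fun v => tabs 19 b v) fun v =>
        RootedGraph.Valid.mem_left.trans (ht.inLeft b v).symm,
      hset _ (fun v => tabs 20 b v) fun v =>
        RootedGraph.Valid.mem_right.trans (ht.inRight b v).symm]
    have hl : ((List.finRange n).flatMap fun v => if tabs 16 b v then [(v : ℕ)] else []) =
        [(R.leftRoot b : ℕ)] := by
      rw [flatMap_ite_nil]
      have : ((List.finRange n).filter fun v => decide (tabs 16 b v)) = [R.leftRoot b] := by
        simp only [ht.isLeftRoot, h.isLeftRoot_iff hbs]
        rw [List.filter_eq, List.count_eq_one_of_mem (List.nodup_finRange n) (List.mem_finRange _)]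
        rfl
      rw [this]
      rfl
    have hr : tabs 18 b b ↔ i ∈ (R.data (labels R)).roots :=
      (ht.isRootLabel b).trans RootedGraph.Valid.mem_roots.symm
    simp [hl]
    refine ⟨?_, rfl, rfl⟩
    by_cases hi : tabs 18 b b
    · exact (if_pos hi).trans (if_pos (hr.1 hi)).symm
    · exact (if_neg hi).trans (if_neg fun h => hi (hr.2 h)).symm

end HammockTables

/-- Every series-parallel graph with a root and a BFS tree has a hammock decomposition, and some
deterministic program computes one in a number of steps polynomial in the number of vertices. -/
theorem mainTheorem3 :
    (∀ (V : Type*) [Finite V] (G : SimpleGraph V) (w : Sym2 V → ℕ) (r : V) (T : SimpleGraph V),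
      IsInstance G w r T → ∃ D : HammockData V, D.IsHammockDecomposition G w r T) ∧
    (∃ (P : RAMProgram) (p : Polynomial ℕ),
      ∀ (n : ℕ) (G : SimpleGraph (Fin n)) (w : Sym2 (Fin n) → ℕ) (r : Fin n)
        (T : SimpleGraph (Fin n)), IsInstance G w r T →
        ∃ (D : HammockData (Fin n)) (s : RAMState) (t : ℕ),
          D.IsHammockDecomposition G w r T ∧
          P.Exec (RAMState.init (encodeInput G w r T)) s t ∧
          t ≤ p.eval n ∧ s.Outputs D.encode) := by
  refine ⟨fun V _ G w r T hI => hI.exists_isHammockDecomposition, ?_⟩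
  -- The three decisions check that variables are bound and that each table refers only to earlier
  -- ones.
  obtain ⟨P, p, h⟩ := exists_program HammockTables.tables HammockTables.countWord
    HammockTables.mainWord (by decide) (by decide) (by decide)
  refine ⟨P, p, fun n G w r T hI => ?_⟩
  obtain ⟨tabs, s, t, h0, h1, hd, hP, ht, hs⟩ := h n G w r T hI.weight_pos
  have hv : (RootedGraph.mk G T r).Valid := hI.valid
  refine ⟨_, s, t, RootedGraph.isHammockDecomposition_data hI
    (l := HammockTables.labels ⟨G, T, r⟩) (fun b => ?_) ?_, hP, ht, ?_⟩
  · simp [HammockTables.labels]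
  · exact (List.nodup_finRange n).filter _
  · rwa [← HammockTables.encode_data hv (HammockTables.correct_of_defines hv.isTree h0 h1 hd)]
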